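/- Let $f_1,f_2,f_3$ be the left-invariant frame of $\mathrm{SL}(2,\mathbb R)$ given by the basis $\begin{pmatrix}0&-1\\1&0\end{pmatrix}$, $\begin{pmatrix}1&0\\0&-1\end{pmatrix}$, $\begin{pmatrix}0&1\\1&0\end{pmatrix}$ of $\mathfrak{sl}(2,\mathbb R)$, so that $[f_2,f_3]=-2f_1$, $[f_3,f_1]=2f_2$, $[f_1,f_2]=2f_3$, and let $f^1,f^2,f^3$ be the dual frame. The cross curvature tensor of a metric $g$ on a $3$-manifold is $h_{ij}=\det(g_{kl})\,\mathrm{adj}(E^{kl})_{ij}$, where $E=\mathrm{Rc}-\frac R2 g$; in an orthonormal frame diagonalizing the Ricci tensor, with principal sectional curvatures $k_1,k_2,k_3$, it is diagonal with $h_{11}=k_2k_3$, $h_{22}=k_3k_1$, $h_{33}=k_1k_2$. The cross curvature flow is $\partial_t g=-2h$, considered on left-invariant Riemannian metrics of $\mathrm{SL}(2,\mathbb R)$. Let $Q=\{(a,b,c)\in\mathbb R^3: a>0,\ b>c>0\}$. For every $(a,b,c)\in Q$ there is a maximal solution $g(t)$, $t\in(-T_b,T_f)$, with $0<T_b,T_f\le\infty$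 and $g(0)=a f^1\otimes f^1+b f^2\otimes f^2+c f^3\otimes f^3$, and every such maximal solution has the form $g(t)=A(t)f^1\otimes f^1+B(t)f^2\otimes f^2+C(t)f^3\otimes f^3$. Consider the following behaviors, each of which includes $T_b<\infty$ and refers to the limit $t\to -T_b$: 1. $A(t)\sim\eta_1(t+T_b)^{-1/14}$, $B(t)\sim\eta_2(t+T_b)^{3/14}$, $C(t)\sim\eta_3(t+T_b)^{3/14}$ for some constants $\eta_1,\eta_2,\eta_3\in(0,\infty)$; 2. $A(t)\sim\eta_1(t+T_b)^{3/14}$, $B(t)\sim\eta_2(t+T_b)^{-1/14}$, $C(t)\sim\eta_3(t+T_b)^{3/14}$ for some constants $\eta_1,\eta_2,\eta_3\in(0,\infty)$; 3. $A(t)\sim 64\,\eta^{-1}(t+T_b)$, $B(t)-\eta\sim 4\sqrt{2(t+T_b)}$, $C(t)-\eta\sim-4\sqrt{2(t+T_b)}$ for some $\eta\in(0,\infty)$. Then there is an open dense subset $Q_0$ of $Q$ such that every maximal solution with initial condition in $Q_0$ has behavior 1 or behavior 2. In fact, let $Q_1$ (resp. $Q_2$) be the set of initial conditions in $Q$ for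 which behavior 1 (resp. 2) occurs. Then there is a smooth embedded hypersurface $S_0\subset Q$ such that $Q\setminus S_0$ has exactly two connected components, namely $Q_1$ and $Q_2$. Moreover $S_0$ is exactly the set of initial conditions in $Q$ for which behavior 3 occurs, and also exactly the set of those for which $$\tfrac13\bigl(2\sqrt{B^2-BC+C^2}-B-C\bigr)\le A<B-C\qquad\text{for all } t\in(-T_b,0).$$ -/

import Mathlib

open Filter Topology Asymptotics
open scoped ContDiff Matrix

noncomputable section

namespace SL2XCF

/-! ### The Lie algebra `sl(2,ℝ)` and its standard Milnor frame -/

/-- The frame `f₁ = W`, `f₂ = H`, `f₃ = V` of `sl(2,ℝ)`; `f₁` generates the rotations. -/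
def milnorFrame : Fin 3 → Matrix (Fin 2) (Fin 2) ℝ :=
  ![!![0, -1; 1, 0], !![1, 0; 0, -1], !![0, 1; 1, 0]]

/-- Structure constants of `sl(2,ℝ)` in this frame, `[fᵢ, fⱼ] = ∑ₖ cᵢⱼᵏ fₖ`:
`[f₂, f₃] = -2 f₁`, `[f₃, f₁] = 2 f₂`, `[f₁, f₂] = 2 f₃`. -/
def structureConst : Fin 3 → Fin 3 → Fin 3 → ℝ :=
  ![![![0, 0, 0], ![0, 0, 2], ![0, -2, 0]],
    ![![0, 0, -2], ![0, 0, 0], ![-2, 0, 0]],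
    ![![0, 2, 0], ![2, 0, 0], ![0, 0, 0]]]

theorem bracket_milnorFrame (i j : Fin 3) :
    ⁅milnorFrame i, milnorFrame j⁆ = ∑ k, structureConst i j k • milnorFrame k := by
  rw [Ring.lie_def]
  fin_cases i <;> fin_cases j <;> ext a b <;> fin_cases a <;> fin_cases b <;>
    simp [milnorFrame, structureConst, Fin.sum_univ_three] <;> norm_num

/-- The frame is a basis of the trace-free matrices. -/
theorem existsUnique_coord_milnorFrame (X : Matrix (Fin 2) (Fin 2) ℝ) (hX : X.trace = 0) :
    ∃! x : Fin 3 → ℝ, X = ∑ k, x k • milnorFrame k := by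
  have h : X 1 1 = -X 0 0 := by
    have : X 0 0 + X 1 1 = 0 := by simpa [Matrix.trace, Fin.sum_univ_two] using hX
    linarith
  refine ⟨![(X 1 0 - X 0 1) / 2, X 0 0, (X 1 0 + X 0 1) / 2], ?_, ?_⟩
  · ext a b
    fin_cases a <;> fin_cases b <;> simp [milnorFrame, Fin.sum_univ_three, h] <;> ring
  · intro y hy
    have e00 := congrFun (congrFun hy 0) 0
    have e01 := congrFun (congrFun hy 0) 1
    have e10 := congrFun (congrFun hy 1) 0
    simp [milnorFrame, Fin.sum_univ_three] at e00 e01 e10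
    ext k
    fin_cases k <;> simp <;> linarith

/-! ### Left-invariant Riemannian geometry of `SL(2,ℝ)`

A left-invariant metric on `SL(2,ℝ)` is an inner product on `sl(2,ℝ)`, recorded by its Gram matrix
`g i j = g(fᵢ, fⱼ)` in the frame; other left-invariant tensors are recorded by their components. -/

/-- `g([fᵢ, fⱼ], fₗ)`. -/
def bracketInner (g : Matrix (Fin 3) (Fin 3) ℝ) (i j l : Fin 3) : ℝ :=
  ∑ m, structureConst i j m * g m l

/-- Levi-Civita connection, `∇_{fᵢ} fⱼ = ∑ₖ Γᵢⱼᵏ fₖ`, by the Koszul formula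
`2 g(∇_X Y, Z) = g([X,Y],Z) - g([Y,Z],X) + g([Z,X],Y)` for left-invariant fields. -/
def christoffel (g : Matrix (Fin 3) (Fin 3) ℝ) (i j k : Fin 3) : ℝ :=
  ∑ l, (1 / 2) * (bracketInner g i j l - bracketInner g j l i + bracketInner g l i j) * g⁻¹ l k

/-- Riemann curvature: the `fₗ`-component of
`R(fᵢ, fⱼ) fₖ = ∇_{fᵢ} ∇_{fⱼ} fₖ - ∇_{fⱼ} ∇_{fᵢ} fₖ - ∇_{[fᵢ, fⱼ]} fₖ`. -/
def riemann (g : Matrix (Fin 3) (Fin 3) ℝ) (i j k l : Fin 3) : ℝ :=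
  ∑ m, (christoffel g j k m * christoffel g i m l - christoffel g i k m * christoffel g j m l
    - structureConst i j m * christoffel g m k l)

/-- Ricci tensor, `Rc(Y, Z) = tr (X ↦ R(X, Y) Z)`. -/
def ricci (g : Matrix (Fin 3) (Fin 3) ℝ) : Matrix (Fin 3) (Fin 3) ℝ :=
  Matrix.of fun j k => ∑ i, riemann g i j k i

/-- Scalar curvature. -/
def scalarCurv (g : Matrix (Fin 3) (Fin 3) ℝ) : ℝ := ∑ j, ∑ k, g⁻¹ j k * ricci g j k

/-- Einstein tensor `E = Rc - (R/2) g`. -/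
def einstein (g : Matrix (Fin 3) (Fin 3) ℝ) : Matrix (Fin 3) (Fin 3) ℝ :=
  ricci g - (scalarCurv g / 2) • g

/-- Cross curvature tensor: with `Eⁱʲ` the Einstein tensor with raised indices, `h` is
`det(Eᵏˡ) / det(gᵏˡ)` times the inverse of `Eⁱʲ`, where `det • inverse` is read as the adjugate so
that no sign or nondegeneracy of the curvature is needed. In an orthonormal frame which
diagonalizes the Ricci tensor, with principal sectional curvatures `k₁, k₂, k₃`, this is
`h₁₁ = k₂ k₃`, `h₂₂ = k₃ k₁`, `h₃₃ = k₁ k₂`. -/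
def crossCurv (g : Matrix (Fin 3) (Fin 3) ℝ) : Matrix (Fin 3) (Fin 3) ℝ :=
  g.det • (g⁻¹ * einstein g * g⁻¹).adjugate

/-! ### The cross curvature flow -/

/-- The open interval `(-Tb, Tf)`, with possibly infinite end points. -/
def timeInterval (Tb Tf : EReal) : Set ℝ := {t : ℝ | -Tb < (t : EReal) ∧ (t : EReal) < Tf}

/-- `g` is a solution of `∂g/∂t = -2h` on `I` through left-invariant metrics. -/
def IsXCF (I : Set ℝ) (g : ℝ → Matrix (Fin 3) (Fin 3) ℝ) : Prop :=
  ∀ t ∈ I, (g t).PosDef ∧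
    ∀ i j, HasDerivAt (fun s => g s i j) (-2 * crossCurv (g t) i j) t

/-- `g` on `(-Tb, Tf) ∋ 0` is a maximal solution with initial metric
`a f¹⊗f¹ + b f²⊗f² + c f³⊗f³`, `p = (a, b, c)`: it has no proper extension to a solution on a larger
open interval. -/
structure IsMaximalXCF (p : ℝ × ℝ × ℝ) (Tb Tf : EReal)
    (g : ℝ → Matrix (Fin 3) (Fin 3) ℝ) : Prop where
  Tb_pos : 0 < Tb
  Tf_pos : 0 < Tf
  init : g 0 = Matrix.diagonal ![p.1, p.2.1, p.2.2]
  flow : IsXCF (timeInterval Tb Tf) g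
  maximal : ∀ (Tb' Tf' : EReal) (g' : ℝ → Matrix (Fin 3) (Fin 3) ℝ),
    Tb ≤ Tb' → Tf ≤ Tf' → IsXCF (timeInterval Tb' Tf') g' →
    (∀ t ∈ timeInterval Tb Tf, g' t = g t) → Tb' = Tb ∧ Tf' = Tf

/-- Case 1: `Tb < ∞` and, as `t → -Tb`,
`A ~ η₁ (t+Tb)^(-1/14)`, `B ~ η₂ (t+Tb)^(3/14)`, `C ~ η₃ (t+Tb)^(3/14)`. -/
def Case1 (Tb : EReal) (A B C : ℝ → ℝ) : Prop :=
  ∃ T : ℝ, Tb = (T : EReal) ∧ ∃ η₁ η₂ η₃ : ℝ, 0 < η₁ ∧ 0 < η₂ ∧ 0 < η₃ ∧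
    A ~[𝓝[>] (-T)] (fun t => η₁ * (t + T) ^ (-(1 / 14) : ℝ)) ∧
    B ~[𝓝[>] (-T)] (fun t => η₂ * (t + T) ^ (3 / 14 : ℝ)) ∧
    C ~[𝓝[>] (-T)] (fun t => η₃ * (t + T) ^ (3 / 14 : ℝ))

/-- Case 2: `Tb < ∞` and, as `t → -Tb`,
`A ~ η₁ (t+Tb)^(3/14)`, `B ~ η₂ (t+Tb)^(-1/14)`, `C ~ η₃ (t+Tb)^(3/14)`. -/
def Case2 (Tb : EReal) (A B C : ℝ → ℝ) : Prop :=
  ∃ T : ℝ, Tb = (T : EReal) ∧ ∃ η₁ η₂ η₃ : ℝ, 0 < η₁ ∧ 0 < η₂ ∧ 0 < η₃ ∧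
    A ~[𝓝[>] (-T)] (fun t => η₁ * (t + T) ^ (3 / 14 : ℝ)) ∧
    B ~[𝓝[>] (-T)] (fun t => η₂ * (t + T) ^ (-(1 / 14) : ℝ)) ∧
    C ~[𝓝[>] (-T)] (fun t => η₃ * (t + T) ^ (3 / 14 : ℝ))

/-- Case 3, behavior: `Tb < ∞` and, as `t → -Tb`, `A ~ 64 η⁻¹ (t+Tb)`, and `B`, `C` have the first
order expansions `η ± 4 √(2(t+Tb))`, i.e. `B - η ~ 4 √(2(t+Tb))` and `C - η ~ -4 √(2(t+Tb))`. -/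
def Case3 (Tb : EReal) (A B C : ℝ → ℝ) : Prop :=
  ∃ T : ℝ, Tb = (T : EReal) ∧ ∃ η : ℝ, 0 < η ∧
    A ~[𝓝[>] (-T)] (fun t => 64 * η⁻¹ * (t + T)) ∧
    (fun t => B t - η) ~[𝓝[>] (-T)] (fun t => 4 * √(2 * (t + T))) ∧
    (fun t => C t - η) ~[𝓝[>] (-T)] (fun t => -(4 * √(2 * (t + T))))

/-- Case 3, defining condition: `(2√(B²-BC+C²) - B - C)/3 ≤ A < B - C` at all times `t < 0`. -/
def Case3Condition (Tb : EReal) (A B C : ℝ → ℝ) : Prop :=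
  ∀ t : ℝ, -Tb < (t : EReal) → t < 0 →
    (1 / 3) * (2 * √(B t ^ 2 - B t * C t + C t ^ 2) - B t - C t) ≤ A t ∧ A t < B t - C t

/-- The initial conditions `Q = {a > 0, b > c > 0}`. -/
def Q : Set (ℝ × ℝ × ℝ) := {p | 0 < p.1 ∧ p.2.2 < p.2.1 ∧ 0 < p.2.2}

/-- The initial conditions in `Q` for which the maximal solution satisfies `P Tb A B C`, where
`A, B, C` are the coefficients of `f¹⊗f¹`, `f²⊗f²`, `f³⊗f³`. -/
def initialSet (P : EReal → (ℝ → ℝ) → (ℝ → ℝ) → (ℝ → ℝ) → Prop) : Set (ℝ × ℝ × ℝ) :=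
  {p | p ∈ Q ∧ ∀ (Tb Tf : EReal) (g : ℝ → Matrix (Fin 3) (Fin 3) ℝ), IsMaximalXCF p Tb Tf g →
    P Tb (fun t => g t 0 0) (fun t => g t 1 1) (fun t => g t 2 2)}

/-- Smooth embedded hypersurface: locally the zero set of a smooth function without critical
points. -/
def IsSmoothEmbeddedHypersurface {E : Type*} [NormedAddCommGroup E] [NormedSpace ℝ E]
    (S : Set E) : Prop :=
  ∀ p ∈ S, ∃ U : Set E, IsOpen U ∧ p ∈ U ∧ ∃ f : E → ℝ,
    ContDiffOn ℝ ∞ f U ∧ (∀ x ∈ U, fderiv ℝ f x ≠ 0) ∧ S ∩ U = {x ∈ U | f x = 0}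

/-- The set of connected components of `X`. -/
def componentsOf {E : Type*} [TopologicalSpace E] (X : Set E) : Set (Set E) :=
  {Y | ∃ x ∈ X, Y = connectedComponentIn X x}

end SL2XCF

end

/-! In the Milnor frame the cross curvature of a diagonal metric is diagonal. Uniqueness for the
matrix equation therefore forces every solution with diagonal initial value to stay diagonal, and
the flow becomes an ODE for (A, B, C). Let X, Y, Z be ABC times the sectional curvatures of f₂∧f₃,
f₃∧f₁, f₁∧f₂, and k = 2/(ABC)². In reversed time the logarithmic derivatives of A, B, C are kYZ,
kZX, kXY; the inequality B > C persists, and it gives Z > 0.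

Two disjoint regions trap orbits in reversed time: A ≥ B - C, because A - (B - C) can only increase
through zero (`sub_lt_A`), and X ≥ 0, because X can only increase through zero (`curvX_pos`). In the
first region A comes to dominate, in the second B. If P is the dominating coefficient, two of X, Y,
Z are close to P² and the third to -3P². Hence the other two coefficients are comparable to P⁻³, and
P⁻¹⁴ is asymptotically linear in the remaining time. This is the origin of the exponents -1/14 and
3/14 (`exists_power_law`).

An orbit avoiding both regions (`Stays`) degenerates: A → 0 and B, C → η > 0. The quotient q = (B -
C)²/A then obeys an equation for which 2η is a repelling equilibrium. If q did not converge to 2η it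
would be driven either above the bound imposed by X < 0, or to zero so fast that A < B - C fails
(`tendsto_quot`). From q → 2η follows the third behavior.

The two basins are open by continuous dependence. Each line with b, c fixed is connected and meets
both basins, so it contains a point with the third behavior. That point is unique: in the
scale-invariant coordinates x = C/B, y = A/B such orbits are graphs y(x) up to x = 1, where the
logarithmic derivative of y increases with y (`slope_lt_slope`). The ratio of two distinct graphs
would move away from 1, yet both are asymptotic to (1 - x)²/2 (`div_le_of_stays`). Hence the third
set is a graph a = bφ(c/b). Its profile φ solves a first order ODE and so is smooth. The two sides
of the graph are connected and avoid the third set, so each is exactly one basin. -/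

/-! ### Autonomous ODEs: uniqueness, extension, maximal solutions, continuous dependence -/

open Set in
/-- `γ` solves the autonomous ODE `γ' = v(γ)` in the set `U` at all times in `I`. -/
def SolvesOn {E : Type*} [NormedAddCommGroup E] [NormedSpace ℝ E] (v : E → E) (U : Set E)
    (γ : ℝ → E) (I : Set ℝ) : Prop :=
  ∀ t ∈ I, γ t ∈ U ∧ HasDerivAt γ (v (γ t)) t

namespace SolvesOn

open Set

variable {E : Type*} [NormedAddCommGroup E] [NormedSpace ℝ E] {v : E → E} {U : Set E}
  {γ δ : ℝ → E} {I J : Set ℝ}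

theorem mono (h : SolvesOn v U γ I) (hJ : J ⊆ I) : SolvesOn v U γ J := fun t ht => h t (hJ ht)

theorem congr (h : SolvesOn v U γ I) (hI : IsOpen I) (he : EqOn δ γ I) : SolvesOn v U δ I := by
  intro t ht
  rw [he ht]
  exact ⟨(h t ht).1, (h t ht).2.congr_of_eventuallyEq (he.eventuallyEq_of_mem (hI.mem_nhds ht))⟩

theorem comp_neg (h : SolvesOn v U γ I) :
    SolvesOn (fun x => -v x) U (fun t => γ (-t)) {t | -t ∈ I} := by
  intro t ht
  refine ⟨(h _ ht).1, ?_⟩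
  simpa [Function.comp_def] using (h _ ht).2.scomp t (hasDerivAt_neg t)

/-- Uniqueness for locally `C¹` vector fields. -/
theorem eqOn (hv : ∀ x ∈ U, ContDiffAt ℝ 1 v x) (hγ : SolvesOn v U γ I) (hδ : SolvesOn v U δ I)
    (hI : IsOpen I) (hI' : IsPreconnected I) {t₀ : ℝ} (ht₀ : t₀ ∈ I) (h0 : γ t₀ = δ t₀) :
    EqOn γ δ I := by
  have key : ∀ t ∈ I, γ t = δ t → γ =ᶠ[𝓝 t] δ := by
    intro t ht he
    obtain ⟨K, s, hs, hL⟩ := (hv _ (hγ t ht).1).exists_lipschitzOnWith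
    have e1 : ∀ᶠ τ in 𝓝 t, τ ∈ I := hI.mem_nhds ht
    have e2 : ∀ᶠ τ in 𝓝 t, γ τ ∈ s := (hγ t ht).2.continuousAt hs
    have e3 : ∀ᶠ τ in 𝓝 t, δ τ ∈ s := (hδ t ht).2.continuousAt (by rwa [← he])
    refine ODE_solution_unique_of_eventually (v := fun _ => v) (s := fun _ => s) (K := K)
      (Eventually.of_forall fun _ => hL) ?_ ?_ he
    · filter_upwards [e1, e2] with τ h1 h2 using ⟨(hγ τ h1).2, h2⟩
    · filter_upwards [e1, e3] with τ h1 h2 using ⟨(hδ τ h1).2, h2⟩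
  -- The times at which the germs agree form an open set. It is also relatively closed: at a limit
  -- of such times continuity gives equal values, and local uniqueness upgrades this to equal germs.
  have hu : IsOpen {t | γ =ᶠ[𝓝 t] δ} := isOpen_setOfPred_eventually_nhds
  have := hI'.subset_of_closure_inter_subset hu ⟨t₀, ht₀, key t₀ ht₀ h0⟩ (by
    rintro t ⟨htc, ht⟩
    apply key t ht
    rw [mem_closure_iff_frequently] at htc
    have hc : ContinuousAt (fun τ => γ τ - δ τ) t :=
      (hγ t ht).2.continuousAt.sub (hδ t ht).2.continuousAt
    by_contra hne
    have h1 : ∀ᶠ τ in 𝓝 t, γ τ - δ τ ≠ 0 := hc.eventually_ne (sub_ne_zero.2 hne)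
    obtain ⟨τ, h2, h3⟩ := (htc.and_eventually h1).exists
    exact h3 (sub_eq_zero.2 h2.self_of_nhds))
  exact fun t ht => (this ht).self_of_nhds

/-- A solution with a limit in `U` at the right end point extends. -/
theorem exists_extend_right [CompleteSpace E] (hU : IsOpen U) (hv : ∀ x ∈ U, ContDiffAt ℝ 1 v x)
    {a b : ℝ} (hab : a < b) (hγ : SolvesOn v U γ (Ioo a b)) {x : E} (hx : x ∈ U)
    (hlim : Tendsto γ (𝓝[<] b) (𝓝 x)) :
    ∃ ε > 0, ∃ δ : ℝ → E, SolvesOn v U δ (Ioo a (b + ε)) ∧ EqOn δ γ (Ioo a b) := by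
  obtain ⟨α, hα0, ε, hε, hα⟩ :=
    (hv x hx).exists_forall_mem_closedBall_exists_eq_forall_mem_Ioo_hasDerivAt₀ b
  have hb : b ∈ Ioo (b - ε) (b + ε) := ⟨by linarith, by linarith⟩
  have hαc : ∀ᶠ t in 𝓝 b, α t ∈ U :=
    (hα b hb).continuousAt (by rw [hα0]; exact hU.mem_nhds hx)
  obtain ⟨ε', hε', hball⟩ := Metric.eventually_nhds_iff_ball.1 hαc
  rw [Real.ball_eq_Ioo] at hball
  let δ : ℝ → E := fun t => if t < b then γ t else α t
  have hδγ : ∀ t < b, δ t = γ t := fun t ht => if_pos ht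
  have hδα : ∀ t, b ≤ t → δ t = α t := fun t ht => if_neg (not_lt.2 ht)
  have hδlt : ∀ t ∈ Ioo a b, HasDerivAt δ (v (δ t)) t := by
    intro t ht
    rw [hδγ t ht.2]
    refine (hγ t ht).2.congr_of_eventuallyEq ?_
    filter_upwards [Iio_mem_nhds ht.2] with τ hτ using hδγ τ hτ
  have hδb : δ b = x := by rw [hδα b le_rfl, hα0]
  refine ⟨min ε ε', lt_min hε hε', δ, ?_, fun t ht => hδγ t ht.2⟩
  intro t ht
  rcases lt_trichotomy t b with h | h | h
  · exact ⟨by rw [hδγ t h]; exact (hγ t ⟨ht.1, h⟩).1, hδlt t ⟨ht.1, h⟩⟩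
  · subst h
    refine ⟨by rwa [hδb], ?_⟩
    have hev : δ =ᶠ[𝓝[<] t] γ := by
      filter_upwards [self_mem_nhdsWithin] with τ hτ using hδγ τ hτ
    have hlim' : Tendsto δ (𝓝[<] t) (𝓝 x) := hlim.congr' hev.symm
    -- Nothing is known about γ at the junction itself. The left derivative is recovered as the
    -- limit of v(δ τ), which exists because v is continuous at x.
    have hleft : HasDerivWithinAt δ (v (δ t)) (Iic t) t := by
      have hmem : Ioo a t ∈ 𝓝[<] t := Ioo_mem_nhdsLT hab
      refine hasDerivWithinAt_Iic_of_tendsto_deriv (s := Ioo a t)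
        (fun τ hτ => (hδlt τ hτ).differentiableAt.differentiableWithinAt) ?_ hmem ?_
      · rw [ContinuousWithinAt, hδb]
        exact hlim'.mono_left (nhdsWithin_mono _ Ioo_subset_Iio_self)
      · rw [hδb]
        have : Tendsto (fun τ => v (δ τ)) (𝓝[<] t) (𝓝 (v x)) :=
          (hv x hx).continuousAt.tendsto.comp hlim'
        refine this.congr' ?_
        filter_upwards [hmem] with τ hτ using (hδlt τ hτ).deriv.symm
    have hright : HasDerivWithinAt δ (v (δ t)) (Ici t) t := by
      have h1 : HasDerivWithinAt α (v (δ t)) (Ici t) t := by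
        rw [hδα t le_rfl]; exact (hα t hb).hasDerivWithinAt
      exact h1.congr (fun τ hτ => hδα τ hτ) (hδα t le_rfl)
    simpa using (hleft.union hright).hasDerivAt (by simp)
  · have h1 : t ∈ Ioo (b - ε) (b + ε) :=
      ⟨by linarith, ht.2.trans_le (by linarith [min_le_left ε ε'])⟩
    have h2 : t ∈ Ioo (b - ε') (b + ε') :=
      ⟨by linarith, ht.2.trans_le (by linarith [min_le_right ε ε'])⟩
    rw [hδα t h.le]
    refine ⟨hball t h2, (hα t h1).congr_of_eventuallyEq ?_⟩
    filter_upwards [Ioi_mem_nhds h] with τ hτ using hδα τ (le_of_lt hτ)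

/-- A solution with a limit in `U` at the left end point extends. -/
theorem exists_extend_left [CompleteSpace E] (hU : IsOpen U) (hv : ∀ x ∈ U, ContDiffAt ℝ 1 v x)
    {a b : ℝ} (hab : a < b) (hγ : SolvesOn v U γ (Ioo a b)) {x : E} (hx : x ∈ U)
    (hlim : Tendsto γ (𝓝[>] a) (𝓝 x)) :
    ∃ ε > 0, ∃ δ : ℝ → E, SolvesOn v U δ (Ioo (a - ε) b) ∧ EqOn δ γ (Ioo a b) := by
  have h1 : SolvesOn (fun x => -v x) U (fun t => γ (-t)) (Ioo (-b) (-a)) :=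
    hγ.comp_neg.mono fun t ht => ⟨by linarith [ht.2], by linarith [ht.1]⟩
  have h2 : Tendsto (fun t => γ (-t)) (𝓝[<] (-a)) (𝓝 x) :=
    hlim.comp (tendsto_neg_nhdsLT_neg (a := a))
  obtain ⟨ε, hε, δ, hδ, he⟩ := h1.exists_extend_right hU (fun x hx => (hv x hx).neg)
    (neg_lt_neg hab) hx h2
  refine ⟨ε, hε, fun t => δ (-t), ?_, ?_⟩
  · have := hδ.comp_neg.mono (J := Ioo (a - ε) b)
      fun t ht => ⟨by linarith [ht.2], by linarith [ht.1]⟩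
    simpa using this
  · intro t ht
    have := he (x := -t) ⟨by linarith [ht.2], by linarith [ht.1]⟩
    simpa using this

open SL2XCF in
/-- Existence of maximal solutions: at a finite end point the solution has no limit in `U`. -/
theorem exists_maximal [CompleteSpace E] (hU : IsOpen U) (hv : ∀ x ∈ U, ContDiffAt ℝ 1 v x)
    {p : E} (hp : p ∈ U) :
    ∃ (Tb Tf : EReal) (γ : ℝ → E), 0 < Tb ∧ 0 < Tf ∧ γ 0 = p ∧
      SolvesOn v U γ (timeInterval Tb Tf) ∧
      (∀ T : ℝ, Tf = T → ∀ x ∈ U, ¬ Tendsto γ (𝓝[<] T) (𝓝 x)) ∧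
      (∀ T : ℝ, Tb = T → ∀ x ∈ U, ¬ Tendsto γ (𝓝[>] (-T)) (𝓝 x)) := by
  classical
  -- Pairs of admissible backward and forward life spans. The suprema of the two components are
  -- taken separately, which is harmless because each time needs an adequate span on its own side of
  -- 0 only.
  let S : Set (ℝ × ℝ) :=
    {ab | 0 < ab.1 ∧ 0 < ab.2 ∧ ∃ δ, δ 0 = p ∧ SolvesOn v U δ (Ioo (-ab.1) ab.2)}
  have hS : ∀ ab : S, ∃ δ, δ 0 = p ∧ SolvesOn v U δ (Ioo (-ab.1.1) ab.1.2) := fun ab => ab.2.2.2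
  choose δ hδ0 hδ using hS
  have agree : ∀ ab cd : S, ∀ t ∈ Ioo (-ab.1.1) ab.1.2, t ∈ Ioo (-cd.1.1) cd.1.2 →
      δ ab t = δ cd t := by
    intro ab cd t h1 h2
    refine eqOn (I := Ioo (-ab.1.1) ab.1.2 ∩ Ioo (-cd.1.1) cd.1.2) hv
      ((hδ ab).mono inter_subset_left) ((hδ cd).mono inter_subset_right)
      (isOpen_Ioo.inter isOpen_Ioo) ?_ (t₀ := 0) ?_ ((hδ0 ab).trans (hδ0 cd).symm) ⟨h1, h2⟩
    · exact (ordConnected_Ioo.inter ordConnected_Ioo).isPreconnected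
    · have := ab.2.1; have := ab.2.2.1; have := cd.2.1; have := cd.2.2.1
      constructor <;> constructor <;> linarith
  let Tf : EReal := ⨆ ab : S, (ab.1.2 : EReal)
  let Tb : EReal := ⨆ ab : S, (ab.1.1 : EReal)
  let γ : ℝ → E := fun t => if h : ∃ ab : S, t ∈ Ioo (-ab.1.1) ab.1.2 then δ h.choose t else p
  have hγδ : ∀ (ab : S), EqOn γ (δ ab) (Ioo (-ab.1.1) ab.1.2) := by
    intro ab t ht
    have h : ∃ ab : S, t ∈ Ioo (-ab.1.1) ab.1.2 := ⟨ab, ht⟩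
    change (if h : ∃ ab : S, t ∈ Ioo (-ab.1.1) ab.1.2 then δ h.choose t else p) = _
    rw [dif_pos h]
    exact agree _ _ t h.choose_spec ht
  have hγsol : ∀ ab : S, SolvesOn v U γ (Ioo (-ab.1.1) ab.1.2) :=
    fun ab => (hδ ab).congr isOpen_Ioo (hγδ ab)
  have hcov : ∀ t ∈ timeInterval Tb Tf, ∃ ab : S, t ∈ Ioo (-ab.1.1) ab.1.2 := by
    rintro t ⟨h1, h2⟩
    rcases le_or_gt 0 t with h0 | h0
    · obtain ⟨ab, hab⟩ := lt_iSup_iff.1 h2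
      exact ⟨ab, by linarith [ab.2.1], EReal.coe_lt_coe_iff.1 hab⟩
    · obtain ⟨ab, hab⟩ := lt_iSup_iff.1 (EReal.neg_lt_comm.1 h1)
      have : -t < ab.1.1 := by exact_mod_cast hab
      exact ⟨ab, by linarith, by linarith [ab.2.2.1]⟩
  obtain ⟨α, hα0, ε, hε, hα⟩ :=
    (hv p hp).exists_forall_mem_closedBall_exists_eq_forall_mem_Ioo_hasDerivAt₀ 0
  have hαc : ∀ᶠ t in 𝓝 (0 : ℝ), α t ∈ U :=
    (hα 0 ⟨by linarith, by linarith⟩).continuousAt (by rw [hα0]; exact hU.mem_nhds hp)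
  obtain ⟨ε', hε', hball⟩ := Metric.eventually_nhds_iff_ball.1 hαc
  rw [Real.ball_eq_Ioo] at hball
  have hε0 : 0 < min ε ε' := lt_min hε hε'
  let ab₀ : S := ⟨(min ε ε', min ε ε'), hε0, hε0, α, hα0, fun t ht => by
    have l := min_le_left ε ε'
    have r := min_le_right ε ε'
    have h1 : -min ε ε' < t := ht.1
    have h2 : t < min ε ε' := ht.2
    exact ⟨hball t ⟨by linarith, by linarith⟩, hα t ⟨by linarith, by linarith⟩⟩⟩
  have hTf : (min ε ε' : ℝ) ≤ Tf := le_iSup (fun ab : S => (ab.1.2 : EReal)) ab₀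
  have hTb : (min ε ε' : ℝ) ≤ Tb := le_iSup (fun ab : S => (ab.1.1 : EReal)) ab₀
  have hTf0 : 0 < Tf := lt_of_lt_of_le (by exact_mod_cast hε0) hTf
  have hTb0 : 0 < Tb := lt_of_lt_of_le (by exact_mod_cast hε0) hTb
  have hγ0 : γ 0 = p := by
    rw [hγδ ab₀ ⟨neg_lt_zero.2 hε0, hε0⟩, hδ0]
  have hsol : SolvesOn v U γ (timeInterval Tb Tf) := by
    intro t ht
    obtain ⟨ab, hab⟩ := hcov t ht
    exact hγsol ab t hab
  refine ⟨Tb, Tf, γ, hTb0, hTf0, hγ0, hsol, ?_, ?_⟩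
  · intro T hT x hx hlim
    have hT0 : 0 < T := by rw [hT] at hTf0; exact_mod_cast hTf0
    have h1 : SolvesOn v U γ (Ioo (-min ε ε') T) := by
      refine hsol.mono fun t ht => ⟨?_, ?_⟩
      · rw [EReal.neg_lt_comm]
        exact lt_of_lt_of_le (by exact_mod_cast (by linarith [ht.1] : -t < min ε ε')) hTb
      · rw [hT]; exact_mod_cast ht.2
    obtain ⟨e, he, β, hβ, hβe⟩ := h1.exists_extend_right hU hv (by linarith) hx hlim
    -- The extended solution contributes a forward life span larger than the supremum.
    let cd : S := ⟨(min ε ε', T + e), hε0, by simp only; linarith, β,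
      by rw [hβe ⟨by linarith, hT0⟩, hγ0], hβ⟩
    have : ((T + e : ℝ) : EReal) ≤ Tf := le_iSup (fun ab : S => (ab.1.2 : EReal)) cd
    rw [hT] at this
    have : T + e ≤ T := by exact_mod_cast this
    linarith
  · intro T hT x hx hlim
    have hT0 : 0 < T := by rw [hT] at hTb0; exact_mod_cast hTb0
    have h1 : SolvesOn v U γ (Ioo (-T) (min ε ε')) := by
      refine hsol.mono fun t ht => ⟨?_, ?_⟩
      · rw [EReal.neg_lt_comm, hT]
        exact_mod_cast (by linarith [ht.1] : -t < T)
      · exact lt_of_lt_of_le (by exact_mod_cast ht.2) hTf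
    obtain ⟨e, he, β, hβ, hβe⟩ := h1.exists_extend_left hU hv (by linarith) hx hlim
    let cd : S := ⟨(T + e, min ε ε'), by simp only; linarith, hε0, β,
      by rw [hβe ⟨by linarith, hε0⟩, hγ0], hβ.mono (by
        intro t ht; exact ⟨by have := ht.1; simp only at this; linarith, ht.2⟩)⟩
    have : ((T + e : ℝ) : EReal) ≤ Tb := le_iSup (fun ab : S => (ab.1.1 : EReal)) cd
    rw [hT] at this
    have : T + e ≤ T := by exact_mod_cast this
    linarith

/-- Continuous dependence: solutions starting close to `γ 0` exist up to time `t₁` and end in a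
given neighbourhood of `γ t₁`. -/
theorem eventually_mem_of_mem_open [ProperSpace E] (hU : IsOpen U)
    (hv : ∀ x ∈ U, ContDiffAt ℝ 1 v x) {t₁ : ℝ} (ht₁ : 0 ≤ t₁) (hγ : SolvesOn v U γ (Icc 0 t₁))
    {O : Set E} (hO : IsOpen O) (hmem : γ t₁ ∈ O) :
    ∀ᶠ q in 𝓝 (γ 0), ∀ (S : EReal) (δ : ℝ → E), 0 < S → δ 0 = q →
      SolvesOn v U δ {t | 0 ≤ t ∧ (t : EReal) < S} →
      (∀ T : ℝ, S = T → ∀ x ∈ U, ¬ Tendsto δ (𝓝[<] T) (𝓝 x)) →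
      (t₁ : EReal) < S ∧ δ t₁ ∈ O := by
  have hγc : ContinuousOn γ (Icc 0 t₁) := fun t ht => (hγ t ht).2.continuousAt.continuousWithinAt
  have hK : IsCompact (γ '' Icc 0 t₁) := isCompact_Icc.image_of_continuousOn hγc
  obtain ⟨r₁, hr₁, hr₁U⟩ := hK.exists_cthickening_subset_open hU
    (by rintro _ ⟨t, ht, rfl⟩; exact (hγ t ht).1)
  obtain ⟨r₂, hr₂, hr₂O⟩ := Metric.isOpen_iff.1 hO _ hmem
  set r := min r₁ r₂ with hr
  have hr0 : 0 < r := lt_min hr₁ hr₂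
  set N := Metric.cthickening r (γ '' Icc 0 t₁) with hN
  have hNU : N ⊆ U := (Metric.cthickening_mono (min_le_left _ _) _).trans hr₁U
  have hNc : IsCompact N := hK.cthickening
  have hNmem : ∀ t ∈ Icc 0 t₁, ∀ y, dist y (γ t) ≤ r → y ∈ N := fun t ht y hy =>
    Metric.mem_cthickening_of_dist_le y (γ t) r _ (mem_image_of_mem _ ht) hy
  obtain ⟨L, hL⟩ : ∃ L, LipschitzOnWith L v N := by
    refine LocallyLipschitzOn.exists_lipschitzOnWith_of_compact hNc fun x hx => ?_
    obtain ⟨K, s, hs, hKs⟩ := (hv x (hNU hx)).exists_lipschitzOnWith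
    exact ⟨K, s, mem_nhdsWithin_of_mem_nhds hs, hKs⟩
  have hexp : 0 < Real.exp (-(L * t₁)) := Real.exp_pos _
  -- Grönwall multiplies the initial distance by at most exp(L t₁), so solutions starting η-close
  -- remain r/2-close, strictly inside the tube of radius r.
  set η := r / 2 * Real.exp (-(L * t₁)) with hη
  have hη0 : 0 < η := by positivity
  filter_upwards [Metric.ball_mem_nhds (γ 0) hη0] with q hq S δ hS hδ0 hδ hesc
  have hηr : ∀ t ≤ t₁, η * Real.exp (L * (t - 0)) ≤ r / 2 := by
    intro t ht
    rw [hη, mul_assoc, ← Real.exp_add]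
    have : Real.exp (-(L * t₁) + L * (t - 0)) ≤ 1 := by
      rw [Real.exp_le_one_iff]
      have := mul_le_mul_of_nonneg_left ht L.2
      simp only [NNReal.val_eq_coe] at this
      linarith
    nlinarith
  have hδc : ∀ t : ℝ, 0 ≤ t → (t : EReal) < S → ContinuousOn δ (Icc 0 t) := fun t _ htS τ hτ =>
    (hδ τ ⟨hτ.1, lt_of_le_of_lt (by exact_mod_cast hτ.2) htS⟩).2.continuousAt.continuousWithinAt
  have close : ∀ t, 0 ≤ t → t ≤ t₁ → (t : EReal) < S → dist (δ t) (γ t) < r := by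
    intro t ht0 ht htS
    by_contra hcon
    push Not at hcon
    have hc : ContinuousOn (fun τ => dist (δ τ) (γ τ)) (Icc 0 t) :=
      continuous_dist.comp_continuousOn
        ((hδc t ht0 htS).prodMk (hγc.mono (Icc_subset_Icc_right ht)))
    have hclosed : IsCompact (Icc 0 t ∩ (fun τ => dist (δ τ) (γ τ)) ⁻¹' Ici r) :=
      isCompact_Icc.of_isClosed_subset (hc.preimage_isClosed_of_isClosed isClosed_Icc isClosed_Ici)
        inter_subset_left
    -- The first time at which the distance reaches r. Before it both curves lie in N, where v is
    -- Lipschitz, so the distance at τ is at most r/2.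
    obtain ⟨τ, ⟨hτ, hτr⟩, hmin⟩ := hclosed.exists_isLeast ⟨t, ⟨ht0, le_rfl⟩, hcon⟩
    have hτS : (τ : EReal) < S := lt_of_le_of_lt (by exact_mod_cast hτ.2) htS
    have hlt : ∀ σ ∈ Ico 0 τ, dist (δ σ) (γ σ) < r := by
      intro σ hσ
      by_contra h
      exact absurd (hmin ⟨⟨hσ.1, hσ.2.le.trans hτ.2⟩, not_lt.1 h⟩) (not_le.2 hσ.2)
    have hIco : ∀ σ ∈ Ico 0 τ, σ ∈ Icc 0 t₁ := fun σ hσ =>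
      ⟨hσ.1, hσ.2.le.trans (hτ.2.trans ht)⟩
    have hIcoS : ∀ σ ∈ Ico 0 τ, σ ∈ {t : ℝ | 0 ≤ t ∧ (t : EReal) < S} := fun σ hσ =>
      ⟨hσ.1, lt_of_le_of_lt (by exact_mod_cast hσ.2.le) hτS⟩
    have := dist_le_of_trajectories_ODE_of_mem (v := fun _ => v) (s := fun _ => N) (K := L)
      (fun _ _ => hL) (hδc τ hτ.1 hτS)
      (fun σ hσ => (hδ σ (hIcoS σ hσ)).2.hasDerivWithinAt)
      (fun σ hσ => hNmem σ (hIco σ hσ) _ (hlt σ hσ).le)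
      (hγc.mono (Icc_subset_Icc_right (hτ.2.trans ht)))
      (fun σ hσ => (hγ σ (hIco σ hσ)).2.hasDerivWithinAt)
      (fun σ hσ => hNmem σ (hIco σ hσ) _ (by simpa using hr0.le))
      (δ := η) (by rw [hδ0]; exact (Metric.mem_ball.1 hq).le) τ ⟨hτ.1, le_rfl⟩
    have h2 := hηr τ (hτ.2.trans ht)
    have h3 : r ≤ dist (δ τ) (γ τ) := hτr
    linarith
  have hlt : (t₁ : EReal) < S := by
    by_contra hcon
    push Not at hcon
    obtain ⟨T, rfl⟩ : ∃ T : ℝ, S = T := by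
      induction S with
      | bot => exact absurd hS (by simp)
      | coe T => exact ⟨T, rfl⟩
      | top => exact absurd hcon (by simp)
    have hT0 : 0 < T := by exact_mod_cast hS
    have hTt : T ≤ t₁ := by exact_mod_cast hcon
    have hin : ∀ τ ∈ Ico 0 T, δ τ ∈ N := fun τ hτ =>
      hNmem τ ⟨hτ.1, hτ.2.le.trans hTt⟩ _
        (close τ hτ.1 (hτ.2.le.trans hTt) (by exact_mod_cast hτ.2)).le
    obtain ⟨B, hB⟩ := (hNc.image_of_continuousOn hL.continuousOn).isBounded.exists_norm_le
    -- If the solution ended at T ≤ t₁, it would have bounded speed in the compact tube and hence a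
    -- limit in U, which the escape hypothesis forbids.
    have hlip : LipschitzOnWith (Real.toNNReal B) δ (Ico 0 T) := by
      refine (convex_Ico 0 T).lipschitzOnWith_of_nnnorm_hasDerivWithin_le (f' := fun τ => v (δ τ))
        (fun τ hτ => (hδ τ ⟨hτ.1, by exact_mod_cast hτ.2⟩).2.hasDerivWithinAt) fun τ hτ => ?_
      exact NNReal.le_toNNReal_of_coe_le (hB _ (mem_image_of_mem _ (hin τ hτ)))
    have hle : 𝓝[<] T ≤ 𝓟 (Ico 0 T) := by
      rw [le_principal_iff]
      exact mem_of_superset (Ioo_mem_nhdsLT hT0) Ioo_subset_Ico_self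
    have hcau : Cauchy (map δ (𝓝[<] T)) :=
      (cauchy_nhds.mono nhdsWithin_le_nhds).map_of_le hlip.uniformContinuousOn hle
    obtain ⟨x, hxN, hx⟩ := hNc.isComplete _ hcau (by
      rw [le_principal_iff, mem_map]
      exact mem_of_superset (le_principal_iff.1 hle) hin)
    exact hesc T rfl x (hNU hxN) hx
  exact ⟨hlt, hr₂O ((close t₁ ht₁ le_rfl hlt).trans_le (min_le_right _ _))⟩

end SolvesOn

/-! ### Curvature of diagonal left-invariant metrics -/

namespace SL2XCF

/-- `a b c` times the sectional curvature of the plane `f₂ ∧ f₃` for `diag (a, b, c)`. -/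
def curvX (a b c : ℝ) : ℝ := (b - c) ^ 2 - 2 * a * (b + c) - 3 * a ^ 2

/-- `a b c` times the sectional curvature of the plane `f₃ ∧ f₁` for `diag (a, b, c)`. -/
def curvY (a b c : ℝ) : ℝ := a ^ 2 - 2 * a * (b - c) - (b - c) * (3 * b + c)

/-- `a b c` times the sectional curvature of the plane `f₁ ∧ f₂` for `diag (a, b, c)`. -/
def curvZ (a b c : ℝ) : ℝ := a ^ 2 + 2 * a * (b - c) + (b - c) * (b + 3 * c)

theorem inv_diagonal_three {a b c : ℝ} (ha : a ≠ 0) (hb : b ≠ 0) (hc : c ≠ 0) :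
    (Matrix.diagonal ![a, b, c])⁻¹ = Matrix.diagonal ![a⁻¹, b⁻¹, c⁻¹] := by
  apply Matrix.inv_eq_right_inv
  rw [Matrix.diagonal_mul_diagonal, ← Matrix.diagonal_one]
  congr 1
  ext i
  fin_cases i <;> simp [ha, hb, hc]

theorem christoffel_diagonal {a b c : ℝ} (ha : a ≠ 0) (hb : b ≠ 0) (hc : c ≠ 0) :
    christoffel (Matrix.diagonal ![a, b, c]) =
      ![![![0, 0, 0], ![0, 0, (a + b + c) / c], ![0, -(a + b + c) / b, 0]],
        ![![0, 0, (a + b - c) / c], ![0, 0, 0], ![(c - a - b) / a, 0, 0]],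
        ![![0, (b - c - a) / b, 0], ![(a + c - b) / a, 0, 0], ![0, 0, 0]]] := by
  ext i j k
  simp only [christoffel, bracketInner, inv_diagonal_three ha hb hc]
  fin_cases i <;> fin_cases j <;> fin_cases k <;>
    simp [structureConst, Matrix.diagonal_apply] <;> field_simp <;> ring

theorem ricci_diagonal {a b c : ℝ} (ha : a ≠ 0) (hb : b ≠ 0) (hc : c ≠ 0) :
    ricci (Matrix.diagonal ![a, b, c]) =
      Matrix.diagonal ![(curvY a b c + curvZ a b c) / (b * c),
        (curvX a b c + curvZ a b c) / (a * c), (curvX a b c + curvY a b c) / (a * b)] := by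
  ext i j
  fin_cases i <;> fin_cases j <;>
    simp [ricci, riemann, christoffel_diagonal ha hb hc, structureConst, Fin.sum_univ_three,
      curvX, curvY, curvZ] <;>
    field_simp <;> ring

/-- In dimension three the Einstein tensor in each principal direction is minus the sectional
curvature of the orthogonal plane. Here this is multiplied by a, b or c because the frame is not
normalized. -/
theorem einstein_diagonal {a b c : ℝ} (ha : a ≠ 0) (hb : b ≠ 0) (hc : c ≠ 0) :
    einstein (Matrix.diagonal ![a, b, c]) =
      Matrix.diagonal ![-curvX a b c / (b * c), -curvY a b c / (a * c),
        -curvZ a b c / (a * b)] := by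
  rw [einstein, scalarCurv, ricci_diagonal ha hb hc, inv_diagonal_three ha hb hc]
  ext i j
  fin_cases i <;> fin_cases j <;> simp [Matrix.diagonal_apply, Fin.sum_univ_three] <;>
    field_simp <;> ring

theorem crossCurv_diagonal {a b c : ℝ} (ha : a ≠ 0) (hb : b ≠ 0) (hc : c ≠ 0) :
    crossCurv (Matrix.diagonal ![a, b, c]) =
      Matrix.diagonal ![a * curvY a b c * curvZ a b c / (a * b * c) ^ 2,
        b * curvZ a b c * curvX a b c / (a * b * c) ^ 2,
        c * curvX a b c * curvY a b c / (a * b * c) ^ 2] := by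
  rw [crossCurv, einstein_diagonal ha hb hc, inv_diagonal_three ha hb hc,
    Matrix.diagonal_mul_diagonal, Matrix.diagonal_mul_diagonal, Matrix.det_diagonal,
    Matrix.adjugate_fin_three]
  ext i j
  fin_cases i <;> fin_cases j <;> simp [Fin.prod_univ_three] <;>
    field_simp

/-! ### Smoothness of the cross curvature tensor -/

open Matrix in
theorem contDiffAt_det_three {g : Fin 3 → Fin 3 → ℝ} :
    ContDiffAt ℝ 1 (fun g : Fin 3 → Fin 3 → ℝ => (Matrix.of g).det) g := by
  simp only [Matrix.det_fin_three, Matrix.of_apply]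
  fun_prop

theorem contDiffAt_inv_three {g : Fin 3 → Fin 3 → ℝ} (hg : (Matrix.of g).det ≠ 0) (i j : Fin 3) :
    ContDiffAt ℝ 1 (fun g : Fin 3 → Fin 3 → ℝ => (Matrix.of g)⁻¹ i j) g := by
  simp only [Matrix.inv_def, Ring.inverse_eq_inv', Matrix.smul_apply, smul_eq_mul]
  refine (contDiffAt_det_three.inv hg).mul ?_
  simp only [Matrix.adjugate_fin_three, Matrix.of_apply]
  fin_cases i <;> fin_cases j <;> simp <;> fun_prop

theorem contDiffAt_bracketInner {g : Fin 3 → Fin 3 → ℝ} (i j k : Fin 3) :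
    ContDiffAt ℝ 1 (fun g : Fin 3 → Fin 3 → ℝ => bracketInner (Matrix.of g) i j k) g :=
  ContDiffAt.sum fun m _ => contDiffAt_const.mul (contDiff_apply_apply ℝ ℝ m k).contDiffAt

theorem contDiffAt_christoffel {g : Fin 3 → Fin 3 → ℝ} (hg : (Matrix.of g).det ≠ 0)
    (i j k : Fin 3) :
    ContDiffAt ℝ 1 (fun g : Fin 3 → Fin 3 → ℝ => christoffel (Matrix.of g) i j k) g :=
  ContDiffAt.sum fun l _ => (contDiffAt_const.mul (((contDiffAt_bracketInner i j l).sub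
    (contDiffAt_bracketInner j l i)).add (contDiffAt_bracketInner l i j))).mul
    (contDiffAt_inv_three hg l k)

theorem contDiffAt_ricci {g : Fin 3 → Fin 3 → ℝ} (hg : (Matrix.of g).det ≠ 0) (i j : Fin 3) :
    ContDiffAt ℝ 1 (fun g : Fin 3 → Fin 3 → ℝ => ricci (Matrix.of g) i j) g := by
  have h := contDiffAt_christoffel hg
  simp only [ricci, Matrix.of_apply, riemann]
  exact ContDiffAt.sum fun k _ => ContDiffAt.sum fun m _ =>
    (((h i j m).mul (h k m k)).sub ((h k j m).mul (h i m k))).sub (contDiffAt_const.mul (h m j k))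

theorem contDiffAt_einstein {g : Fin 3 → Fin 3 → ℝ} (hg : (Matrix.of g).det ≠ 0) (i j : Fin 3) :
    ContDiffAt ℝ 1 (fun g : Fin 3 → Fin 3 → ℝ => einstein (Matrix.of g) i j) g := by
  have h1 := contDiffAt_ricci hg
  have h2 := contDiffAt_inv_three hg
  have h3 : ContDiffAt ℝ 1 (fun g : Fin 3 → Fin 3 → ℝ => scalarCurv (Matrix.of g)) g :=
    ContDiffAt.sum fun k _ => ContDiffAt.sum fun m _ => (h2 k m).mul (h1 k m)
  exact (h1 i j).sub ((h3.div_const 2).mul (contDiff_apply_apply ℝ ℝ i j).contDiffAt)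

theorem contDiffAt_mul_three {M N : (Fin 3 → Fin 3 → ℝ) → Matrix (Fin 3) (Fin 3) ℝ}
    {g : Fin 3 → Fin 3 → ℝ} (hM : ∀ i j, ContDiffAt ℝ 1 (fun g => M g i j) g)
    (hN : ∀ i j, ContDiffAt ℝ 1 (fun g => N g i j) g) (i j : Fin 3) :
    ContDiffAt ℝ 1 (fun g => (M g * N g) i j) g := by
  simp only [Matrix.mul_apply]
  exact ContDiffAt.sum fun k _ => (hM i k).mul (hN k j)

theorem contDiffAt_adjugate_three {M : (Fin 3 → Fin 3 → ℝ) → Matrix (Fin 3) (Fin 3) ℝ}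
    {g : Fin 3 → Fin 3 → ℝ} (hM : ∀ i j, ContDiffAt ℝ 1 (fun g => M g i j) g) (i j : Fin 3) :
    ContDiffAt ℝ 1 (fun g => (M g).adjugate i j) g := by
  simp only [Matrix.adjugate_fin_three]
  fin_cases i <;> fin_cases j <;> simp <;>
    first
    | exact ((hM _ _).mul (hM _ _)).sub ((hM _ _).mul (hM _ _))
    | exact ((hM _ _).mul (hM _ _)).neg.add ((hM _ _).mul (hM _ _))

/-- Regularity is needed at all nondegenerate matrices and not only at diagonal ones: uniqueness
among arbitrary matrix solutions is what makes solutions with diagonal initial metric diagonal. -/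
theorem contDiffAt_crossCurv {g : Fin 3 → Fin 3 → ℝ} (hg : (Matrix.of g).det ≠ 0) (i j : Fin 3) :
    ContDiffAt ℝ 1 (fun g : Fin 3 → Fin 3 → ℝ => crossCurv (Matrix.of g) i j) g :=
  contDiffAt_det_three.mul (contDiffAt_adjugate_three (contDiffAt_mul_three (contDiffAt_mul_three
    (contDiffAt_inv_three hg) (contDiffAt_einstein hg)) (contDiffAt_inv_three hg)) i j)

end SL2XCF

/-! ### Reduction of the flow to diagonal metrics -/

namespace SL2XCF

open Set

/-- The positive octant. -/
def octant : Set (ℝ × ℝ × ℝ) := {p | 0 < p.1 ∧ 0 < p.2.1 ∧ 0 < p.2.2}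

theorem isOpen_octant : IsOpen octant :=
  (isOpen_lt continuous_const continuous_fst).inter
    ((isOpen_lt continuous_const (continuous_fst.comp continuous_snd)).inter
      (isOpen_lt continuous_const (continuous_snd.comp continuous_snd)))

/-- The diagonal metric with coefficients `p`. -/
def diagMetric (p : ℝ × ℝ × ℝ) : Matrix (Fin 3) (Fin 3) ℝ := Matrix.diagonal ![p.1, p.2.1, p.2.2]

/-- The cross curvature flow on diagonal metrics. -/
noncomputable def diagField (p : ℝ × ℝ × ℝ) : ℝ × ℝ × ℝ :=
  (-2 * (p.1 * curvY p.1 p.2.1 p.2.2 * curvZ p.1 p.2.1 p.2.2 / (p.1 * p.2.1 * p.2.2) ^ 2),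
    -2 * (p.2.1 * curvZ p.1 p.2.1 p.2.2 * curvX p.1 p.2.1 p.2.2 / (p.1 * p.2.1 * p.2.2) ^ 2),
    -2 * (p.2.2 * curvX p.1 p.2.1 p.2.2 * curvY p.1 p.2.1 p.2.2 / (p.1 * p.2.1 * p.2.2) ^ 2))

theorem contDiffAt_diagField {p : ℝ × ℝ × ℝ} (hp : p ∈ octant) : ContDiffAt ℝ 1 diagField p := by
  have h : (p.1 * p.2.1 * p.2.2) ^ 2 ≠ 0 := by
    obtain ⟨h1, h2, h3⟩ := hp
    positivity
  unfold diagField curvX curvY curvZ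
  fun_prop (disch := exact h)

theorem posDef_diagMetric {p : ℝ × ℝ × ℝ} (hp : p ∈ octant) : (diagMetric p).PosDef := by
  rw [diagMetric, Matrix.posDef_diagonal_iff]
  intro i
  fin_cases i
  exacts [hp.1, hp.2.1, hp.2.2]

theorem hasDerivAt_fst_comp {E F : Type*} [NormedAddCommGroup E] [NormedSpace ℝ E]
    [NormedAddCommGroup F] [NormedSpace ℝ F] {f : ℝ → E × F} {f' : E × F} {t : ℝ}
    (h : HasDerivAt f f' t) : HasDerivAt (fun s => (f s).1) f'.1 t :=
  (hasFDerivAt_fst (p := f t)).comp_hasDerivAt t h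

theorem hasDerivAt_snd_comp {E F : Type*} [NormedAddCommGroup E] [NormedSpace ℝ E]
    [NormedAddCommGroup F] [NormedSpace ℝ F] {f : ℝ → E × F} {f' : E × F} {t : ℝ}
    (h : HasDerivAt f f' t) : HasDerivAt (fun s => (f s).2) f'.2 t :=
  (hasFDerivAt_snd (p := f t)).comp_hasDerivAt t h

theorem isXCF_diagMetric {I : Set ℝ} {γ : ℝ → ℝ × ℝ × ℝ} (h : SolvesOn diagField octant γ I) :
    IsXCF I (fun t => diagMetric (γ t)) := by
  intro t ht
  obtain ⟨hp, hd⟩ := h t ht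
  refine ⟨posDef_diagMetric hp, fun i j => ?_⟩
  rw [show crossCurv (diagMetric (γ t)) = _ from crossCurv_diagonal hp.1.ne' hp.2.1.ne' hp.2.2.ne']
  have h1 := hasDerivAt_fst_comp hd
  have h2 := hasDerivAt_fst_comp (hasDerivAt_snd_comp hd)
  have h3 := hasDerivAt_snd_comp (hasDerivAt_snd_comp hd)
  simp only [diagField] at h1 h2 h3
  fin_cases i <;> fin_cases j <;>
    simp [diagMetric] <;>
    first
    | exact hasDerivAt_const _ _
    | simpa using h1
    | simpa using h2
    | simpa using h3

/-- The cross curvature flow as a vector field on `3 × 3` arrays. -/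
noncomputable def metricField (g : Fin 3 → Fin 3 → ℝ) : Fin 3 → Fin 3 → ℝ :=
  fun i j => -2 * crossCurv (Matrix.of g) i j

theorem IsXCF.solvesOn {I : Set ℝ} {g : ℝ → Matrix (Fin 3) (Fin 3) ℝ} (h : IsXCF I g) :
    SolvesOn metricField {g | (Matrix.of g).det ≠ 0} (fun t i j => g t i j) I := by
  intro t ht
  refine ⟨(h t ht).1.det_pos.ne', ?_⟩
  rw [hasDerivAt_pi]
  intro i
  rw [hasDerivAt_pi]
  exact fun j => (h t ht).2 i j

theorem contDiffAt_metricField {g : Fin 3 → Fin 3 → ℝ} (hg : (Matrix.of g).det ≠ 0) :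
    ContDiffAt ℝ 1 metricField g := by
  rw [contDiffAt_pi]
  intro i
  rw [contDiffAt_pi]
  exact fun j => contDiffAt_const.mul (contDiffAt_crossCurv hg i j)

theorem isOpen_timeInterval (Tb Tf : EReal) : IsOpen (timeInterval Tb Tf) :=
  (isOpen_Ioo (a := -Tb) (b := Tf)).preimage continuous_coe_real_ereal

theorem ordConnected_timeInterval (Tb Tf : EReal) : (timeInterval Tb Tf).OrdConnected :=
  ⟨fun x hx y hy z hz => ⟨lt_of_lt_of_le hx.1 (by exact_mod_cast hz.1),
    lt_of_le_of_lt (by exact_mod_cast hz.2) hy.2⟩⟩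

theorem zero_mem_timeInterval {Tb Tf : EReal} (hb : 0 < Tb) (hf : 0 < Tf) :
    (0 : ℝ) ∈ timeInterval Tb Tf := ⟨by rw [EReal.neg_lt_comm]; simpa using hb,
      by simpa using hf⟩

theorem timeInterval_mono {Tb Tf Tb' Tf' : EReal} (hb : Tb ≤ Tb') (hf : Tf ≤ Tf') :
    timeInterval Tb Tf ⊆ timeInterval Tb' Tf' := fun _ ht =>
  ⟨lt_of_le_of_lt (EReal.neg_le_neg_iff.2 hb) ht.1, lt_of_lt_of_le ht.2 hf⟩

/-- Solutions with diagonal initial metric coincide with the maximal diagonal solution. -/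
theorem IsXCF.eqOn_diagMetric {Tb Tf Tb' Tf' : EReal} {γ : ℝ → ℝ × ℝ × ℝ}
    {g : ℝ → Matrix (Fin 3) (Fin 3) ℝ} (hTb : 0 < Tb) (hTf : 0 < Tf) (hTb' : 0 < Tb')
    (hTf' : 0 < Tf') (hγ : SolvesOn diagField octant γ (timeInterval Tb Tf))
    (hesc_f : ∀ T : ℝ, Tf = T → ∀ x ∈ octant, ¬ Tendsto γ (𝓝[<] T) (𝓝 x))
    (hesc_b : ∀ T : ℝ, Tb = T → ∀ x ∈ octant, ¬ Tendsto γ (𝓝[>] (-T)) (𝓝 x))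
    (hg : IsXCF (timeInterval Tb' Tf') g) (h0 : g 0 = diagMetric (γ 0)) :
    Tb' ≤ Tb ∧ Tf' ≤ Tf ∧ ∀ t ∈ timeInterval Tb' Tf', g t = diagMetric (γ t) := by
  have agree : ∀ t ∈ timeInterval (min Tb Tb') (min Tf Tf'), g t = diagMetric (γ t) := by
    intro t ht
    have h1 := (hg.solvesOn.mono
      (timeInterval_mono (min_le_right Tb Tb') (min_le_right Tf Tf'))).eqOn
      (fun _ hx => contDiffAt_metricField hx)
      ((isXCF_diagMetric hγ).solvesOn.mono
        (timeInterval_mono (min_le_left Tb Tb') (min_le_left Tf Tf')))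
      (isOpen_timeInterval _ _) (ordConnected_timeInterval _ _).isPreconnected
      (zero_mem_timeInterval (lt_min hTb hTb') (lt_min hTf hTf')) (by simp only [h0]) ht
    exact h1
  -- A solution g living beyond an end point of γ would supply a limit of γ there, with positive
  -- coordinates since g is positive definite. This contradicts the escape of γ from the octant.
  have hlim : ∀ T ∈ timeInterval Tb' Tf', ∀ l ≤ 𝓝 T,
      (∀ᶠ t in l, t ∈ timeInterval (min Tb Tb') (min Tf Tf')) →
      ∃ x ∈ octant, Tendsto γ l (𝓝 x) := by
    intro T hT l hl hev
    have hc : ∀ i, Tendsto (fun t => g t i i) l (𝓝 (g T i i)) := fun i =>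
      ((hg T hT).2 i i).continuousAt.tendsto.mono_left hl
    refine ⟨(g T 0 0, g T 1 1, g T 2 2), ⟨(hg T hT).1.diag_pos, (hg T hT).1.diag_pos,
      (hg T hT).1.diag_pos⟩, ((hc 0).prodMk_nhds ((hc 1).prodMk_nhds (hc 2))).congr' ?_⟩
    filter_upwards [hev] with t ht
    rw [agree t ht]
    simp [diagMetric]
  have hf : Tf' ≤ Tf := by
    by_contra hcon
    push Not at hcon
    obtain ⟨T, rfl⟩ : ∃ T : ℝ, Tf = T := by
      induction Tf with
      | bot => exact absurd hTf (by simp)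
      | coe T => exact ⟨T, rfl⟩
      | top => exact absurd hcon (by simp)
    have hT0 : 0 < T := by exact_mod_cast hTf
    have h0m := zero_mem_timeInterval (lt_min hTb hTb') (lt_min hTf hTf')
    obtain ⟨x, hx, hlx⟩ := hlim T ⟨(zero_mem_timeInterval hTb' hTf').1.trans
      (by exact_mod_cast hT0), hcon⟩ (𝓝[<] T) nhdsWithin_le_nhds (by
        filter_upwards [Ioo_mem_nhdsLT hT0] with t ht
        exact ⟨h0m.1.trans (by exact_mod_cast ht.1), by
          rw [min_eq_left hcon.le]; exact_mod_cast ht.2⟩)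
    exact hesc_f T rfl x hx hlx
  have hb : Tb' ≤ Tb := by
    by_contra hcon
    push Not at hcon
    obtain ⟨T, rfl⟩ : ∃ T : ℝ, Tb = T := by
      induction Tb with
      | bot => exact absurd hTb (by simp)
      | coe T => exact ⟨T, rfl⟩
      | top => exact absurd hcon (by simp)
    have hT0 : 0 < T := by exact_mod_cast hTb
    have h0m := zero_mem_timeInterval (lt_min hTb hTb') (lt_min hTf hTf')
    obtain ⟨x, hx, hlx⟩ := hlim (-T) ⟨by rw [EReal.neg_lt_comm]; simpa using hcon,
        lt_trans (by exact_mod_cast (by linarith : -T < 0)) hTf'⟩ (𝓝[>] (-T))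
      nhdsWithin_le_nhds (by
        filter_upwards [Ioo_mem_nhdsGT (neg_lt_zero.2 hT0)] with t ht
        refine ⟨?_, lt_trans (by exact_mod_cast ht.2) h0m.2⟩
        rw [min_eq_left hcon.le]
        exact_mod_cast ht.1)
    exact hesc_b T rfl x hx hlx
  exact ⟨hb, hf, fun t ht => agree t (by rwa [min_eq_right hb, min_eq_right hf])⟩

/-- The cross curvature flow on diagonal metrics in reversed time, on `[s₀, S)`; at a finite end
point the metric does not converge to a metric. -/
structure BackOrbit (s₀ : ℝ) (S : EReal) (A B C : ℝ → ℝ) : Prop where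
  lt : (s₀ : EReal) < S
  pos : ∀ s : ℝ, s₀ ≤ s → (s : EReal) < S → 0 < A s ∧ 0 < B s ∧ 0 < C s
  derivA : ∀ s : ℝ, s₀ ≤ s → (s : EReal) < S →
    HasDerivAt A (2 * (A s * curvY (A s) (B s) (C s) * curvZ (A s) (B s) (C s) /
      (A s * B s * C s) ^ 2)) s
  derivB : ∀ s : ℝ, s₀ ≤ s → (s : EReal) < S →
    HasDerivAt B (2 * (B s * curvZ (A s) (B s) (C s) * curvX (A s) (B s) (C s) /
      (A s * B s * C s) ^ 2)) s
  derivC : ∀ s : ℝ, s₀ ≤ s → (s : EReal) < S →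
    HasDerivAt C (2 * (C s * curvX (A s) (B s) (C s) * curvY (A s) (B s) (C s) /
      (A s * B s * C s) ^ 2)) s
  escape : ∀ T : ℝ, S = T → ∀ a b c : ℝ, 0 < a → 0 < b → 0 < c →
    Tendsto A (𝓝[<] T) (𝓝 a) → Tendsto B (𝓝[<] T) (𝓝 b) → Tendsto C (𝓝[<] T) (𝓝 c) → False

/-- Maximal solutions with diagonal initial metric are diagonal, and in reversed time they
are given by one and the same `BackOrbit`. -/
theorem exists_backOrbit {p : ℝ × ℝ × ℝ} (hp : p ∈ octant) :
    ∃ (Tb : EReal) (A B C : ℝ → ℝ), BackOrbit 0 Tb A B C ∧ (A 0, B 0, C 0) = p ∧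
      (∃ Tf g, IsMaximalXCF p Tb Tf g) ∧
      ∀ Tb' Tf' g, IsMaximalXCF p Tb' Tf' g → Tb' = Tb ∧
        (∀ t ∈ timeInterval Tb' Tf', (g t).IsDiag) ∧
        ∀ t : ℝ, -Tb < t → t ≤ 0 → g t 0 0 = A (-t) ∧ g t 1 1 = B (-t) ∧ g t 2 2 = C (-t) := by
  obtain ⟨Tb, Tf, γ, hTb, hTf, hγ0, hγ, hef, heb⟩ :=
    SolvesOn.exists_maximal isOpen_octant (fun _ => contDiffAt_diagField) hp
  have key : ∀ {Tb' Tf' : EReal} {g : ℝ → Matrix (Fin 3) (Fin 3) ℝ}, 0 < Tb' → 0 < Tf' →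
      IsXCF (timeInterval Tb' Tf') g → g 0 = diagMetric p →
      Tb' ≤ Tb ∧ Tf' ≤ Tf ∧ ∀ t ∈ timeInterval Tb' Tf', g t = diagMetric (γ t) :=
    fun hb hf hg h0 => hg.eqOn_diagMetric hTb hTf hb hf hγ hef heb (by rw [h0, hγ0])
  refine ⟨Tb, fun s => (γ (-s)).1, fun s => (γ (-s)).2.1, fun s => (γ (-s)).2.2, ?_, by simp [hγ0],
    ⟨Tf, fun t => diagMetric (γ t), hTb, hTf, by rw [hγ0]; rfl, isXCF_diagMetric hγ, ?_⟩, ?_⟩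
  · have hmem : ∀ s : ℝ, 0 ≤ s → (s : EReal) < Tb → -s ∈ timeInterval Tb Tf := fun s h1 h2 =>
      ⟨by rw [EReal.neg_lt_comm]; simpa using h2,
        lt_of_le_of_lt (by exact_mod_cast (by linarith : -s ≤ 0)) hTf⟩
    have hd : ∀ s : ℝ, 0 ≤ s → (s : EReal) < Tb →
        HasDerivAt (fun s => γ (-s)) (-diagField (γ (-s))) s := fun s h1 h2 => by
      simpa [Function.comp_def] using (hγ _ (hmem s h1 h2)).2.scomp s (hasDerivAt_neg s)
    refine ⟨by simpa using hTb, fun s h1 h2 => (hγ _ (hmem s h1 h2)).1, ?_, ?_, ?_, ?_⟩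
    · intro s h1 h2
      simpa [diagField] using hasDerivAt_fst_comp (hd s h1 h2)
    · intro s h1 h2
      simpa [diagField] using hasDerivAt_fst_comp (hasDerivAt_snd_comp (hd s h1 h2))
    · intro s h1 h2
      simpa [diagField] using hasDerivAt_snd_comp (hasDerivAt_snd_comp (hd s h1 h2))
    · intro T hT a b c ha hb hc hA hB hC
      refine heb T hT (a, b, c) ⟨ha, hb, hc⟩ ?_
      have := (hA.prodMk_nhds (hB.prodMk_nhds hC)).comp (tendsto_neg_nhdsGT_neg (a := T))
      simpa [Function.comp_def] using this
  · intro Tb' Tf' g' h1 h2 h3 h4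
    obtain ⟨e1, e2, -⟩ := key (hTb.trans_le h1) (hTf.trans_le h2) h3
      (by rw [h4 0 (zero_mem_timeInterval hTb hTf), hγ0])
    exact ⟨le_antisymm e1 h1, le_antisymm e2 h2⟩
  · intro Tb' Tf' g hg
    obtain ⟨e1, e2, e3⟩ := key hg.Tb_pos hg.Tf_pos hg.flow hg.init
    -- The diagonal solution extends g, so the maximality of g identifies the two intervals.
    obtain ⟨e4, e5⟩ := hg.maximal Tb Tf _ e1 e2 (isXCF_diagMetric hγ) fun t ht => (e3 t ht).symm
    refine ⟨e4.symm, fun t ht => ?_, fun t h1 h2 => ?_⟩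
    · rw [e3 t ht]
      exact Matrix.isDiag_diagonal _
    · rw [e3 t ⟨by rwa [← e4], lt_of_le_of_lt (by exact_mod_cast h2) hg.Tf_pos⟩]
      simp [diagMetric]

end SL2XCF

namespace SL2XCF

open Set

/-! ### Real functions on a half-open interval with possibly infinite right end point -/

/-- The interval `[s₀, S)`. -/
def halfOpen (s₀ : ℝ) (S : EReal) : Set ℝ := {s | s₀ ≤ s ∧ (s : EReal) < S}

/-- The filter of times approaching `S` from the left. -/
noncomputable def atEnd (S : EReal) : Filter ℝ := comap Real.toEReal (𝓝[<] S)

variable {s₀ s₁ : ℝ} {S : EReal} {f f' : ℝ → ℝ}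

theorem halfOpen_mono (h : s₀ ≤ s₁) : halfOpen s₁ S ⊆ halfOpen s₀ S := fun _ hs => ⟨h.trans hs.1, hs.2⟩

theorem ordConnected_halfOpen : (halfOpen s₀ S).OrdConnected :=
  ⟨fun _ hx _ hy _ hz => ⟨hx.1.trans hz.1, lt_of_le_of_lt (by exact_mod_cast hz.2) hy.2⟩⟩

theorem left_mem_halfOpen (h : (s₀ : EReal) < S) : s₀ ∈ halfOpen s₀ S := ⟨le_rfl, h⟩

theorem exists_gt_halfOpen (h : (s₀ : EReal) < S) : ∃ s, s₀ < s ∧ (s : EReal) < S := by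
  obtain ⟨s, h1, h2⟩ := EReal.lt_iff_exists_real_btwn.1 h
  exact ⟨s, by exact_mod_cast h1, h2⟩

theorem eventually_atEnd (h : (s₀ : EReal) < S) {P : ℝ → Prop} :
    (∀ᶠ s in atEnd S, P s) ↔ ∃ a : ℝ, s₀ ≤ a ∧ (a : EReal) < S ∧ ∀ s ∈ halfOpen a S, P s := by
  rw [atEnd, ((nhdsLT_basis_of_exists_lt ⟨_, h⟩).comap _).eventually_iff]
  constructor
  · rintro ⟨a, ha, H⟩
    obtain ⟨b, hb1, hb2⟩ := EReal.lt_iff_exists_real_btwn.1 (max_lt ha h)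
    refine ⟨b, ?_, hb2, fun s hs => H ⟨?_, hs.2⟩⟩
    · exact_mod_cast ((le_max_right a _).trans_lt hb1).le
    · exact (le_max_left a _).trans_lt (hb1.trans_le (by exact_mod_cast hs.1))
  · rintro ⟨a, -, ha, H⟩
    exact ⟨a, ha, fun s hs => H s ⟨by exact_mod_cast hs.1.le, hs.2⟩⟩

theorem eventually_mem_halfOpen (h : (s₀ : EReal) < S) : ∀ᶠ s in atEnd S, s ∈ halfOpen s₀ S :=
  (eventually_atEnd h).2 ⟨s₀, le_rfl, h, fun _ hs => hs⟩

theorem atEnd_neBot (h : (s₀ : EReal) < S) : (atEnd S).NeBot := by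
  rw [neBot_iff, Ne, ← empty_mem_iff_bot]
  intro he
  obtain ⟨a, -, ha, H⟩ := (eventually_atEnd (P := fun _ => False) h).1 he
  exact H a ⟨le_rfl, ha⟩

theorem atEnd_coe (T : ℝ) : atEnd (T : EReal) = 𝓝[<] T := by
  have h : ((T - 1 : ℝ) : EReal) < T := by exact_mod_cast sub_one_lt T
  ext s
  change (∀ᶠ x in atEnd (T : EReal), x ∈ s) ↔ (∀ᶠ x in 𝓝[<] T, x ∈ s)
  rw [eventually_atEnd h, (nhdsLT_basis_of_exists_lt ⟨_, sub_one_lt T⟩).eventually_iff]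
  constructor
  · rintro ⟨a, -, ha, H⟩
    exact ⟨a, by exact_mod_cast ha, fun x hx => H x ⟨hx.1.le, by exact_mod_cast hx.2⟩⟩
  · rintro ⟨a, ha, H⟩
    have hm : max a (T - 1) < T := max_lt ha (sub_one_lt T)
    refine ⟨(max a (T - 1) + T) / 2, by linarith [le_max_right a (T - 1)], ?_, fun x hx =>
      H ⟨?_, by exact_mod_cast hx.2⟩⟩
    · exact_mod_cast (by linarith : (max a (T - 1) + T) / 2 < T)
    · linarith [hx.1, le_max_left a (T - 1)]

theorem monotoneOn_halfOpen (hf : ∀ s ∈ halfOpen s₀ S, HasDerivAt f (f' s) s)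
    (hf' : ∀ s ∈ halfOpen s₀ S, 0 ≤ f' s) : MonotoneOn f (halfOpen s₀ S) :=
  monotoneOn_of_hasDerivWithinAt_nonneg ordConnected_halfOpen.convex
    (fun s hs => (hf s hs).continuousAt.continuousWithinAt)
    (fun s hs => (hf s (interior_subset hs)).hasDerivWithinAt)
    (fun s hs => hf' s (interior_subset hs))

theorem antitoneOn_halfOpen (hf : ∀ s ∈ halfOpen s₀ S, HasDerivAt f (f' s) s)
    (hf' : ∀ s ∈ halfOpen s₀ S, f' s ≤ 0) : AntitoneOn f (halfOpen s₀ S) :=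
  antitoneOn_of_hasDerivWithinAt_nonpos ordConnected_halfOpen.convex
    (fun s hs => (hf s hs).continuousAt.continuousWithinAt)
    (fun s hs => (hf s (interior_subset hs)).hasDerivWithinAt)
    (fun s hs => hf' s (interior_subset hs))

theorem strictMonoOn_halfOpen (hf : ∀ s ∈ halfOpen s₀ S, HasDerivAt f (f' s) s)
    (hf' : ∀ s ∈ halfOpen s₀ S, 0 < f' s) : StrictMonoOn f (halfOpen s₀ S) :=
  strictMonoOn_of_hasDerivWithinAt_pos ordConnected_halfOpen.convex
    (fun s hs => (hf s hs).continuousAt.continuousWithinAt)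
    (fun s hs => (hf s (interior_subset hs)).hasDerivWithinAt)
    (fun s hs => hf' s (interior_subset hs))

theorem exists_tendsto_atEnd_of_antitoneOn (h : (s₀ : EReal) < S)
    (hf : AntitoneOn f (halfOpen s₀ S)) {m : ℝ} (hm : ∀ s ∈ halfOpen s₀ S, m ≤ f s) :
    ∃ l, m ≤ l ∧ Tendsto f (atEnd S) (𝓝 l) ∧ ∀ s ∈ halfOpen s₀ S, l ≤ f s := by
  have hbdd : BddBelow (f '' halfOpen s₀ S) := ⟨m, by rintro _ ⟨s, hs, rfl⟩; exact hm s hs⟩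
  have hne : (f '' halfOpen s₀ S).Nonempty := ⟨_, mem_image_of_mem f (left_mem_halfOpen h)⟩
  have hle : ∀ s ∈ halfOpen s₀ S, sInf (f '' halfOpen s₀ S) ≤ f s := fun s hs =>
    csInf_le hbdd (mem_image_of_mem f hs)
  refine ⟨sInf (f '' halfOpen s₀ S), le_csInf hne (by rintro _ ⟨s, hs, rfl⟩; exact hm s hs), ?_, hle⟩
  rw [tendsto_order]
  constructor
  · intro a ha
    filter_upwards [eventually_mem_halfOpen h] with s hs using ha.trans_le (hle s hs)
  · intro a ha
    obtain ⟨_, ⟨t, ht, rfl⟩, hta⟩ := exists_lt_of_csInf_lt hne ha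
    exact (eventually_atEnd h).2 ⟨t, ht.1, ht.2, fun s hs =>
      (hf ht (halfOpen_mono ht.1 hs) hs.1).trans_lt hta⟩

theorem exists_tendsto_atEnd_of_monotoneOn (h : (s₀ : EReal) < S)
    (hf : MonotoneOn f (halfOpen s₀ S)) {m : ℝ} (hm : ∀ s ∈ halfOpen s₀ S, f s ≤ m) :
    ∃ l, l ≤ m ∧ Tendsto f (atEnd S) (𝓝 l) ∧ ∀ s ∈ halfOpen s₀ S, f s ≤ l := by
  obtain ⟨l, h1, h2, h3⟩ := exists_tendsto_atEnd_of_antitoneOn h hf.neg (m := -m)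
    fun s hs => neg_le_neg (hm s hs)
  exact ⟨-l, by linarith, by simpa using h2.neg, fun s hs => by linarith [h3 s hs]⟩

theorem tendsto_atTop_atEnd_of_monotoneOn (h : (s₀ : EReal) < S)
    (hf : MonotoneOn f (halfOpen s₀ S)) (hu : ∀ m, ∃ s ∈ halfOpen s₀ S, m < f s) :
    Tendsto f (atEnd S) atTop := by
  rw [tendsto_atTop]
  intro m
  obtain ⟨t, ht, hm⟩ := hu m
  exact (eventually_atEnd h).2 ⟨t, ht.1, ht.2, fun s hs =>
    hm.le.trans (hf ht (halfOpen_mono ht.1 hs) hs.1)⟩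

/-- Once nonnegative, a function which increases through its zeros becomes and stays positive. -/
theorem pos_of_deriv_pos_at_zero (hf : ∀ s ∈ halfOpen s₀ S, HasDerivAt f (f' s) s)
    (h0 : 0 ≤ f s₀) (hz : ∀ s ∈ halfOpen s₀ S, f s = 0 → 0 < f' s) {s : ℝ} (hs : s₀ < s)
    (hsS : (s : EReal) < S) : 0 < f s := by
  have hmem : ∀ t ∈ Icc s₀ s, t ∈ halfOpen s₀ S := fun t ht =>
    ⟨ht.1, lt_of_le_of_lt (by exact_mod_cast ht.2) hsS⟩
  have hnn : ∀ t ∈ Icc s₀ s, 0 ≤ f t := by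
    have := image_le_of_deriv_right_lt_deriv_boundary' (f := fun _ => (0 : ℝ)) (f' := fun _ => 0)
      (B := f) (B' := f') (a := s₀) (b := s) continuousOn_const
      (fun _ _ => hasDerivWithinAt_const _ _ _) h0
      (fun t ht => (hf t (hmem t ht)).continuousAt.continuousWithinAt)
      (fun t ht => (hf t (hmem t (Ico_subset_Icc_self ht))).hasDerivWithinAt)
      (fun t ht h => hz t (hmem t (Ico_subset_Icc_self ht)) h.symm)
    exact fun t ht => this ht
  -- At a zero the derivative is positive, so f would be negative just to the left.
  refine lt_of_le_of_ne (hnn s ⟨hs.le, le_rfl⟩) fun h => ?_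
  have hd := hf s (hmem s ⟨hs.le, le_rfl⟩)
  have hp := hz s (hmem s ⟨hs.le, le_rfl⟩) h.symm
  have h1 : ∀ᶠ t in 𝓝[<] s, 0 < slope f s t :=
    (hasDerivAt_iff_tendsto_slope_left_right.1 hd).1.eventually (lt_mem_nhds hp)
  obtain ⟨t, ht1, ht2, ht3⟩ := (h1.and (Ioo_mem_nhdsLT hs)).exists
  rw [slope_def_field, ← h, sub_zero] at ht1
  have := hnn t ⟨ht2.le, ht3.le⟩
  exact absurd ht1 (not_lt.2 (div_nonpos_of_nonneg_of_nonpos this (by linarith)))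

/-- A positive function with locally bounded logarithmic derivative stays positive. -/
theorem pos_of_deriv_eq_mul {k : ℝ → ℝ} (hf : ∀ s ∈ halfOpen s₀ S, HasDerivAt f (k s * f s) s)
    (hk : ContinuousOn k (halfOpen s₀ S)) (h0 : 0 < f s₀) : ∀ s ∈ halfOpen s₀ S, 0 < f s := by
  intro s hs
  rcases hs.1.eq_or_lt with rfl | hlt
  · exact h0
  have hsub : Icc s₀ s ⊆ halfOpen s₀ S := fun t ht =>
    ⟨ht.1, lt_of_le_of_lt (by exact_mod_cast ht.2) hs.2⟩
  obtain ⟨K, hK⟩ := (isCompact_Icc.image_of_continuousOn (hk.mono hsub)).isBounded.exists_norm_le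
  -- An exponential barrier from below. Wherever f meets it, the bound k ≥ -K makes f decrease
  -- strictly more slowly than the rate K + 1.
  have hB : ∀ t, HasDerivAt (fun t => f s₀ * Real.exp (-(K + 1) * (t - s₀)))
      (f s₀ * (Real.exp (-(K + 1) * (t - s₀)) * -(K + 1))) t := by
    intro t
    have := (((hasDerivAt_id t).sub_const s₀).const_mul (-(K + 1))).exp.const_mul (f s₀)
    simpa using this
  have := image_le_of_deriv_right_lt_deriv_boundary'
    (f := fun t => f s₀ * Real.exp (-(K + 1) * (t - s₀)))
    (f' := fun t => f s₀ * (Real.exp (-(K + 1) * (t - s₀)) * -(K + 1)))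
    (B := f) (B' := fun t => k t * f t) (a := s₀) (b := s)
    (fun t _ => (hB t).continuousAt.continuousWithinAt)
    (fun t _ => (hB t).hasDerivWithinAt) (by simp)
    (fun t ht => (hf t (hsub ht)).continuousAt.continuousWithinAt)
    (fun t ht => (hf t (hsub (Ico_subset_Icc_self ht))).hasDerivWithinAt)
    (fun t ht he => by
      have h1 := hK _ (mem_image_of_mem k (Ico_subset_Icc_self ht))
      rw [Real.norm_eq_abs, abs_le] at h1
      rw [← he]
      have : 0 < f s₀ * Real.exp (-(K + 1) * (t - s₀)) := by positivity
      nlinarith [h1.1])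
  exact lt_of_lt_of_le (by positivity) (this ⟨hlt.le, le_rfl⟩)

theorem isEquivalent_const_mul_of_tendsto_div {l : Filter ℝ} {u v : ℝ → ℝ} {c : ℝ} (hc : c ≠ 0)
    (hv : ∀ᶠ x in l, v x ≠ 0) (h : Tendsto (fun x => u x / v x) l (𝓝 c)) :
    u ~[l] fun x => c * v x := by
  rw [isEquivalent_iff_tendsto_one (by filter_upwards [hv] with x hx using mul_ne_zero hc hx)]
  have := h.div_const c
  rw [div_self hc] at this
  refine this.congr fun x => ?_
  rw [Pi.div_apply, div_div, mul_comm]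

/-! ### The power laws -/

/-- If `P` is increasing with logarithmic derivative `w = 2θP⁴/(Pqr)²`, where `θ → 1` when
`q, r ≪ P`, and `q`, `r` have logarithmic derivatives `-3w` up to relative errors `O(1/P)`,
then `P` blows up in finite time `T` like `(T - s)^(-1/14)` and `q`, `r` vanish like
`(T - s)^(3/14)`. -/
theorem exists_power_law {P q r θ w e₁ e₂ : ℝ → ℝ} {K θ₀ : ℝ} (hS : (s₀ : EReal) < S)
    (hθ₀ : 0 < θ₀) (hpos : ∀ s ∈ halfOpen s₀ S, 0 < P s ∧ 0 < q s ∧ 0 < r s)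
    (hθ : ∀ s ∈ halfOpen s₀ S, θ₀ ≤ θ s)
    (hw : ∀ s ∈ halfOpen s₀ S, w s = 2 * θ s * P s ^ 4 / (P s * q s * r s) ^ 2)
    (he₁ : ∀ s ∈ halfOpen s₀ S, |e₁ s| ≤ K / P s) (he₂ : ∀ s ∈ halfOpen s₀ S, |e₂ s| ≤ K / P s)
    (dP : ∀ s ∈ halfOpen s₀ S, HasDerivAt P (P s * w s) s)
    (dq : ∀ s ∈ halfOpen s₀ S, HasDerivAt q (q s * (w s * (e₁ s - 3))) s)
    (dr : ∀ s ∈ halfOpen s₀ S, HasDerivAt r (r s * (w s * (e₂ s - 3))) s)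
    (hesc : ∀ T : ℝ, S = T → ∀ a b c : ℝ, 0 < a → 0 < b → 0 < c →
      Tendsto P (𝓝[<] T) (𝓝 a) → Tendsto q (𝓝[<] T) (𝓝 b) → Tendsto r (𝓝[<] T) (𝓝 c) → False)
    (hlim : ∀ l : Filter ℝ, Tendsto (fun s => q s / P s) l (𝓝 0) →
      Tendsto (fun s => r s / P s) l (𝓝 0) → Tendsto θ l (𝓝 1)) :
    ∃ T : ℝ, S = T ∧ ∃ η₁ η₂ η₃ : ℝ, 0 < η₁ ∧ 0 < η₂ ∧ 0 < η₃ ∧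
      P ~[𝓝[<] T] (fun s => η₁ * (T - s) ^ (-(1 / 14) : ℝ)) ∧
      q ~[𝓝[<] T] (fun s => η₂ * (T - s) ^ (3 / 14 : ℝ)) ∧
      r ~[𝓝[<] T] (fun s => η₃ * (T - s) ^ (3 / 14 : ℝ)) := by
  have hw0 : ∀ s ∈ halfOpen s₀ S, 0 ≤ w s := by
    intro s hs
    obtain ⟨h1, h2, h3⟩ := hpos s hs
    have := hθ₀.trans_le (hθ s hs)
    rw [hw s hs]
    positivity
  have hPm : MonotoneOn P (halfOpen s₀ S) := monotoneOn_halfOpen dP fun s hs =>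
    mul_nonneg (hpos s hs).1.le (hw0 s hs)
  have hK : 0 ≤ K := by
    have h1 := he₁ s₀ (left_mem_halfOpen hS)
    have h2 := (hpos s₀ (left_mem_halfOpen hS)).1
    by_contra hneg
    have := div_neg_of_neg_of_pos (not_le.1 hneg) h2
    linarith [abs_nonneg (e₁ s₀)]
  -- The derivative of K/P is minus the bound w K/P on the error terms w e. Adding or subtracting
  -- K/P thus replaces integrating the errors.
  have dKP : ∀ s ∈ halfOpen s₀ S, HasDerivAt (fun s => K / P s) (-(w s * (K / P s))) s := by
    intro s hs
    have hP := (hpos s hs).1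
    refine (show HasDerivAt (fun s => K / P s) _ s from
      ((dP s hs).inv hP.ne').const_mul K).congr_deriv ?_
    field_simp
  obtain ⟨κ₀, -, hκ₀, -⟩ := exists_tendsto_atEnd_of_antitoneOn hS
    (antitoneOn_halfOpen dKP fun s hs => neg_nonpos.2
      (mul_nonneg (hw0 s hs) (div_nonneg hK (hpos s hs).1.le)))
    (m := 0) fun s hs => div_nonneg hK (hpos s hs).1.le
  -- For y = q or r, log(yP³) has derivative w e. Subtracting K/P makes it nondecreasing and adding
  -- K/P makes it nonincreasing, so it is bounded above and converges: y is asymptotic to a constant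
  -- times P⁻³.
  have conv : ∀ (y e : ℝ → ℝ), (∀ s ∈ halfOpen s₀ S, 0 < y s) →
      (∀ s ∈ halfOpen s₀ S, HasDerivAt y (y s * (w s * (e s - 3))) s) →
      (∀ s ∈ halfOpen s₀ S, |e s| ≤ K / P s) →
      ∃ L M, Tendsto (fun s => Real.log (y s) + 3 * Real.log (P s)) (atEnd S) (𝓝 L) ∧
        ∀ s ∈ halfOpen s₀ S, Real.log (y s) + 3 * Real.log (P s) ≤ M := by
    intro y e hy dy he
    have dg : ∀ s ∈ halfOpen s₀ S, HasDerivAt (fun s => Real.log (y s) + 3 * Real.log (P s))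
        (w s * e s) s := by
      intro s hs
      have hP := (hpos s hs).1
      refine (show HasDerivAt (fun s => Real.log (y s) + 3 * Real.log (P s)) _ s from
        ((dy s hs).log (hy s hs).ne').add (((dP s hs).log hP.ne').const_mul 3)).congr_deriv ?_
      have := (hy s hs).ne'
      field_simp
      ring
    have hm1 := monotoneOn_halfOpen (fun s hs => (dg s hs).sub (dKP s hs)) fun s hs => by
      have h1 := (abs_le.1 (he s hs)).1
      nlinarith [hw0 s hs]
    have hm2 := antitoneOn_halfOpen (fun s hs => (dg s hs).add (dKP s hs)) fun s hs => by
      have h1 := (abs_le.1 (he s hs)).2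
      nlinarith [hw0 s hs]
    set M := Real.log (y s₀) + 3 * Real.log (P s₀) + K / P s₀ with hM
    have hle : ∀ s ∈ halfOpen s₀ S, Real.log (y s) + 3 * Real.log (P s) ≤ M := by
      intro s hs
      have h1 := hm2 (left_mem_halfOpen hS) hs hs.1
      simp only [Pi.add_apply] at h1
      have h2 := div_nonneg hK (hpos s hs).1.le
      linarith
    obtain ⟨L, -, hL, -⟩ := exists_tendsto_atEnd_of_monotoneOn hS hm1 (m := M) fun s hs => by
      have h2 := div_nonneg hK (hpos s hs).1.le
      simp only [Pi.sub_apply]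
      linarith [hle s hs]
    refine ⟨L + κ₀, M, ?_, hle⟩
    have := hL.add hκ₀
    simpa using this
  obtain ⟨L₁, M₁, hL₁, hM₁⟩ := conv q e₁ (fun s hs => (hpos s hs).2.1) dq he₁
  obtain ⟨L₂, M₂, hL₂, hM₂⟩ := conv r e₂ (fun s hs => (hpos s hs).2.2) dr he₂
  set g₁ := fun s => Real.log (q s) + 3 * Real.log (P s) with hg₁
  set g₂ := fun s => Real.log (r s) + 3 * Real.log (P s) with hg₂
  have exp_g : ∀ y p : ℝ, 0 < y → 0 < p → Real.exp (Real.log y + 3 * Real.log p) = y * p ^ 3 := by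
    intro y p hy hp
    rw [Real.exp_add, Real.exp_log hy, mul_comm 3, Real.exp_mul, Real.exp_log hp]
    norm_cast
  -- Since qr is comparable to P⁻⁶, w is comparable to P⁴⁻²⁺¹² = P¹⁴. The power P⁻¹⁴ therefore has
  -- derivative -28θ/((qP³)²(rP³)²), which tends to a constant once θ → 1.
  have dΨ : ∀ s ∈ halfOpen s₀ S, HasDerivAt (fun s => (P s ^ 14)⁻¹)
      (-28 * θ s * Real.exp (-2 * (g₁ s + g₂ s))) s := by
    intro s hs
    obtain ⟨h1, h2, h3⟩ := hpos s hs
    refine (show HasDerivAt (fun s => (P s ^ 14)⁻¹) _ s from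
      ((dP s hs).pow 14).inv (pow_pos h1 14).ne').congr_deriv ?_
    have hexp : ∀ x y : ℝ, Real.exp (-2 * (x + y)) = (Real.exp x ^ 2 * Real.exp y ^ 2)⁻¹ := by
      intro x y
      rw [← Real.exp_nat_mul, ← Real.exp_nat_mul, ← Real.exp_add, ← Real.exp_neg]
      congr 1
      push_cast
      ring
    have e1 : Real.exp (g₁ s) = q s * P s ^ 3 := exp_g _ _ h2 h1
    have e2 : Real.exp (g₂ s) = r s * P s ^ 3 := exp_g _ _ h3 h1
    rw [hw s hs, hexp, e1, e2, Pi.pow_apply]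
    field_simp
    ring
  -- A uniform lower bound for the rate at which the positive quantity P⁻¹⁴ decreases, so the end
  -- time is finite.
  set c := 28 * θ₀ * Real.exp (-2 * (M₁ + M₂)) with hc
  have hc0 : 0 < c := by positivity
  have hΨc : AntitoneOn (fun s => (P s ^ 14)⁻¹ + c * s) (halfOpen s₀ S) := by
    refine antitoneOn_halfOpen (fun s hs => (dΨ s hs).add ((hasDerivAt_id s).const_mul c))
      fun s hs => ?_
    have h1 : Real.exp (-2 * (M₁ + M₂)) ≤ Real.exp (-2 * (g₁ s + g₂ s)) :=
      Real.exp_le_exp.2 (by linarith [hM₁ s hs, hM₂ s hs])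
    have h2 := mul_le_mul (hθ s hs) h1 (Real.exp_pos _).le (hθ₀.le.trans (hθ s hs))
    nlinarith
  obtain ⟨T, rfl⟩ : ∃ T : ℝ, S = T := by
    induction S with
    | bot => exact absurd hS (by simp)
    | coe T => exact ⟨T, rfl⟩
    | top =>
      exfalso
      set s := s₀ + (P s₀ ^ 14)⁻¹ / c with hs
      have hP0 := (hpos s₀ (left_mem_halfOpen hS)).1
      have hss : s₀ ≤ s := by rw [hs]; linarith [show 0 < (P s₀ ^ 14)⁻¹ / c by positivity]
      have hmem : s ∈ halfOpen s₀ ⊤ := ⟨hss, EReal.coe_lt_top _⟩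
      have h1 := hΨc (left_mem_halfOpen hS) hmem hss
      have hP1 := (hpos s hmem).1
      have h2 : 0 < (P s ^ 14)⁻¹ := by positivity
      have h3 : c * s = c * s₀ + (P s₀ ^ 14)⁻¹ := by rw [hs]; field_simp
      simp only at h1
      linarith
  rw [atEnd_coe] at hL₁ hL₂
  have hev : ∀ᶠ s in 𝓝[<] T, s ∈ halfOpen s₀ T := by
    rw [← atEnd_coe]; exact eventually_mem_halfOpen hS
  -- If P were bounded it would converge, and q, r would converge to positive limits because yP³
  -- does, contrary to `hesc`.
  have hP_top : Tendsto P (𝓝[<] T) atTop := by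
    rw [← atEnd_coe]
    refine tendsto_atTop_atEnd_of_monotoneOn hS hPm ?_
    by_contra hcon
    push Not at hcon
    obtain ⟨m, hm⟩ := hcon
    obtain ⟨a, -, ha, hle⟩ := exists_tendsto_atEnd_of_monotoneOn hS hPm hm
    rw [atEnd_coe] at ha
    have ha0 : 0 < a := (hpos s₀ (left_mem_halfOpen hS)).1.trans_le
      (hle s₀ (left_mem_halfOpen hS))
    have lim : ∀ (y : ℝ → ℝ) (L : ℝ), (∀ s ∈ halfOpen s₀ T, 0 < y s) →
        Tendsto (fun s => Real.log (y s) + 3 * Real.log (P s)) (𝓝[<] T) (𝓝 L) →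
        Tendsto y (𝓝[<] T) (𝓝 (Real.exp L / a ^ 3)) := by
      intro y L hy hL
      refine ((Real.continuous_exp.tendsto L).comp hL |>.div (ha.pow 3) (by positivity)).congr' ?_
      filter_upwards [hev] with s hs
      have h1 := (hpos s hs).1
      change Real.exp (Real.log (y s) + 3 * Real.log (P s)) / P s ^ 3 = y s
      rw [exp_g _ _ (hy s hs) h1]
      field_simp
    exact hesc T rfl a _ _ ha0 (by positivity) (by positivity) ha
      (lim q L₁ (fun s hs => (hpos s hs).2.1) hL₁) (lim r L₂ (fun s hs => (hpos s hs).2.2) hL₂)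
  have hratio : ∀ (y : ℝ → ℝ) (L : ℝ), (∀ s ∈ halfOpen s₀ T, 0 < y s) →
      Tendsto (fun s => Real.log (y s) + 3 * Real.log (P s)) (𝓝[<] T) (𝓝 L) →
      Tendsto (fun s => y s / P s) (𝓝[<] T) (𝓝 0) := by
    intro y L hy hL
    have h4 : Tendsto (fun s => P s ^ 4) (𝓝[<] T) atTop :=
      (tendsto_pow_atTop (by norm_num)).comp hP_top
    refine (((Real.continuous_exp.tendsto L).comp hL).div_atTop h4).congr' ?_
    filter_upwards [hev] with s hs
    have h1 := (hpos s hs).1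
    change Real.exp (Real.log (y s) + 3 * Real.log (P s)) / P s ^ 4 = y s / P s
    rw [exp_g _ _ (hy s hs) h1]
    field_simp
  have hθ1 : Tendsto θ (𝓝[<] T) (𝓝 1) := hlim _
    (hratio q L₁ (fun s hs => (hpos s hs).2.1) hL₁) (hratio r L₂ (fun s hs => (hpos s hs).2.2) hL₂)
  set κ := 28 * Real.exp (-2 * (L₁ + L₂)) with hκ
  have hκ0 : 0 < κ := by positivity
  have hΨlim : Tendsto (fun s => (P s ^ 14)⁻¹ / (T - s)) (𝓝[<] T) (𝓝 κ) := by
    refine HasDerivAt.lhopital_zero_nhdsLT (f' := fun s => -28 * θ s * Real.exp (-2 * (g₁ s + g₂ s)))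
      (g' := fun _ => -1) ?_ ?_ (by simp) ?_ ?_ ?_
    · filter_upwards [hev] with s hs using dΨ s hs
    · exact Eventually.of_forall fun s => by simpa using (hasDerivAt_id s).const_sub T
    · exact ((tendsto_pow_atTop (by norm_num)).comp hP_top).inv_tendsto_atTop
    · have : Tendsto (fun s => T - s) (𝓝 T) (𝓝 (T - T)) := tendsto_const_nhds.sub tendsto_id
      rw [sub_self] at this
      exact this.mono_left nhdsWithin_le_nhds
    · have h1 := ((hθ1.const_mul (-28)).mul ((Real.continuous_exp.tendsto _).comp
        ((hL₁.add hL₂).const_mul (-2)))).div_const (-1)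
      rw [show -28 * 1 * Real.exp (-2 * (L₁ + L₂)) / -1 = κ by rw [hκ]; ring] at h1
      exact h1
  have hTs : ∀ᶠ s in 𝓝[<] T, 0 < T - s := by
    filter_upwards [self_mem_nhdsWithin] with s hs using sub_pos.2 hs
  have hPlim : Tendsto (fun s => P s / (T - s) ^ (-(1 / 14) : ℝ)) (𝓝[<] T)
      (𝓝 (κ ^ (-(1 / 14) : ℝ))) := by
    refine (hΨlim.rpow_const (Or.inl hκ0.ne') (p := (-(1 / 14) : ℝ))).congr' ?_
    filter_upwards [hev, hTs] with s hs hs'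
    have h1 := (hpos s hs).1
    rw [Real.div_rpow (by positivity) hs'.le, Real.inv_rpow (by positivity),
      Real.rpow_neg (by positivity), inv_inv, ← Real.rpow_natCast (P s) 14, ← Real.rpow_mul h1.le]
    norm_num
  have hylim : ∀ (y : ℝ → ℝ) (L : ℝ), (∀ s ∈ halfOpen s₀ T, 0 < y s) →
      Tendsto (fun s => Real.log (y s) + 3 * Real.log (P s)) (𝓝[<] T) (𝓝 L) →
      Tendsto (fun s => y s / (T - s) ^ (3 / 14 : ℝ)) (𝓝[<] T)
        (𝓝 (Real.exp L / (κ ^ (-(1 / 14) : ℝ)) ^ 3)) := by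
    intro y L hy hL
    refine (((Real.continuous_exp.tendsto L).comp hL).div (hPlim.pow 3) (by positivity)).congr' ?_
    filter_upwards [hev, hTs] with s hs hs'
    have h1 := (hpos s hs).1
    have h2 : (T - s) ^ (3 / 14 : ℝ) = (((T - s) ^ (-(1 / 14) : ℝ)) ^ 3)⁻¹ := by
      rw [← Real.rpow_natCast, ← Real.rpow_mul hs'.le, ← Real.rpow_neg hs'.le]
      norm_num
    change Real.exp (Real.log (y s) + 3 * Real.log (P s)) /
      (P s / (T - s) ^ (-(1 / 14) : ℝ)) ^ 3 = y s / (T - s) ^ (3 / 14 : ℝ)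
    rw [exp_g _ _ (hy s hs) h1, h2]
    have : 0 < (T - s) ^ (-(1 / 14) : ℝ) := by positivity
    field_simp
  have hne : ∀ p : ℝ, ∀ᶠ s in 𝓝[<] T, (T - s) ^ p ≠ 0 := fun p => by
    filter_upwards [hTs] with s hs using (Real.rpow_pos_of_pos hs p).ne'
  refine ⟨T, rfl, _, _, _, by positivity, by positivity, by positivity,
    isEquivalent_const_mul_of_tendsto_div (by positivity) (hne _) hPlim,
    isEquivalent_const_mul_of_tendsto_div (by positivity) (hne _)
      (hylim q L₁ (fun s hs => (hpos s hs).2.1) hL₁),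
    isEquivalent_const_mul_of_tendsto_div (by positivity) (hne _)
      (hylim r L₂ (fun s hs => (hpos s hs).2.2) hL₂)⟩

end SL2XCF

namespace SL2XCF

open Set

/-! ### Algebra of the curvatures -/

section Algebra

variable {a b c : ℝ}

/-- These factorizations order the three curvatures by the signs of a - (b - c) and b - c. Since
logarithmic derivatives of ratios are products of one curvature with a difference of the other two,
they also decide which ratios are monotone. -/
theorem curvY_sub_curvX : curvY a b c - curvX a b c = 4 * (a + b) * (a - (b - c)) := by
  unfold curvX curvY; ring

theorem curvZ_sub_curvY : curvZ a b c - curvY a b c = 4 * (b - c) * (a + b + c) := by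
  unfold curvZ curvY; ring

theorem curvZ_sub_curvX : curvZ a b c - curvX a b c = 4 * (a + c) * (a + (b - c)) := by
  unfold curvZ curvX; ring

theorem sq_le_curvZ (ha : 0 < a) (hc : 0 < c) (hcb : c < b) : a ^ 2 ≤ curvZ a b c := by
  have h1 := sub_pos.2 hcb
  have h2 : 0 < 2 * a * (b - c) := by positivity
  have h3 : 0 < (b - c) * (b + 3 * c) := mul_pos h1 (by linarith)
  unfold curvZ
  linarith

theorem curvZ_pos (ha : 0 < a) (hc : 0 < c) (hcb : c < b) : 0 < curvZ a b c :=
  (pow_pos ha 2).trans_le (sq_le_curvZ ha hc hcb)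

/-- X ≥ 0 reads (b - c)² ≥ 2a(b + c) + 3a² > a². Hence the two trapping regions are disjoint. -/
theorem lt_sub_of_curvX_nonneg (ha : 0 < a) (hc : 0 < c) (hcb : c < b) (hX : 0 ≤ curvX a b c) :
    a < b - c := by
  unfold curvX at hX
  have h1 : 0 < 2 * a * (b + c) := by have := hc.trans hcb; positivity
  by_contra hcon
  nlinarith

theorem curvY_neg (ha : 0 < a) (hc : 0 < c) (hcb : c < b) (h : a ≤ b - c) : curvY a b c < 0 := by
  have h1 := sub_pos.2 hcb
  have h3 : 0 < (b - c) * (3 * b + c) := mul_pos h1 (by linarith)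
  unfold curvY
  nlinarith [mul_pos ha h1]

theorem curvX_neg (ha : 0 < a) (hc : 0 < c) (hcb : c < b) (h : b - c ≤ a) : curvX a b c < 0 := by
  by_contra hcon
  linarith [lt_sub_of_curvX_nonneg ha hc hcb (not_lt.1 hcon)]

end Algebra

theorem hasDerivAt_div_of_log {f g : ℝ → ℝ} {α β s : ℝ} (hf : HasDerivAt f (f s * α) s)
    (hg : HasDerivAt g (g s * β) s) (h : g s ≠ 0) :
    HasDerivAt (fun s => f s / g s) (f s / g s * (α - β)) s := by
  refine (hf.div hg h).congr_deriv ?_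
  field_simp

/-- A positive function whose derivative is bounded above by a negative constant lives on a
bounded interval. -/
theorem exists_end_of_deriv_le {s₀ : ℝ} {S : EReal} {f f' : ℝ → ℝ} {c : ℝ} (hS : (s₀ : EReal) < S)
    (hc : 0 < c) (hf : ∀ s ∈ halfOpen s₀ S, HasDerivAt f (f' s) s)
    (hf' : ∀ s ∈ halfOpen s₀ S, f' s ≤ -c) (hpos : ∀ s ∈ halfOpen s₀ S, 0 < f s) :
    ∃ T : ℝ, S = T := by
  have hanti : AntitoneOn (fun s => f s + c * s) (halfOpen s₀ S) :=
    antitoneOn_halfOpen (fun s hs => (hf s hs).add ((hasDerivAt_id s).const_mul c))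
      fun s hs => by linarith [hf' s hs]
  induction S with
  | bot => exact absurd hS (by simp)
  | coe T => exact ⟨T, rfl⟩
  | top =>
    exfalso
    have h0 := hpos s₀ (left_mem_halfOpen hS)
    have hss : s₀ ≤ s₀ + f s₀ / c := by linarith [div_pos h0 hc]
    have hmem : s₀ + f s₀ / c ∈ halfOpen s₀ ⊤ := ⟨hss, EReal.coe_lt_top _⟩
    have h1 := hanti (left_mem_halfOpen hS) hmem hss
    have h2 := hpos _ hmem
    have h3 : c * (s₀ + f s₀ / c) = c * s₀ + f s₀ := by field_simp
    simp only at h1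
    linarith

/-- The speed of the reversed flow relative to the cubic vector field of curvature products. -/
noncomputable def speed (a b c : ℝ) : ℝ := 2 / (a * b * c) ^ 2

theorem speed_pos {a b c : ℝ} (ha : 0 < a) (hb : 0 < b) (hc : 0 < c) : 0 < speed a b c := by
  unfold speed; positivity

namespace BackOrbit

variable {s₀ s₁ : ℝ} {S : EReal} {A B C : ℝ → ℝ}

theorem restrict (h : BackOrbit s₀ S A B C) (h1 : s₀ ≤ s₁) (h2 : (s₁ : EReal) < S) :
    BackOrbit s₁ S A B C :=
  ⟨h2, fun s hs => h.pos s (h1.trans hs), fun s hs => h.derivA s (h1.trans hs),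
    fun s hs => h.derivB s (h1.trans hs), fun s hs => h.derivC s (h1.trans hs), h.escape⟩

theorem hasDerivA (h : BackOrbit s₀ S A B C) {s : ℝ} (hs : s ∈ halfOpen s₀ S) :
    HasDerivAt A (A s * (speed (A s) (B s) (C s) *
      (curvY (A s) (B s) (C s) * curvZ (A s) (B s) (C s)))) s :=
  (h.derivA s hs.1 hs.2).congr_deriv (by unfold speed; ring)

theorem hasDerivB (h : BackOrbit s₀ S A B C) {s : ℝ} (hs : s ∈ halfOpen s₀ S) :
    HasDerivAt B (B s * (speed (A s) (B s) (C s) *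
      (curvZ (A s) (B s) (C s) * curvX (A s) (B s) (C s)))) s :=
  (h.derivB s hs.1 hs.2).congr_deriv (by unfold speed; ring)

theorem hasDerivC (h : BackOrbit s₀ S A B C) {s : ℝ} (hs : s ∈ halfOpen s₀ S) :
    HasDerivAt C (C s * (speed (A s) (B s) (C s) *
      (curvX (A s) (B s) (C s) * curvY (A s) (B s) (C s)))) s :=
  (h.derivC s hs.1 hs.2).congr_deriv (by unfold speed; ring)

/-- BZ - CY = (B - C)Z + C(Z - Y), and Z - Y has the factor B - C. So B - C satisfies a linear
homogeneous equation, and the sign of its growth is the sign of X. -/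
theorem hasDerivSub (h : BackOrbit s₀ S A B C) {s : ℝ} (hs : s ∈ halfOpen s₀ S) :
    HasDerivAt (fun s => B s - C s) ((B s - C s) * (speed (A s) (B s) (C s) *
      (curvX (A s) (B s) (C s) * (curvZ (A s) (B s) (C s) + 4 * C s * (A s + B s + C s))))) s :=
  ((h.hasDerivB hs).sub (h.hasDerivC hs)).congr_deriv (by unfold curvY curvZ; ring)

theorem hasDerivX (h : BackOrbit s₀ S A B C) {s : ℝ} (hs : s ∈ halfOpen s₀ S) :
    HasDerivAt (fun s => curvX (A s) (B s) (C s))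
      (2 * (B s - C s) * ((B s - C s) * (speed (A s) (B s) (C s) * (curvX (A s) (B s) (C s) *
        (curvZ (A s) (B s) (C s) + 4 * C s * (A s + B s + C s))))) -
      (2 * (A s * (speed (A s) (B s) (C s) *
        (curvY (A s) (B s) (C s) * curvZ (A s) (B s) (C s)))) * (B s + C s) +
        2 * A s * (B s * (speed (A s) (B s) (C s) *
          (curvZ (A s) (B s) (C s) * curvX (A s) (B s) (C s))) +
          C s * (speed (A s) (B s) (C s) *
          (curvX (A s) (B s) (C s) * curvY (A s) (B s) (C s))))) -
      3 * (2 * A s * (A s * (speed (A s) (B s) (C s) *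
        (curvY (A s) (B s) (C s) * curvZ (A s) (B s) (C s)))))) s := by
  have h1 := (((h.hasDerivSub hs).pow 2).sub (((h.hasDerivA hs).const_mul 2).mul
    ((h.hasDerivB hs).add (h.hasDerivC hs)))).sub (((h.hasDerivA hs).pow 2).const_mul 3)
  exact (show HasDerivAt (fun s => curvX (A s) (B s) (C s)) _ s from h1).congr_deriv
    (by simp only [Pi.add_apply]; ring)

theorem continuousOn_curv (h : BackOrbit s₀ S A B C) {F : ℝ × ℝ × ℝ → ℝ} (hF : Continuous F) :
    ContinuousOn (fun s => F (A s, B s, C s)) (halfOpen s₀ S) := fun _ hs =>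
  (hF.continuousAt.comp ((h.hasDerivA hs).continuousAt.prodMk
    ((h.hasDerivB hs).continuousAt.prodMk (h.hasDerivC hs).continuousAt))).continuousWithinAt

theorem C_lt_B (h : BackOrbit s₀ S A B C) (h0 : C s₀ < B s₀) {s : ℝ} (hs : s ∈ halfOpen s₀ S) :
    C s < B s := by
  have := pos_of_deriv_eq_mul (f := fun s => B s - C s)
    (k := fun s => speed (A s) (B s) (C s) *
      (curvX (A s) (B s) (C s) * (curvZ (A s) (B s) (C s) + 4 * C s * (A s + B s + C s))))
    (fun s hs => (h.hasDerivSub hs).congr_deriv (by ring)) ?_ (sub_pos.2 h0) s hs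
  · exact sub_pos.1 this
  · have h1 := h.continuousOn_curv (F := fun p => curvX p.1 p.2.1 p.2.2 *
      (curvZ p.1 p.2.1 p.2.2 + 4 * p.2.2 * (p.1 + p.2.1 + p.2.2))) (by
        unfold curvX curvZ; fun_prop)
    have h2 := h.continuousOn_curv (F := fun p => (p.1 * p.2.1 * p.2.2) ^ 2) (by fun_prop)
    refine (continuousOn_const.div h2 fun s hs => ?_).mul h1
    obtain ⟨p1, p2, p3⟩ := h.pos s hs.1 hs.2
    positivity

/-! ### Orbits with nonnegative curvature of `f₂ ∧ f₃` -/

/-- The derivatives of B and C carry the factor X. Where X = 0 only A moves: it decreases because Y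
< 0 < Z, and X is decreasing in A. -/
theorem curvX_pos (h : BackOrbit s₀ S A B C) (h0 : C s₀ < B s₀)
    (hX : 0 ≤ curvX (A s₀) (B s₀) (C s₀)) {s : ℝ} (hs : s₀ < s) (hsS : (s : EReal) < S) :
    0 < curvX (A s) (B s) (C s) := by
  refine pos_of_deriv_pos_at_zero (f := fun s => curvX (A s) (B s) (C s))
    (fun s hs => h.hasDerivX hs) hX (fun s hs hz => ?_) hs hsS
  obtain ⟨p1, p2, p3⟩ := h.pos s hs.1 hs.2
  have hcb := h.C_lt_B h0 hs
  have hY := curvY_neg p1 p3 hcb (lt_sub_of_curvX_nonneg p1 p3 hcb hz.ge).le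
  have hZ := curvZ_pos p1 p3 hcb
  have hk := speed_pos p1 p2 p3
  rw [hz]
  have : 0 < A s * (speed (A s) (B s) (C s) * (-curvY (A s) (B s) (C s) *
      curvZ (A s) (B s) (C s))) * (2 * (B s + C s) + 6 * A s) := by
    have := neg_pos.2 hY
    positivity
  linarith

/-- Backward in time, orbits with nonnegative curvature of `f₂ ∧ f₃` blow up in `B`. -/
theorem power_law_of_curvX_nonneg (h : BackOrbit s₀ S A B C) (h0 : C s₀ < B s₀)
    (hX : 0 ≤ curvX (A s₀) (B s₀) (C s₀)) :
    ∃ T : ℝ, S = T ∧ ∃ η₁ η₂ η₃ : ℝ, 0 < η₁ ∧ 0 < η₂ ∧ 0 < η₃ ∧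
      B ~[𝓝[<] T] (fun s => η₁ * (T - s) ^ (-(1 / 14) : ℝ)) ∧
      A ~[𝓝[<] T] (fun s => η₂ * (T - s) ^ (3 / 14 : ℝ)) ∧
      C ~[𝓝[<] T] (fun s => η₃ * (T - s) ^ (3 / 14 : ℝ)) := by
  obtain ⟨s₁, hs₁, hs₁S⟩ := exists_gt_halfOpen h.lt
  have hX₁ := h.curvX_pos h0 hX hs₁ hs₁S
  replace h0 := h.C_lt_B h0 ⟨hs₁.le, hs₁S⟩
  replace h := h.restrict hs₁.le hs₁S
  clear hX hs₁
  have facts : ∀ s ∈ halfOpen s₁ S, 0 < A s ∧ 0 < B s ∧ 0 < C s ∧ C s < B s ∧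
      0 < curvX (A s) (B s) (C s) ∧ curvY (A s) (B s) (C s) < 0 ∧ 0 < curvZ (A s) (B s) (C s) ∧
      A s < B s - C s ∧ 0 < speed (A s) (B s) (C s) := by
    intro s hs
    obtain ⟨p1, p2, p3⟩ := h.pos s hs.1 hs.2
    have hcb := h.C_lt_B h0 hs
    have hX : 0 < curvX (A s) (B s) (C s) := by
      rcases hs.1.eq_or_lt with rfl | hlt
      · exact hX₁
      · exact h.curvX_pos h0 hX₁.le hlt hs.2
    have hA := lt_sub_of_curvX_nonneg p1 p3 hcb hX.le
    exact ⟨p1, p2, p3, hcb, hX, curvY_neg p1 p3 hcb hA.le, curvZ_pos p1 p3 hcb, hA,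
      speed_pos p1 p2 p3⟩
  have hAanti : AntitoneOn A (halfOpen s₁ S) :=
    antitoneOn_halfOpen (fun s hs => h.hasDerivA hs) fun s hs => by
      obtain ⟨p1, p2, p3, hcb, hX, hY, hZ, hA, hk⟩ := facts s hs
      exact mul_nonpos_of_nonneg_of_nonpos p1.le (mul_nonpos_of_nonneg_of_nonpos hk.le
        (mul_nonpos_of_nonpos_of_nonneg hY.le hZ.le))
  have hCanti : AntitoneOn C (halfOpen s₁ S) :=
    antitoneOn_halfOpen (fun s hs => h.hasDerivC hs) fun s hs => by
      obtain ⟨p1, p2, p3, hcb, hX, hY, hZ, hA, hk⟩ := facts s hs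
      exact mul_nonpos_of_nonneg_of_nonpos p3.le (mul_nonpos_of_nonneg_of_nonpos hk.le
        (mul_nonpos_of_nonneg_of_nonpos hX.le hY.le))
  -- With X > 0, Z > 0 and Y < 0 the coefficient B grows while A and C shrink. As a function of A/B
  -- and C/B, X/B² is decreasing in each on the relevant range, so it stays above its initial value
  -- δ.
  have hABanti : AntitoneOn (fun s => A s / B s) (halfOpen s₁ S) :=
    antitoneOn_halfOpen (fun s hs =>
      hasDerivAt_div_of_log (h.hasDerivA hs) (h.hasDerivB hs) (facts s hs).2.1.ne') fun s hs => by
      obtain ⟨p1, p2, p3, hcb, hX, hY, hZ, hA, hk⟩ := facts s hs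
      refine mul_nonpos_of_nonneg_of_nonpos (by positivity) ?_
      rw [← mul_sub]
      exact mul_nonpos_of_nonneg_of_nonpos hk.le (by nlinarith)
  have hCBanti : AntitoneOn (fun s => C s / B s) (halfOpen s₁ S) :=
    antitoneOn_halfOpen (fun s hs =>
      hasDerivAt_div_of_log (h.hasDerivC hs) (h.hasDerivB hs) (facts s hs).2.1.ne') fun s hs => by
      obtain ⟨p1, p2, p3, hcb, hX, hY, hZ, hA, hk⟩ := facts s hs
      refine mul_nonpos_of_nonneg_of_nonpos (by positivity) ?_
      rw [← mul_sub]
      exact mul_nonpos_of_nonneg_of_nonpos hk.le (by nlinarith)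
  have hm₁ := left_mem_halfOpen h.lt
  set δ := curvX (A s₁) (B s₁) (C s₁) / B s₁ ^ 2 with hδ
  have hδ0 : 0 < δ := div_pos hX₁ (pow_pos (facts s₁ hm₁).2.1 2)
  have hXδ : ∀ s ∈ halfOpen s₁ S, δ * B s ^ 2 ≤ curvX (A s) (B s) (C s) := by
    intro s hs
    obtain ⟨p1, p2, p3, hcb, hX, hY, hZ, hA, hk⟩ := facts s hs
    obtain ⟨q1, q2, q3, hcb', -⟩ := facts s₁ hm₁
    have e : ∀ a b c : ℝ, 0 < b →
        curvX a b c / b ^ 2 = (1 - c / b) ^ 2 - 2 * (a / b) * (1 + c / b) - 3 * (a / b) ^ 2 := by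
      intro a b c hb
      unfold curvX
      field_simp
    rw [← le_div_iff₀ (by positivity), hδ, e _ _ _ p2, e _ _ _ q2]
    have h1 : A s / B s ≤ A s₁ / B s₁ := hABanti hm₁ hs hs.1
    have h2 : C s / B s ≤ C s₁ / B s₁ := hCBanti hm₁ hs hs.1
    have h3 : C s₁ / B s₁ < 1 := (div_lt_one q2).2 hcb'
    have h4 : 0 < A s / B s := by positivity
    have h5 : 0 < C s / B s := by positivity
    have h6 : (1 - C s₁ / B s₁) ^ 2 ≤ (1 - C s / B s) ^ 2 := by gcongr
    have h7 : 2 * (A s / B s) * (1 + C s / B s) ≤ 2 * (A s₁ / B s₁) * (1 + C s₁ / B s₁) := by gcongr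
    have h8 : 3 * (A s / B s) ^ 2 ≤ 3 * (A s₁ / B s₁) ^ 2 := by gcongr
    linarith
  set K := 16 * (A s₁ + C s₁) / δ with hK
  -- For A, C ≪ B one has X ≈ Z ≈ B² and Y ≈ -3B², so Y/X and Y/Z, the growth rates of log A and log
  -- C relative to log B, are both -3 up to O(1/B). The constant K combines |Y + 3X|, |Y + 3Z| ≤
  -- 16B(A + C) with δB² ≤ X ≤ Z.
  refine exists_power_law (P := B) (q := A) (r := C) (K := K) (θ₀ := δ ^ 2) h.lt (by positivity)
    (θ := fun s => ((A s / B s) ^ 2 + 2 * (A s / B s) * (1 - C s / B s) +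
      (1 - C s / B s) * (1 + 3 * (C s / B s))) *
      ((1 - C s / B s) ^ 2 - 2 * (A s / B s) * (1 + C s / B s) - 3 * (A s / B s) ^ 2))
    (w := fun s => speed (A s) (B s) (C s) * (curvZ (A s) (B s) (C s) * curvX (A s) (B s) (C s)))
    (e₁ := fun s => (curvY (A s) (B s) (C s) + 3 * curvX (A s) (B s) (C s)) /
      curvX (A s) (B s) (C s))
    (e₂ := fun s => (curvY (A s) (B s) (C s) + 3 * curvZ (A s) (B s) (C s)) /
      curvZ (A s) (B s) (C s))
    (fun s hs => ⟨(facts s hs).2.1, (facts s hs).1, (facts s hs).2.2.1⟩) ?_ ?_ ?_ ?_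
    (fun s hs => h.hasDerivB hs) ?_ ?_
    (fun T hT a b c ha hb hc l1 l2 l3 => h.escape T hT b a c hb ha hc l2 l1 l3) ?_
  · intro s hs
    obtain ⟨p1, p2, p3, hcb, hX, hY, hZ, hA, hk⟩ := facts s hs
    have h1 := hXδ s hs
    have h2 : curvX (A s) (B s) (C s) ≤ curvZ (A s) (B s) (C s) := by
      have := curvZ_sub_curvX (a := A s) (b := B s) (c := C s)
      have h3 : 0 < 4 * (A s + C s) * (A s + (B s - C s)) :=
        mul_pos (by positivity) (by linarith)
      linarith
    have h3 : δ * B s ^ 2 * (δ * B s ^ 2) ≤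
        curvZ (A s) (B s) (C s) * curvX (A s) (B s) (C s) :=
      mul_le_mul (h1.trans h2) h1 (by positivity) hZ.le
    rw [show ((A s / B s) ^ 2 + 2 * (A s / B s) * (1 - C s / B s) +
      (1 - C s / B s) * (1 + 3 * (C s / B s))) *
      ((1 - C s / B s) ^ 2 - 2 * (A s / B s) * (1 + C s / B s) - 3 * (A s / B s) ^ 2) =
      curvZ (A s) (B s) (C s) * curvX (A s) (B s) (C s) / B s ^ 4 by
        unfold curvX curvZ; field_simp]
    rw [le_div_iff₀ (by positivity)]
    linarith
  · intro s hs
    obtain ⟨p1, p2, p3, hcb, hX, hY, hZ, hA, hk⟩ := facts s hs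
    unfold speed curvX curvZ
    field_simp
  · intro s hs
    obtain ⟨p1, p2, p3, hcb, hX, hY, hZ, hA, hk⟩ := facts s hs
    have h1 := hXδ s hs
    have hA1 : A s ≤ A s₁ := hAanti hm₁ hs hs.1
    have hC1 : C s ≤ C s₁ := hCanti hm₁ hs hs.1
    rw [abs_div, abs_of_pos hX, div_le_div_iff₀ hX p2]
    have h2 : |curvY (A s) (B s) (C s) + 3 * curvX (A s) (B s) (C s)| ≤
        16 * B s * (A s₁ + C s₁) := by
      have h3 : A s * A s ≤ A s * B s := by gcongr; linarith
      have h4 : A s * C s ≤ A s * B s := by gcongr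
      have h5 : B s * A s ≤ B s * A s₁ := by gcongr
      have h6 : B s * C s ≤ B s * C s₁ := by gcongr
      have h7 := mul_pos p1 p3
      have h8 := mul_pos p1 p2
      have h9 := mul_pos p1 p1
      have h10 := mul_pos p3 (sub_pos.2 hcb)
      have h11 := mul_pos p3 p3
      have h12 := mul_pos p2 p3
      unfold curvX curvY
      rw [abs_le]
      constructor <;> nlinarith
    have h3 : 0 < A s₁ + C s₁ := by linarith
    calc _ ≤ 16 * B s * (A s₁ + C s₁) * B s := by gcongr
      _ = K * (δ * B s ^ 2) := by rw [hK]; field_simp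
      _ ≤ _ := by gcongr
  · intro s hs
    obtain ⟨p1, p2, p3, hcb, hX, hY, hZ, hA, hk⟩ := facts s hs
    have h1 := hXδ s hs
    have hA1 : A s ≤ A s₁ := hAanti hm₁ hs hs.1
    have hC1 : C s ≤ C s₁ := hCanti hm₁ hs hs.1
    have hXZ : curvX (A s) (B s) (C s) ≤ curvZ (A s) (B s) (C s) := by
      have := curvZ_sub_curvX (a := A s) (b := B s) (c := C s)
      have h3 : 0 < 4 * (A s + C s) * (A s + (B s - C s)) :=
        mul_pos (by positivity) (by linarith)
      linarith
    rw [abs_div, abs_of_pos hZ, div_le_div_iff₀ hZ p2]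
    have h2 : |curvY (A s) (B s) (C s) + 3 * curvZ (A s) (B s) (C s)| ≤
        16 * B s * (A s₁ + C s₁) := by
      have h3 : A s * A s ≤ A s * B s := by gcongr; linarith
      have h4 : A s * C s ≤ A s * B s := by gcongr
      have h5 : B s * A s ≤ B s * A s₁ := by gcongr
      have h6 : B s * C s ≤ B s * C s₁ := by gcongr
      have h7 := mul_pos p1 p3
      have h8 := mul_pos p1 p2
      have h9 := mul_pos p1 p1
      have h10 := mul_pos p3 (sub_pos.2 hcb)
      have h11 := mul_pos p3 p3
      have h12 := mul_pos p2 p3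
      have h13 := mul_pos p1 (sub_pos.2 hcb)
      unfold curvZ curvY
      rw [abs_le]
      constructor <;> nlinarith
    have h3 : 0 < A s₁ + C s₁ := by linarith
    calc _ ≤ 16 * B s * (A s₁ + C s₁) * B s := by gcongr
      _ = K * (δ * B s ^ 2) := by rw [hK]; field_simp
      _ ≤ _ := by gcongr; exact h1.trans hXZ
  · intro s hs
    obtain ⟨p1, p2, p3, hcb, hX, hY, hZ, hA, hk⟩ := facts s hs
    refine (h.hasDerivA hs).congr_deriv ?_
    field_simp
    ring
  · intro s hs
    obtain ⟨p1, p2, p3, hcb, hX, hY, hZ, hA, hk⟩ := facts s hs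
    refine (h.hasDerivC hs).congr_deriv ?_
    field_simp
    ring
  · intro l hu hv
    have hcont : Continuous fun p : ℝ × ℝ =>
        (p.1 ^ 2 + 2 * p.1 * (1 - p.2) + (1 - p.2) * (1 + 3 * p.2)) *
        ((1 - p.2) ^ 2 - 2 * p.1 * (1 + p.2) - 3 * p.1 ^ 2) := by fun_prop
    have := (hcont.tendsto (0, 0)).comp (hu.prodMk_nhds hv)
    simpa [Function.comp_def] using this

end BackOrbit

end SL2XCF

namespace SL2XCF

open Set

namespace BackOrbit

variable {s₀ s₁ : ℝ} {S : EReal} {A B C : ℝ → ℝ}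

/-! ### Orbits with `A ≥ B - C` -/

/-- On A = B - C one has X = Y = -4AB. The derivative of A - (B - C) reduces to -4kACX(A + B + C),
which equals 32kA²B²C > 0. -/
theorem sub_lt_A (h : BackOrbit s₀ S A B C) (h0 : C s₀ < B s₀) (hA : B s₀ - C s₀ ≤ A s₀) {s : ℝ}
    (hs : s₀ < s) (hsS : (s : EReal) < S) : B s - C s < A s := by
  refine sub_pos.1 (pos_of_deriv_pos_at_zero (f := fun s => A s - (B s - C s))
    (fun s hs => (h.hasDerivA hs).sub (h.hasDerivSub hs)) (sub_nonneg.2 hA)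
    (fun s hs hz => ?_) hs hsS)
  obtain ⟨p1, p2, p3⟩ := h.pos s hs.1 hs.2
  have hcb := h.C_lt_B h0 hs
  have hk := speed_pos p1 p2 p3
  have e : A s = B s - C s := sub_eq_zero.1 hz
  have h1 : 0 < B s - C s := sub_pos.2 hcb
  have : 0 < 32 * B s ^ 2 * C s * (B s - C s) ^ 2 * speed (A s) (B s) (C s) := by positivity
  convert this using 1
  unfold curvX curvY curvZ
  rw [e]
  ring

/-- When `A > B - C`, the curvature of `f₃ ∧ f₁` becomes positive backward in time. -/
theorem exists_curvY_pos (h : BackOrbit s₀ S A B C)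
    (hBC : ∀ s ∈ halfOpen s₀ S, C s < B s) (hA : ∀ s ∈ halfOpen s₀ S, B s - C s < A s)
    (hBA : AntitoneOn (fun s => B s / A s) (halfOpen s₀ S))
    (hDA : AntitoneOn (fun s => (B s - C s) / A s) (halfOpen s₀ S))
    (hB : AntitoneOn B (halfOpen s₀ S)) :
    ∃ s ∈ halfOpen s₀ S, 0 < curvY (A s) (B s) (C s) := by
  -- If Y ≤ 0 throughout, then A and B decrease and C increases, so all three converge. It remains
  -- to keep A away from zero and to show that the end time is finite, which contradicts escape.
  by_contra hcon
  push Not at hcon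
  have hm := left_mem_halfOpen h.lt
  have p := fun s (hs : s ∈ halfOpen s₀ S) => h.pos s hs.1 hs.2
  obtain ⟨a1, b1, c1⟩ := p s₀ hm
  have hX : ∀ s ∈ halfOpen s₀ S, curvX (A s) (B s) (C s) < 0 := fun s hs =>
    curvX_neg (p s hs).1 (p s hs).2.2 (hBC s hs) (hA s hs).le
  have hZ : ∀ s ∈ halfOpen s₀ S, 0 < curvZ (A s) (B s) (C s) := fun s hs =>
    curvZ_pos (p s hs).1 (p s hs).2.2 (hBC s hs)
  have hk : ∀ s ∈ halfOpen s₀ S, 0 < speed (A s) (B s) (C s) := fun s hs =>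
    speed_pos (p s hs).1 (p s hs).2.1 (p s hs).2.2
  have hAanti : AntitoneOn A (halfOpen s₀ S) :=
    antitoneOn_halfOpen (fun s hs => h.hasDerivA hs) fun s hs =>
      mul_nonpos_of_nonneg_of_nonpos (p s hs).1.le (mul_nonpos_of_nonneg_of_nonpos (hk s hs).le
        (mul_nonpos_of_nonpos_of_nonneg (hcon s hs) (hZ s hs).le))
  have hCmono : MonotoneOn C (halfOpen s₀ S) :=
    monotoneOn_halfOpen (fun s hs => h.hasDerivC hs) fun s hs =>
      mul_nonneg (p s hs).2.2.le (mul_nonneg (hk s hs).le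
        (mul_nonneg_of_nonpos_of_nonpos (hX s hs).le (hcon s hs)))
  have hC_ge : ∀ s ∈ halfOpen s₀ S, C s₀ ≤ C s := fun s hs => hCmono hm hs hs.1
  have hB_le : ∀ s ∈ halfOpen s₀ S, B s ≤ B s₀ := fun s hs => hB hm hs hs.1
  have hA_le : ∀ s ∈ halfOpen s₀ S, A s ≤ A s₀ := fun s hs => hAanti hm hs hs.1
  -- Since B/A decreases, A is at least B times the initial A/B, and B > C ≥ C(s₀).
  set a₀ := C s₀ / (B s₀ / A s₀) with ha₀
  have ha₀0 : 0 < a₀ := by positivity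
  have hA_ge : ∀ s ∈ halfOpen s₀ S, a₀ ≤ A s := by
    intro s hs
    obtain ⟨q1, q2, q3⟩ := p s hs
    have h1 : B s / A s ≤ B s₀ / A s₀ := hBA hm hs hs.1
    rw [ha₀, div_le_iff₀ (by positivity)]
    rw [div_le_iff₀ q1] at h1
    linarith [hC_ge s hs, hBC s hs]
  set δ := (B s₀ - C s₀) / A s₀ with hδ
  have hδ1 : δ < 1 := (div_lt_one a1).2 (hA s₀ hm)
  have hgap : ∀ s ∈ halfOpen s₀ S, (1 - δ) * a₀ ≤ A s - (B s - C s) := by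
    intro s hs
    obtain ⟨q1, q2, q3⟩ := p s hs
    have h1 : (B s - C s) / A s ≤ δ := hDA hm hs hs.1
    rw [div_le_iff₀ q1] at h1
    nlinarith [hA_ge s hs]
  have hspeed : ∀ s ∈ halfOpen s₀ S, speed (A s₀) (B s₀) (B s₀) ≤ speed (A s) (B s) (C s) := by
    intro s hs
    obtain ⟨q1, q2, q3⟩ := p s hs
    unfold speed
    have h1 := hA_le s hs
    have h2 := hB_le s hs
    have h3 : C s ≤ B s₀ := (hBC s hs).le.trans h2
    gcongr
  have hspeed0 := speed_pos a1 b1 b1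
  set c := C s₀ / A s₀ * (speed (A s₀) (B s₀) (B s₀) * (a₀ ^ 2 * (4 * a₀ * ((1 - δ) * a₀)))) with hc
  have hδ0 : 0 < 1 - δ := sub_pos.2 hδ1
  have hc0 : 0 < c := by positivity
  -- B/A has derivative -(B/A)kZ·4(A + B)(A - (B - C)), and every factor after the sign is bounded
  -- below by a positive constant.
  obtain ⟨T, rfl⟩ := exists_end_of_deriv_le h.lt hc0 (fun s hs =>
    hasDerivAt_div_of_log (h.hasDerivB hs) (h.hasDerivA hs) (p s hs).1.ne') (fun s hs => by
      obtain ⟨q1, q2, q3⟩ := p s hs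
      have e := curvY_sub_curvX (a := A s) (b := B s) (c := C s)
      rw [← mul_sub, mul_comm (curvY _ _ _), ← mul_sub,
        show curvX (A s) (B s) (C s) - curvY (A s) (B s) (C s) =
          -(4 * (A s + B s) * (A s - (B s - C s))) by linarith]
      have h1 : C s₀ / A s₀ ≤ B s / A s := by
        have := hC_ge s hs
        have := hBC s hs
        have := hA_le s hs
        gcongr
        linarith
      have h2 : a₀ ^ 2 ≤ curvZ (A s) (B s) (C s) :=
        (pow_le_pow_left₀ ha₀0.le (hA_ge s hs) 2).trans (sq_le_curvZ q1 q3 (hBC s hs))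
      have h3 := hgap s hs
      have h4 : a₀ ≤ A s + B s := by linarith [hA_ge s hs]
      have h5 := hspeed s hs
      have : c ≤ B s / A s * (speed (A s) (B s) (C s) * (curvZ (A s) (B s) (C s) *
          (4 * (A s + B s) * (A s - (B s - C s))))) := by
        rw [hc]
        have := hZ s hs
        have := hk s hs
        gcongr
      linarith) (fun s hs => div_pos (p s hs).2.1 (p s hs).1)
  obtain ⟨a, ha, hla, -⟩ := exists_tendsto_atEnd_of_antitoneOn h.lt hAanti hA_ge
  obtain ⟨b, hb, hlb, -⟩ := exists_tendsto_atEnd_of_antitoneOn h.lt hB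
    (m := C s₀) fun s hs => (hC_ge s hs).trans (hBC s hs).le
  obtain ⟨c', -, hlc, hcle⟩ := exists_tendsto_atEnd_of_monotoneOn h.lt hCmono
    (m := B s₀) fun s hs => (hBC s hs).le.trans (hB_le s hs)
  rw [atEnd_coe] at hla hlb hlc
  exact h.escape T rfl a b c' (ha₀0.trans_le ha) (c1.trans_le hb) (c1.trans_le (hcle s₀ hm))
    hla hlb hlc

/-- Backward in time, orbits with `A ≥ B - C` blow up in `A`. -/
theorem power_law_of_sub_le (h : BackOrbit s₀ S A B C) (h0 : C s₀ < B s₀)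
    (hA : B s₀ - C s₀ ≤ A s₀) :
    ∃ T : ℝ, S = T ∧ ∃ η₁ η₂ η₃ : ℝ, 0 < η₁ ∧ 0 < η₂ ∧ 0 < η₃ ∧
      A ~[𝓝[<] T] (fun s => η₁ * (T - s) ^ (-(1 / 14) : ℝ)) ∧
      B ~[𝓝[<] T] (fun s => η₂ * (T - s) ^ (3 / 14 : ℝ)) ∧
      C ~[𝓝[<] T] (fun s => η₃ * (T - s) ^ (3 / 14 : ℝ)) := by
  obtain ⟨s₁, hs₁, hs₁S⟩ := exists_gt_halfOpen h.lt
  have hA₁ := h.sub_lt_A h0 hA hs₁ hs₁S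
  replace h0 := h.C_lt_B h0 ⟨hs₁.le, hs₁S⟩
  replace h := h.restrict hs₁.le hs₁S
  clear hA hs₁
  have facts : ∀ s ∈ halfOpen s₁ S, 0 < A s ∧ 0 < B s ∧ 0 < C s ∧ C s < B s ∧
      curvX (A s) (B s) (C s) < 0 ∧ 0 < curvZ (A s) (B s) (C s) ∧
      B s - C s < A s ∧ 0 < speed (A s) (B s) (C s) := by
    intro s hs
    obtain ⟨p1, p2, p3⟩ := h.pos s hs.1 hs.2
    have hcb := h.C_lt_B h0 hs
    have hA : B s - C s < A s := by
      rcases hs.1.eq_or_lt with rfl | hlt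
      · exact hA₁
      · exact h.sub_lt_A h0 hA₁.le hlt hs.2
    exact ⟨p1, p2, p3, hcb, curvX_neg p1 p3 hcb hA.le, curvZ_pos p1 p3 hcb, hA,
      speed_pos p1 p2 p3⟩
  have hBanti : AntitoneOn B (halfOpen s₁ S) :=
    antitoneOn_halfOpen (fun s hs => h.hasDerivB hs) fun s hs => by
      obtain ⟨p1, p2, p3, hcb, hX, hZ, hA, hk⟩ := facts s hs
      exact mul_nonpos_of_nonneg_of_nonpos p2.le (mul_nonpos_of_nonneg_of_nonpos hk.le
        (mul_nonpos_of_nonneg_of_nonpos hZ.le hX.le))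
  have hXY : ∀ s ∈ halfOpen s₁ S, curvX (A s) (B s) (C s) ≤ curvY (A s) (B s) (C s) := by
    intro s hs
    obtain ⟨p1, p2, p3, hcb, hX, hZ, hA, hk⟩ := facts s hs
    have e := curvY_sub_curvX (a := A s) (b := B s) (c := C s)
    have : 0 < 4 * (A s + B s) * (A s - (B s - C s)) := mul_pos (by positivity) (by linarith)
    linarith
  have hBAanti : AntitoneOn (fun s => B s / A s) (halfOpen s₁ S) :=
    antitoneOn_halfOpen (fun s hs =>
      hasDerivAt_div_of_log (h.hasDerivB hs) (h.hasDerivA hs) (facts s hs).1.ne') fun s hs => by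
      obtain ⟨p1, p2, p3, hcb, hX, hZ, hA, hk⟩ := facts s hs
      refine mul_nonpos_of_nonneg_of_nonpos (by positivity) ?_
      rw [← mul_sub]
      exact mul_nonpos_of_nonneg_of_nonpos hk.le (by nlinarith [hXY s hs])
  have hDAanti : AntitoneOn (fun s => (B s - C s) / A s) (halfOpen s₁ S) :=
    antitoneOn_halfOpen (fun s hs =>
      hasDerivAt_div_of_log (f := fun s => B s - C s) (h.hasDerivSub hs) (h.hasDerivA hs)
        (facts s hs).1.ne') fun s hs => by
      obtain ⟨p1, p2, p3, hcb, hX, hZ, hA, hk⟩ := facts s hs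
      refine mul_nonpos_of_nonneg_of_nonpos (div_nonneg (sub_pos.2 hcb).le p1.le) ?_
      rw [← mul_sub]
      refine mul_nonpos_of_nonneg_of_nonpos hk.le ?_
      have h1 : curvX (A s) (B s) (C s) * (4 * C s * (A s + B s + C s)) ≤ 0 :=
        mul_nonpos_of_nonpos_of_nonneg hX.le (by positivity)
      nlinarith [hXY s hs]
  obtain ⟨s₂, hs₂, hY₂⟩ := h.exists_curvY_pos (fun s hs => (facts s hs).2.2.2.1)
    (fun s hs => (facts s hs).2.2.2.2.2.2.1) hBAanti hDAanti hBanti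
  have hsub := halfOpen_mono (S := S) hs₂.1
  replace h := h.restrict hs₂.1 hs₂.2
  have hm := left_mem_halfOpen h.lt
  -- With d = (B - C)/A, Y/A² = (1 - d)² - 4(B/A)d. Both d < 1 and B/A are nonincreasing, so once
  -- positive this quantity never drops.
  set ε := curvY (A s₂) (B s₂) (C s₂) / A s₂ ^ 2 with hε
  have hε0 : 0 < ε := div_pos hY₂ (pow_pos (facts s₂ hs₂).1 2)
  have hYε : ∀ s ∈ halfOpen s₂ S, ε * A s ^ 2 ≤ curvY (A s) (B s) (C s) := by
    intro s hs
    obtain ⟨p1, p2, p3, hcb, hX, hZ, hA, hk⟩ := facts s (hsub hs)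
    obtain ⟨q1, q2, q3, hcb', -, -, hA', -⟩ := facts s₂ hs₂
    have e : ∀ a b c : ℝ, 0 < a → curvY a b c / a ^ 2 =
        (1 - (b - c) / a) ^ 2 - 4 * (b / a) * ((b - c) / a) := by
      intro a b c ha
      unfold curvY
      field_simp
      ring
    rw [← le_div_iff₀ (by positivity), hε, e _ _ _ p1, e _ _ _ q1]
    have h1 : B s / A s ≤ B s₂ / A s₂ := hBAanti hs₂ (hsub hs) hs.1
    have h2 : (B s - C s) / A s ≤ (B s₂ - C s₂) / A s₂ := hDAanti hs₂ (hsub hs) hs.1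
    have h3 : (B s₂ - C s₂) / A s₂ < 1 := (div_lt_one q1).2 hA'
    have h4 : 0 < B s / A s := by positivity
    have h5 : 0 < (B s - C s) / A s := div_pos (sub_pos.2 hcb) p1
    have h6 : (1 - (B s₂ - C s₂) / A s₂) ^ 2 ≤ (1 - (B s - C s) / A s) ^ 2 := by
      gcongr
    have h7 : 4 * (B s / A s) * ((B s - C s) / A s) ≤
        4 * (B s₂ / A s₂) * ((B s₂ - C s₂) / A s₂) := by gcongr
    linarith
  have hYpos : ∀ s ∈ halfOpen s₂ S, 0 < curvY (A s) (B s) (C s) := fun s hs =>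
    (mul_pos hε0 (pow_pos (facts s (hsub hs)).1 2)).trans_le (hYε s hs)
  have hYZ : ∀ s ∈ halfOpen s₂ S, curvY (A s) (B s) (C s) ≤ curvZ (A s) (B s) (C s) := by
    intro s hs
    obtain ⟨p1, p2, p3, hcb, hX, hZ, hA, hk⟩ := facts s (hsub hs)
    have e := curvZ_sub_curvY (a := A s) (b := B s) (c := C s)
    have : 0 < 4 * (B s - C s) * (A s + B s + C s) :=
      mul_pos (mul_pos (by norm_num) (sub_pos.2 hcb)) (by positivity)
    linarith
  set K := 25 * B s₂ / ε with hK
  -- Now B, C ≪ A gives Y ≈ Z ≈ A² and X ≈ -3A², so X/Y and X/Z are the relative rates near -3. The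
  -- constant K comes from |X + 3Y|, |X + 3Z| ≤ 25AB and εA² ≤ Y ≤ Z.
  refine exists_power_law (P := A) (q := B) (r := C) (K := K) (θ₀ := ε ^ 2) h.lt (by positivity)
    (θ := fun s => (1 - 2 * (B s / A s - C s / A s) -
      (B s / A s - C s / A s) * (3 * (B s / A s) + C s / A s)) *
      (1 + 2 * (B s / A s - C s / A s) +
      (B s / A s - C s / A s) * (B s / A s + 3 * (C s / A s))))
    (w := fun s => speed (A s) (B s) (C s) * (curvY (A s) (B s) (C s) * curvZ (A s) (B s) (C s)))
    (e₁ := fun s => (curvX (A s) (B s) (C s) + 3 * curvY (A s) (B s) (C s)) /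
      curvY (A s) (B s) (C s))
    (e₂ := fun s => (curvX (A s) (B s) (C s) + 3 * curvZ (A s) (B s) (C s)) /
      curvZ (A s) (B s) (C s))
    (fun s hs => ⟨(facts s (hsub hs)).1, (facts s (hsub hs)).2.1, (facts s (hsub hs)).2.2.1⟩)
    ?_ ?_ ?_ ?_ (fun s hs => h.hasDerivA hs) ?_ ?_ h.escape ?_
  · intro s hs
    obtain ⟨p1, p2, p3, hcb, hX, hZ, hA, hk⟩ := facts s (hsub hs)
    have h1 := hYε s hs
    have h3 : ε * A s ^ 2 * (ε * A s ^ 2) ≤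
        curvY (A s) (B s) (C s) * curvZ (A s) (B s) (C s) :=
      mul_le_mul h1 (h1.trans (hYZ s hs)) (by positivity) (hYpos s hs).le
    rw [show (1 - 2 * (B s / A s - C s / A s) -
      (B s / A s - C s / A s) * (3 * (B s / A s) + C s / A s)) *
      (1 + 2 * (B s / A s - C s / A s) +
      (B s / A s - C s / A s) * (B s / A s + 3 * (C s / A s))) =
      curvY (A s) (B s) (C s) * curvZ (A s) (B s) (C s) / A s ^ 4 by
        unfold curvY curvZ; field_simp]
    rw [le_div_iff₀ (by positivity)]
    linarith
  · intro s hs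
    obtain ⟨p1, p2, p3, hcb, hX, hZ, hA, hk⟩ := facts s (hsub hs)
    unfold speed curvY curvZ
    field_simp
  · intro s hs
    obtain ⟨p1, p2, p3, hcb, hX, hZ, hA, hk⟩ := facts s (hsub hs)
    have h1 := hYε s hs
    have hB1 : B s ≤ B s₂ := hBanti hs₂ (hsub hs) hs.1
    rw [abs_div, abs_of_pos (hYpos s hs), div_le_div_iff₀ (hYpos s hs) p1]
    have h2 : |curvX (A s) (B s) (C s) + 3 * curvY (A s) (B s) (C s)| ≤ 25 * A s * B s := by
      have hD := sub_pos.2 hcb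
      have h3 : (B s - C s) * B s ≤ A s * B s := by gcongr
      have h4 : A s * C s ≤ A s * B s := by gcongr
      have h5 := mul_pos hD p3
      have h6 := mul_pos p1 p3
      have h7 := mul_pos hD p2
      have h8 := mul_pos p1 hD
      unfold curvX curvY
      rw [abs_le]
      constructor <;> nlinarith
    calc _ ≤ 25 * A s * B s₂ * A s := by gcongr; exact h2.trans (by gcongr)
      _ = K * (ε * A s ^ 2) := by rw [hK]; field_simp
      _ ≤ _ := by
        have := (facts s₂ hs₂).2.1
        gcongr
  · intro s hs
    obtain ⟨p1, p2, p3, hcb, hX, hZ, hA, hk⟩ := facts s (hsub hs)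
    have h1 := (hYε s hs).trans (hYZ s hs)
    have hB1 : B s ≤ B s₂ := hBanti hs₂ (hsub hs) hs.1
    rw [abs_div, abs_of_pos hZ, div_le_div_iff₀ hZ p1]
    have h2 : |curvX (A s) (B s) (C s) + 3 * curvZ (A s) (B s) (C s)| ≤ 25 * A s * B s := by
      have hD := sub_pos.2 hcb
      have h3 : (B s - C s) * B s ≤ A s * B s := by gcongr
      have h4 : A s * C s ≤ A s * B s := by gcongr
      have h5 := mul_pos hD p3
      have h6 := mul_pos p1 p3
      have h7 := mul_pos hD p2
      have h8 := mul_pos p1 hD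
      unfold curvX curvZ
      rw [abs_le]
      constructor <;> nlinarith
    calc _ ≤ 25 * A s * B s₂ * A s := by gcongr; exact h2.trans (by gcongr)
      _ = K * (ε * A s ^ 2) := by rw [hK]; field_simp
      _ ≤ _ := by
        have := (facts s₂ hs₂).2.1
        gcongr
  · intro s hs
    have := (hYpos s hs).ne'
    refine (h.hasDerivB hs).congr_deriv ?_
    field_simp
    ring
  · intro s hs
    obtain ⟨p1, p2, p3, hcb, hX, hZ, hA, hk⟩ := facts s (hsub hs)
    refine (h.hasDerivC hs).congr_deriv ?_
    field_simp
    ring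
  · intro l hu hv
    have hcont : Continuous fun p : ℝ × ℝ =>
        (1 - 2 * (p.1 - p.2) - (p.1 - p.2) * (3 * p.1 + p.2)) *
        (1 + 2 * (p.1 - p.2) + (p.1 - p.2) * (p.1 + 3 * p.2)) := by fun_prop
    have := (hcont.tendsto (0, 0)).comp (hu.prodMk_nhds hv)
    simpa [Function.comp_def] using this

end BackOrbit

end SL2XCF

namespace SL2XCF

open Set

namespace BackOrbit

variable {s₀ s₁ : ℝ} {S : EReal} {A B C : ℝ → ℝ}

/-! ### Orbits in the region where the curvature of `f₂ ∧ f₃` is negative and `A < B - C` -/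

/-- The orbit stays in the region between the two basins. -/
def Stays (s₀ : ℝ) (S : EReal) (A B C : ℝ → ℝ) : Prop :=
  ∀ s ∈ halfOpen s₀ S, C s < B s ∧ curvX (A s) (B s) (C s) < 0 ∧ A s < B s - C s

theorem Stays.restrict (hR : Stays s₀ S A B C) (h1 : s₀ ≤ s₁) : Stays s₁ S A B C :=
  fun s hs => hR s (halfOpen_mono h1 hs)

theorem stays_facts (h : BackOrbit s₀ S A B C) (hR : Stays s₀ S A B C) {s : ℝ}
    (hs : s ∈ halfOpen s₀ S) : 0 < A s ∧ 0 < B s ∧ 0 < C s ∧ C s < B s ∧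
      curvX (A s) (B s) (C s) < 0 ∧ curvY (A s) (B s) (C s) < 0 ∧ 0 < curvZ (A s) (B s) (C s) ∧
      A s < B s - C s ∧ 0 < speed (A s) (B s) (C s) := by
  obtain ⟨p1, p2, p3⟩ := h.pos s hs.1 hs.2
  obtain ⟨hcb, hX, hA⟩ := hR s hs
  exact ⟨p1, p2, p3, hcb, hX, curvY_neg p1 p3 hcb hA.le, curvZ_pos p1 p3 hcb, hA,
    speed_pos p1 p2 p3⟩

/-- Such an orbit converges to a degenerate metric with `A = 0` and `B = C`. -/
theorem exists_tendsto_of_stays (h : BackOrbit s₀ S A B C) (hR : Stays s₀ S A B C) :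
    ∃ η : ℝ, 0 < η ∧ Tendsto A (atEnd S) (𝓝 0) ∧ Tendsto B (atEnd S) (𝓝 η) ∧
      Tendsto C (atEnd S) (𝓝 η) := by
  have hm := left_mem_halfOpen h.lt
  have hne := atEnd_neBot h.lt
  have facts := fun s (hs : s ∈ halfOpen s₀ S) => h.stays_facts hR hs
  have hAanti : AntitoneOn A (halfOpen s₀ S) :=
    antitoneOn_halfOpen (fun s hs => h.hasDerivA hs) fun s hs => by
      obtain ⟨p1, p2, p3, hcb, hX, hY, hZ, hA, hk⟩ := facts s hs
      exact mul_nonpos_of_nonneg_of_nonpos p1.le (mul_nonpos_of_nonneg_of_nonpos hk.le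
        (mul_nonpos_of_nonpos_of_nonneg hY.le hZ.le))
  have hBanti : AntitoneOn B (halfOpen s₀ S) :=
    antitoneOn_halfOpen (fun s hs => h.hasDerivB hs) fun s hs => by
      obtain ⟨p1, p2, p3, hcb, hX, hY, hZ, hA, hk⟩ := facts s hs
      exact mul_nonpos_of_nonneg_of_nonpos p2.le (mul_nonpos_of_nonneg_of_nonpos hk.le
        (mul_nonpos_of_nonneg_of_nonpos hZ.le hX.le))
  have hCmono : MonotoneOn C (halfOpen s₀ S) :=
    monotoneOn_halfOpen (fun s hs => h.hasDerivC hs) fun s hs => by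
      obtain ⟨p1, p2, p3, hcb, hX, hY, hZ, hA, hk⟩ := facts s hs
      exact mul_nonneg p3.le (mul_nonneg hk.le (mul_nonneg_of_nonpos_of_nonpos hX.le hY.le))
  obtain ⟨a1, b1, c1, -⟩ := facts s₀ hm
  have hC_ge : ∀ s ∈ halfOpen s₀ S, C s₀ ≤ C s := fun s hs => hCmono hm hs hs.1
  have hB_le : ∀ s ∈ halfOpen s₀ S, B s ≤ B s₀ := fun s hs => hBanti hm hs hs.1
  have hA_le : ∀ s ∈ halfOpen s₀ S, A s ≤ A s₀ := fun s hs => hAanti hm hs hs.1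
  obtain ⟨a, ha0, hla, hale⟩ := exists_tendsto_atEnd_of_antitoneOn h.lt hAanti
    (m := 0) fun s hs => (facts s hs).1.le
  obtain ⟨b, hb, hlb, -⟩ := exists_tendsto_atEnd_of_antitoneOn h.lt hBanti
    (m := C s₀) fun s hs => (hC_ge s hs).trans (facts s hs).2.2.2.1.le
  obtain ⟨c, -, hlc, hcle⟩ := exists_tendsto_atEnd_of_monotoneOn h.lt hCmono
    (m := B s₀) fun s hs => (facts s hs).2.2.2.1.le.trans (hB_le s hs)
  have hb0 := c1.trans_le hb
  -- A positive limit of A would keep A' below a negative constant. The end time would be finite and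
  -- the metric would converge to a nondegenerate one.
  have ha : a = 0 := by
    by_contra hne
    have ha' : 0 < a := lt_of_le_of_ne ha0 (Ne.symm hne)
    set k := a * (speed (A s₀) (B s₀) (B s₀) * (a * (3 * C s₀) * a ^ 2)) with hk
    have hk0 : 0 < k := by have := speed_pos a1 b1 b1; positivity
    obtain ⟨T, rfl⟩ := exists_end_of_deriv_le h.lt hk0 (fun s hs => h.hasDerivA hs)
      (fun s hs => by
        obtain ⟨p1, p2, p3, hcb, hX, hY, hZ, hA, hκ⟩ := facts s hs
        have h1 : speed (A s₀) (B s₀) (B s₀) ≤ speed (A s) (B s) (C s) := by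
          unfold speed
          have h1 := hA_le s hs
          have h2 := hB_le s hs
          have h3 : C s ≤ B s₀ := hcb.le.trans h2
          gcongr
        have h2 : a * (3 * C s₀) ≤ -curvY (A s) (B s) (C s) := by
          have e1 : a ≤ B s - C s := (hale s hs).trans hA.le
          have e2 : 3 * C s₀ ≤ 3 * B s + C s := by linarith [hC_ge s hs]
          have e3 := mul_le_mul e1 e2 (by positivity) (ha'.le.trans e1)
          unfold curvY
          nlinarith
        have h3 : a ^ 2 ≤ curvZ (A s) (B s) (C s) :=
          (pow_le_pow_left₀ ha0 (hale s hs) 2).trans (sq_le_curvZ p1 p3 hcb)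
        have h4 := hale s hs
        have : k ≤ A s * (speed (A s) (B s) (C s) *
            (-curvY (A s) (B s) (C s) * curvZ (A s) (B s) (C s))) := by
          rw [hk]
          have := neg_pos.2 hY
          have := speed_pos a1 b1 b1
          gcongr
        linarith) (fun s hs => (facts s hs).1)
    rw [atEnd_coe] at hla hlb hlc
    exact h.escape T rfl a b c ha' hb0 (c1.trans_le (hcle s₀ hm)) hla hlb hlc
  subst ha
  -- X < 0 means (B - C)² < 2A(B + C) + 3A², and the right side tends to zero.
  have hbc : b = c := by
    have h1 : Tendsto (fun s => (B s - C s) ^ 2) (atEnd S) (𝓝 ((b - c) ^ 2)) := (hlb.sub hlc).pow 2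
    have h2 : Tendsto (fun s => 2 * A s * (B s + C s) + 3 * A s ^ 2) (atEnd S)
        (𝓝 (2 * 0 * (b + c) + 3 * 0 ^ 2)) :=
      ((hla.const_mul 2).mul (hlb.add hlc)).add ((hla.pow 2).const_mul 3)
    have h3 := le_of_tendsto_of_tendsto h1 h2 (by
      filter_upwards [eventually_mem_halfOpen h.lt] with s hs
      have := (facts s hs).2.2.2.2.1
      unfold curvX at this
      linarith)
    have h4 : (b - c) ^ 2 = 0 := le_antisymm (by simpa using h3) (sq_nonneg _)
    exact sub_eq_zero.1 (pow_eq_zero_iff (two_ne_zero) |>.1 h4)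
  subst hbc
  exact ⟨b, hb0, hla, hlb, hlc⟩

/-- -log(B - C) serves as a clock running to infinity. Comparing other logarithms with it replaces
any knowledge of the speed or of the end time. -/
theorem tendsto_log_sub (h : BackOrbit s₀ S A B C) (hR : Stays s₀ S A B C) :
    Tendsto (fun s => Real.log (B s - C s)) (atEnd S) atBot := by
  obtain ⟨η, hη, hA, hB, hC⟩ := h.exists_tendsto_of_stays hR
  refine Real.tendsto_log_nhdsGT_zero.comp (tendsto_nhdsWithin_iff.2 ⟨by simpa using hB.sub hC, ?_⟩)
  filter_upwards [eventually_mem_halfOpen h.lt] with s hs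
  exact sub_pos.2 (hR s hs).1

/-- The two coefficients governing the approach to the degenerate metric. -/
theorem tendsto_coefficients (h : BackOrbit s₀ S A B C) (hR : Stays s₀ S A B C) {η : ℝ}
    (hA : Tendsto A (atEnd S) (𝓝 0)) (hB : Tendsto B (atEnd S) (𝓝 η))
    (hC : Tendsto C (atEnd S) (𝓝 η)) :
    Tendsto (fun s => 2 * (B s + C s) + 3 * A s) (atEnd S) (𝓝 (4 * η)) ∧
    Tendsto (fun s => curvZ (A s) (B s) (C s) + 4 * C s * (A s + B s + C s)) (atEnd S)
      (𝓝 (8 * η ^ 2)) ∧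
    Tendsto (fun s => curvZ (A s) (B s) (C s) / (B s - C s)) (atEnd S) (𝓝 (4 * η)) ∧
    Tendsto (fun s => -curvY (A s) (B s) (C s) * curvZ (A s) (B s) (C s) / (B s - C s) ^ 2)
      (atEnd S) (𝓝 (16 * η ^ 2)) := by
  have hmem := eventually_mem_halfOpen h.lt
  have hD := hB.sub hC
  -- A < B - C bounds this quotient by A. It is the only term of Z/(B - C) and Y/(B - C) not visibly
  -- polynomial.
  have hquad : Tendsto (fun s => A s ^ 2 / (B s - C s)) (atEnd S) (𝓝 0) := by
    refine squeeze_zero' ?_ ?_ hA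
    · filter_upwards [hmem] with s hs
      exact div_nonneg (sq_nonneg _) (sub_pos.2 (hR s hs).1).le
    · filter_upwards [hmem] with s hs
      obtain ⟨p1, p2, p3, hcb, hX, hY, hZ, hAD, hk⟩ := h.stays_facts hR hs
      rw [div_le_iff₀ (sub_pos.2 hcb)]
      nlinarith
  have hZD : Tendsto (fun s => curvZ (A s) (B s) (C s) / (B s - C s)) (atEnd S) (𝓝 (4 * η)) := by
    have := (hquad.add (hA.const_mul 2)).add (hB.add (hC.const_mul 3))
    rw [show 0 + 2 * 0 + (η + 3 * η) = 4 * η by ring] at this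
    refine this.congr' ?_
    filter_upwards [hmem] with s hs
    have := (sub_pos.2 (hR s hs).1).ne'
    unfold curvZ
    field_simp
  have hYD : Tendsto (fun s => -curvY (A s) (B s) (C s) / (B s - C s)) (atEnd S) (𝓝 (4 * η)) := by
    have := ((hA.const_mul 2).sub hquad).add ((hB.const_mul 3).add hC)
    rw [show 2 * 0 - 0 + (3 * η + η) = 4 * η by ring] at this
    refine this.congr' ?_
    filter_upwards [hmem] with s hs
    have := (sub_pos.2 (hR s hs).1).ne'
    unfold curvY
    field_simp
    ring
  refine ⟨?_, ?_, hZD, ?_⟩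
  · have := ((hB.add hC).const_mul 2).add (hA.const_mul 3)
    rwa [show 2 * (η + η) + 3 * 0 = 4 * η by ring] at this
  · have := (((hA.pow 2).add ((hA.const_mul 2).mul hD)).add
      (hD.mul (hB.add (hC.const_mul 3)))).add ((hC.const_mul 4).mul ((hA.add hB).add hC))
    rw [show 0 ^ 2 + 2 * 0 * (η - η) + (η - η) * (η + 3 * η) + 4 * η * (0 + η + η) = 8 * η ^ 2 by
      ring] at this
    exact this
  · have := hYD.mul hZD
    rw [show 4 * η * (4 * η) = 16 * η ^ 2 by ring] at this
    refine this.congr fun s => ?_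
    rw [div_mul_div_comm, sq]

/-- Here -X = A(m - q) with m = 2(B + C) + 3A and q = (B - C)²/A. Pulling out kA leaves q together
with coefficients that have limits. -/
theorem hasDerivLogSub (h : BackOrbit s₀ S A B C) (hR : Stays s₀ S A B C) {s : ℝ}
    (hs : s ∈ halfOpen s₀ S) :
    HasDerivAt (fun s => Real.log (B s - C s)) (-(speed (A s) (B s) (C s) * A s *
      ((2 * (B s + C s) + 3 * A s - (B s - C s) ^ 2 / A s) *
        (curvZ (A s) (B s) (C s) + 4 * C s * (A s + B s + C s))))) s := by
  obtain ⟨p1, p2, p3, hcb, -⟩ := h.stays_facts hR hs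
  have hD := (sub_pos.2 hcb).ne'
  refine ((h.hasDerivSub hs).log hD).congr_deriv ?_
  rw [mul_div_cancel_left₀ _ hD]
  unfold curvX
  field_simp
  ring

theorem hasDerivLogA (h : BackOrbit s₀ S A B C) (hR : Stays s₀ S A B C) {s : ℝ}
    (hs : s ∈ halfOpen s₀ S) :
    HasDerivAt (fun s => Real.log (A s)) (-(speed (A s) (B s) (C s) * A s *
      ((B s - C s) ^ 2 / A s *
        (-curvY (A s) (B s) (C s) * curvZ (A s) (B s) (C s) / (B s - C s) ^ 2)))) s := by
  obtain ⟨p1, p2, p3, hcb, -⟩ := h.stays_facts hR hs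
  have hD := (sub_pos.2 hcb).ne'
  refine ((h.hasDerivA hs).log p1.ne').congr_deriv ?_
  field_simp

/-- The logarithmic derivative of `q = (B - C)² / A`. -/
theorem hasDerivLogQuot (h : BackOrbit s₀ S A B C) (hR : Stays s₀ S A B C) {s : ℝ}
    (hs : s ∈ halfOpen s₀ S) :
    HasDerivAt (fun s => Real.log ((B s - C s) ^ 2 / A s)) (speed (A s) (B s) (C s) * A s *
      ((B s - C s) ^ 2 / A s *
        (-curvY (A s) (B s) (C s) * curvZ (A s) (B s) (C s) / (B s - C s) ^ 2 +
          2 * (curvZ (A s) (B s) (C s) + 4 * C s * (A s + B s + C s))) -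
        2 * (2 * (B s + C s) + 3 * A s) *
          (curvZ (A s) (B s) (C s) + 4 * C s * (A s + B s + C s)))) s := by
  have h1 := ((h.hasDerivLogSub hR hs).const_mul 2).sub (h.hasDerivLogA hR hs)
  refine (h1.congr_of_eventuallyEq ?_).congr_deriv (by ring)
  obtain ⟨p1, p2, p3, hcb, -⟩ := h.stays_facts hR hs
  have hc : ContinuousAt (fun s => B s - C s) s := (h.hasDerivSub hs).continuousAt
  filter_upwards [(h.hasDerivA hs).continuousAt.eventually_ne p1.ne',
    hc.eventually_ne (sub_pos.2 hcb).ne'] with t h1 h2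
  rw [Real.log_div (pow_ne_zero 2 h2) h1, Real.log_pow]
  norm_num

/-- 2η is a repelling equilibrium for q = (B - C)²/A. From above 2η + ε the quotient cannot return,
and log q grows at least like a multiple of -log(B - C), hence without bound; but X < 0 means q <
2(B + C) + 3A → 4η. -/
theorem eventually_quot_lt (h : BackOrbit s₀ S A B C) (hR : Stays s₀ S A B C) {η ε : ℝ}
    (hη : 0 < η) (hε : 0 < ε) (hA : Tendsto A (atEnd S) (𝓝 0)) (hB : Tendsto B (atEnd S) (𝓝 η))
    (hC : Tendsto C (atEnd S) (𝓝 η)) :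
    ∀ᶠ s in atEnd S, (B s - C s) ^ 2 / A s < 2 * η + ε := by
  obtain ⟨hm, hK1, -, hK2⟩ := h.tendsto_coefficients hR hA hB hC
  have e1 : ∀ᶠ s in atEnd S, 16 * η ^ 2 * ε <
      (2 * η + ε) * (-curvY (A s) (B s) (C s) * curvZ (A s) (B s) (C s) / (B s - C s) ^ 2 +
          2 * (curvZ (A s) (B s) (C s) + 4 * C s * (A s + B s + C s))) -
        2 * (2 * (B s + C s) + 3 * A s) *
          (curvZ (A s) (B s) (C s) + 4 * C s * (A s + B s + C s)) := by
    -- The limit is 32η²(2η + ε) - 64η³ = 32η²ε; half of it is kept as a margin.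
    refine (((hK2.add (hK1.const_mul 2)).const_mul (2 * η + ε)).sub
      ((hm.const_mul 2).mul hK1)).eventually (lt_mem_nhds ?_)
    have : 0 < η ^ 2 * ε := by positivity
    nlinarith
  have e2 : ∀ᶠ s in atEnd S, (2 * (B s + C s) + 3 * A s) *
      (curvZ (A s) (B s) (C s) + 4 * C s * (A s + B s + C s)) < 32 * η ^ 3 + 1 :=
    (hm.mul hK1).eventually (gt_mem_nhds (by linarith))
  have e3 : ∀ᶠ s in atEnd S, 2 * (B s + C s) + 3 * A s < 4 * η + 1 :=
    hm.eventually (gt_mem_nhds (by linarith))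
  obtain ⟨s₁, h01, h1S, H⟩ := (eventually_atEnd h.lt).1 (e1.and (e2.and e3))
  replace h := h.restrict h01 h1S
  replace hR := hR.restrict h01
  clear h01 e1 e2 e3
  refine (eventually_atEnd h.lt).2 ⟨s₁, le_rfl, h1S, fun s₂ hs₂ => ?_⟩
  by_contra hcon
  push Not at hcon
  have hsub := halfOpen_mono (S := S) hs₂.1
  replace h := h.restrict hs₂.1 hs₂.2
  replace hR := hR.restrict hs₂.1
  have facts := fun s (hs : s ∈ halfOpen s₂ S) => h.stays_facts hR hs
  have hq0 : ∀ s ∈ halfOpen s₂ S, 0 < (B s - C s) ^ 2 / A s := fun s hs =>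
    div_pos (pow_pos (sub_pos.2 (facts s hs).2.2.2.1) 2) (facts s hs).1
  have hcoef : ∀ s ∈ halfOpen s₂ S, 0 < -curvY (A s) (B s) (C s) * curvZ (A s) (B s) (C s) /
      (B s - C s) ^ 2 + 2 * (curvZ (A s) (B s) (C s) + 4 * C s * (A s + B s + C s)) := by
    intro s hs
    obtain ⟨p1, p2, p3, hcb, hX, hY, hZ, hAD, hk⟩ := facts s hs
    have := neg_pos.2 hY
    have := sub_pos.2 hcb
    positivity
  have hge : ∀ s ∈ halfOpen s₂ S, 2 * η + ε ≤ (B s - C s) ^ 2 / A s := by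
    intro s hs
    rcases hs.1.eq_or_lt with rfl | hlt
    · exact hcon
    have := pos_of_deriv_pos_at_zero (f := fun s => Real.log ((B s - C s) ^ 2 / A s) -
      Real.log (2 * η + ε)) (fun s hs => (h.hasDerivLogQuot hR hs).sub_const _)
      (sub_nonneg.2 (Real.log_le_log (by positivity) hcon)) (fun s hs hz => by
        have e : (B s - C s) ^ 2 / A s = 2 * η + ε :=
          Real.log_injOn_pos (hq0 s hs) (by positivity : 0 < 2 * η + ε) (sub_eq_zero.1 hz)
        obtain ⟨p1, p2, p3, hcb, hX, hY, hZ, hAD, hk⟩ := facts s hs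
        have h1 := (H s (hsub hs)).1
        rw [e]
        have : 0 < 16 * η ^ 2 * ε := by positivity
        exact mul_pos (mul_pos hk p1) (this.trans h1)) hlt hs.2
    exact ((Real.log_lt_log_iff (by positivity) (hq0 s hs)).1 (sub_pos.1 this)).le
  -- Small enough that r times the largest decay rate of log(B - C) stays below the margin 16η²ε,
  -- making log q + r log(B - C) nondecreasing.
  set r := 16 * η ^ 2 * ε / (32 * η ^ 3 + 1) with hr
  have hr0 : 0 < r := by positivity
  have hmono := monotoneOn_halfOpen (fun s hs => (h.hasDerivLogQuot hR hs).add
    ((h.hasDerivLogSub hR hs).const_mul r)) fun s hs => by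
      obtain ⟨p1, p2, p3, hcb, hX, hY, hZ, hAD, hk⟩ := facts s hs
      obtain ⟨h1, h2, h3⟩ := H s (hsub hs)
      have h4 := mul_le_mul_of_nonneg_right (hge s hs) (hcoef s hs).le
      have h5 : r * ((2 * (B s + C s) + 3 * A s) *
          (curvZ (A s) (B s) (C s) + 4 * C s * (A s + B s + C s))) ≤ 16 * η ^ 2 * ε := by
        calc _ ≤ r * (32 * η ^ 3 + 1) := by gcongr
          _ = _ := by rw [hr]; field_simp
      have h6 : 0 ≤ r * ((B s - C s) ^ 2 / A s *
          (curvZ (A s) (B s) (C s) + 4 * C s * (A s + B s + C s))) := by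
        have := (hq0 s hs).le
        positivity
      have h7 : 0 < speed (A s) (B s) (C s) * A s := mul_pos hk p1
      have h8 : ∀ κ u v x : ℝ, κ * u + r * -(κ * x) = κ * (u - r * x) := fun _ _ _ _ => by ring
      rw [h8 _ _ 0]
      refine mul_nonneg h7.le ?_
      linarith
  have hbot := h.tendsto_log_sub hR
  set V := Real.log ((B s₂ - C s₂) ^ 2 / A s₂) + r * Real.log (B s₂ - C s₂) with hV
  have := atEnd_neBot h.lt
  obtain ⟨s, hs1, hs2⟩ := ((hbot.eventually (eventually_lt_atBot
    ((V - Real.log (4 * η + 1)) / r))).and (eventually_mem_halfOpen h.lt)).exists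
  have h1 := hmono (left_mem_halfOpen h.lt) hs2 hs2.1
  simp only [Pi.add_apply] at h1
  have h2 : Real.log ((B s - C s) ^ 2 / A s) ≤ Real.log (4 * η + 1) := by
    obtain ⟨p1, p2, p3, hcb, hX, hY, hZ, hAD, hk⟩ := facts s hs2
    refine Real.log_le_log (hq0 s hs2) ?_
    have h3 := (H s (hsub hs2)).2.2
    rw [div_le_iff₀ p1]
    unfold curvX at hX
    nlinarith
  rw [lt_div_iff₀ hr0] at hs1
  linarith

/-- From below 2η - ε the quotient is driven to zero like a power of B - C. Then log A decreases at
less than half the rate of log(B - C), so A would be at least a constant times √(B - C),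
contradicting A < B - C. -/
theorem eventually_lt_quot (h : BackOrbit s₀ S A B C) (hR : Stays s₀ S A B C) {η ε : ℝ}
    (hη : 0 < η) (hε : 0 < ε) (hεη : ε < 2 * η) (hA : Tendsto A (atEnd S) (𝓝 0))
    (hB : Tendsto B (atEnd S) (𝓝 η)) (hC : Tendsto C (atEnd S) (𝓝 η)) :
    ∀ᶠ s in atEnd S, 2 * η - ε < (B s - C s) ^ 2 / A s := by
  obtain ⟨hm, hK1, -, hK2⟩ := h.tendsto_coefficients hR hA hB hC
  have e1 : ∀ᶠ s in atEnd S,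
      (2 * η - ε) * (-curvY (A s) (B s) (C s) * curvZ (A s) (B s) (C s) / (B s - C s) ^ 2 +
          2 * (curvZ (A s) (B s) (C s) + 4 * C s * (A s + B s + C s))) -
        2 * (2 * (B s + C s) + 3 * A s) *
          (curvZ (A s) (B s) (C s) + 4 * C s * (A s + B s + C s)) < -(16 * η ^ 2 * ε) := by
    refine (((hK2.add (hK1.const_mul 2)).const_mul (2 * η - ε)).sub
      ((hm.const_mul 2).mul hK1)).eventually (gt_mem_nhds ?_)
    have : 0 < η ^ 2 * ε := by positivity
    nlinarith
  have e2 : ∀ᶠ s in atEnd S, (2 * (B s + C s) + 3 * A s) *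
      (curvZ (A s) (B s) (C s) + 4 * C s * (A s + B s + C s)) < 32 * η ^ 3 + 1 :=
    (hm.mul hK1).eventually (gt_mem_nhds (by linarith))
  obtain ⟨s₁, h01, h1S, H⟩ := (eventually_atEnd h.lt).1 (e1.and e2)
  replace h := h.restrict h01 h1S
  replace hR := hR.restrict h01
  clear h01 e1 e2
  refine (eventually_atEnd h.lt).2 ⟨s₁, le_rfl, h1S, fun s₂ hs₂ => ?_⟩
  by_contra hcon
  push Not at hcon
  have hsub := halfOpen_mono (S := S) hs₂.1
  replace h := h.restrict hs₂.1 hs₂.2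
  replace hR := hR.restrict hs₂.1
  have facts := fun s (hs : s ∈ halfOpen s₂ S) => h.stays_facts hR hs
  have hε' : 0 < 2 * η - ε := by linarith
  have hq0 : ∀ s ∈ halfOpen s₂ S, 0 < (B s - C s) ^ 2 / A s := fun s hs =>
    div_pos (pow_pos (sub_pos.2 (facts s hs).2.2.2.1) 2) (facts s hs).1
  have hcoef : ∀ s ∈ halfOpen s₂ S, 0 < -curvY (A s) (B s) (C s) * curvZ (A s) (B s) (C s) /
      (B s - C s) ^ 2 + 2 * (curvZ (A s) (B s) (C s) + 4 * C s * (A s + B s + C s)) := by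
    intro s hs
    obtain ⟨p1, p2, p3, hcb, hX, hY, hZ, hAD, hk⟩ := facts s hs
    have := neg_pos.2 hY
    have := sub_pos.2 hcb
    positivity
  have hle : ∀ s ∈ halfOpen s₂ S, (B s - C s) ^ 2 / A s ≤ 2 * η - ε := by
    intro s hs
    rcases hs.1.eq_or_lt with rfl | hlt
    · exact hcon
    have := pos_of_deriv_pos_at_zero (f := fun s => Real.log (2 * η - ε) -
      Real.log ((B s - C s) ^ 2 / A s)) (fun s hs => (h.hasDerivLogQuot hR hs).const_sub _)
      (sub_nonneg.2 (Real.log_le_log (hq0 s₂ (left_mem_halfOpen h.lt)) hcon)) (fun s hs hz => by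
        have e : (B s - C s) ^ 2 / A s = 2 * η - ε :=
          Real.log_injOn_pos (hq0 s hs) hε' (sub_eq_zero.1 hz).symm
        obtain ⟨p1, p2, p3, hcb, hX, hY, hZ, hAD, hk⟩ := facts s hs
        have h1 := (H s (hsub hs)).1
        rw [e]
        have : 0 < 16 * η ^ 2 * ε := by positivity
        exact neg_pos.2 (mul_neg_of_pos_of_neg (mul_pos hk p1) (by linarith))) hlt hs.2
    exact ((Real.log_lt_log_iff (hq0 s hs) hε').1 (sub_pos.1 this)).le
  set r := 16 * η ^ 2 * ε / (32 * η ^ 3 + 1) with hr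
  have hr0 : 0 < r := by positivity
  have hbot := h.tendsto_log_sub hR
  have hanti := antitoneOn_halfOpen (fun s hs => (h.hasDerivLogQuot hR hs).sub
    ((h.hasDerivLogSub hR hs).const_mul r)) fun s hs => by
      obtain ⟨p1, p2, p3, hcb, hX, hY, hZ, hAD, hk⟩ := facts s hs
      obtain ⟨h1, h2⟩ := H s (hsub hs)
      have h4 := mul_le_mul_of_nonneg_right (hle s hs) (hcoef s hs).le
      have h5 : r * ((2 * (B s + C s) + 3 * A s) *
          (curvZ (A s) (B s) (C s) + 4 * C s * (A s + B s + C s))) ≤ 16 * η ^ 2 * ε := by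
        calc _ ≤ r * (32 * η ^ 3 + 1) := by gcongr
          _ = _ := by rw [hr]; field_simp
      have h6 : 0 ≤ r * ((B s - C s) ^ 2 / A s *
          (curvZ (A s) (B s) (C s) + 4 * C s * (A s + B s + C s))) := by
        have := (hq0 s hs).le
        positivity
      have h7 : 0 < speed (A s) (B s) (C s) * A s := mul_pos hk p1
      have h8 : ∀ κ u x : ℝ, κ * u - r * -(κ * x) = κ * (u + r * x) := fun _ _ _ => by ring
      rw [h8]
      refine mul_nonpos_of_nonneg_of_nonpos h7.le ?_
      linarith
  set V := Real.log ((B s₂ - C s₂) ^ 2 / A s₂) - r * Real.log (B s₂ - C s₂) with hV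
  have hq_lim : Tendsto (fun s => (B s - C s) ^ 2 / A s) (atEnd S) (𝓝 0) := by
    have h1 : Tendsto (fun s => Real.exp (V + r * Real.log (B s - C s))) (atEnd S) (𝓝 0) :=
      Real.tendsto_exp_atBot.comp (tendsto_atBot_add_const_left _ _ (hbot.const_mul_atBot hr0))
    refine squeeze_zero' ?_ ?_ h1
    · filter_upwards [eventually_mem_halfOpen h.lt] with s hs using (hq0 s hs).le
    · filter_upwards [eventually_mem_halfOpen h.lt] with s hs
      rw [← Real.log_le_iff_le_exp (hq0 s hs)]
      have h2 := hanti (left_mem_halfOpen h.lt) hs hs.1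
      simp only [Pi.sub_apply] at h2
      linarith
  -- As q → 0 the decay rate of log A tends to 0 and that of log(B - C) to 32η³, both up to the
  -- common factor kA.
  have e3 : ∀ᶠ s in atEnd S, (B s - C s) ^ 2 / A s *
        (-curvY (A s) (B s) (C s) * curvZ (A s) (B s) (C s) / (B s - C s) ^ 2) <
      1 / 2 * ((2 * (B s + C s) + 3 * A s - (B s - C s) ^ 2 / A s) *
        (curvZ (A s) (B s) (C s) + 4 * C s * (A s + B s + C s))) := by
    refine (hq_lim.mul hK2).eventually_lt (((hm.sub hq_lim).mul hK1).const_mul (1 / 2)) ?_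
    have : 0 < η ^ 3 := by positivity
    nlinarith
  obtain ⟨s₃, h23, h3S, H3⟩ := (eventually_atEnd h.lt).1 e3
  replace h := h.restrict h23 h3S
  replace hR := hR.restrict h23
  have hmono := monotoneOn_halfOpen (fun s hs => (h.hasDerivLogA hR hs).sub
    ((h.hasDerivLogSub hR hs).const_mul (1 / 2))) fun s hs => by
      obtain ⟨p1, p2, p3, hcb, hX, hY, hZ, hAD, hk⟩ := h.stays_facts hR hs
      have h1 := H3 s hs
      have h7 : 0 < speed (A s) (B s) (C s) * A s := mul_pos hk p1
      have h8 : ∀ κ u x : ℝ, -(κ * u) - 1 / 2 * -(κ * x) = κ * (1 / 2 * x - u) :=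
        fun _ _ _ => by ring
      rw [h8]
      exact mul_nonneg h7.le (by linarith)
  set V' := Real.log (A s₃) - 1 / 2 * Real.log (B s₃ - C s₃) with hV'
  have := atEnd_neBot h.lt
  obtain ⟨s, hs1, hs2⟩ := ((hbot.eventually (eventually_lt_atBot (2 * V'))).and
    (eventually_mem_halfOpen h.lt)).exists
  have h1 := hmono (left_mem_halfOpen h.lt) hs2 hs2.1
  obtain ⟨p1, p2, p3, hcb, hX, hY, hZ, hAD, hk⟩ := h.stays_facts hR hs2
  have h2 := Real.log_lt_log p1 hAD
  simp only [Pi.sub_apply] at h1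
  linarith

/-- Along an orbit between the two basins, `(B - C)² ~ 2 η A`. -/
theorem tendsto_quot (h : BackOrbit s₀ S A B C) (hR : Stays s₀ S A B C) {η : ℝ} (hη : 0 < η)
    (hA : Tendsto A (atEnd S) (𝓝 0)) (hB : Tendsto B (atEnd S) (𝓝 η))
    (hC : Tendsto C (atEnd S) (𝓝 η)) :
    Tendsto (fun s => (B s - C s) ^ 2 / A s) (atEnd S) (𝓝 (2 * η)) := by
  rw [tendsto_order]
  constructor
  · intro a ha
    -- The minimum with η keeps ε below 2η, as the lower bound requires.
    have h1 : 0 < min (2 * η - a) η := lt_min (by linarith) hη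
    filter_upwards [h.eventually_lt_quot hR hη h1
      ((min_le_right _ _).trans_lt (by linarith)) hA hB hC] with s hs
    linarith [min_le_left (2 * η - a) η]
  · intro a ha
    filter_upwards [h.eventually_quot_lt hR hη (sub_pos.2 ha) hA hB hC] with s hs
    linarith

/-- The asymptotic behavior of orbits between the two basins. -/
theorem asymptotics_of_stays (h : BackOrbit s₀ S A B C) (hR : Stays s₀ S A B C) :
    ∃ T : ℝ, S = T ∧ ∃ η : ℝ, 0 < η ∧
      A ~[𝓝[<] T] (fun s => 64 * η⁻¹ * (T - s)) ∧
      (fun s => B s - η) ~[𝓝[<] T] (fun s => 4 * √(2 * (T - s))) ∧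
      (fun s => C s - η) ~[𝓝[<] T] (fun s => -(4 * √(2 * (T - s)))) := by
  obtain ⟨η, hη, hA, hB, hC⟩ := h.exists_tendsto_of_stays hR
  obtain ⟨hm, hK1, hZD, -⟩ := h.tendsto_coefficients hR hA hB hC
  have hq := h.tendsto_quot hR hη hA hB hC
  have dD2 : ∀ s ∈ halfOpen s₀ S, HasDerivAt (fun s => (B s - C s) ^ 2)
      (4 * ((B s - C s) ^ 2 / A s) * ((B s - C s) ^ 2 / A s - (2 * (B s + C s) + 3 * A s)) *
        (curvZ (A s) (B s) (C s) + 4 * C s * (A s + B s + C s)) / (B s * C s) ^ 2) s := by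
    intro s hs
    obtain ⟨p1, p2, p3, hcb, -⟩ := h.stays_facts hR hs
    refine (show HasDerivAt (fun s => (B s - C s) ^ 2) _ s from
      (h.hasDerivSub hs).pow 2).congr_deriv ?_
    unfold speed curvX
    field_simp
    ring
  have hlim : Tendsto (fun s => 4 * ((B s - C s) ^ 2 / A s) *
      ((B s - C s) ^ 2 / A s - (2 * (B s + C s) + 3 * A s)) *
        (curvZ (A s) (B s) (C s) + 4 * C s * (A s + B s + C s)) / (B s * C s) ^ 2) (atEnd S)
      (𝓝 (-128)) := by
    have := (((hq.const_mul 4).mul (hq.sub hm)).mul hK1).div ((hB.mul hC).pow 2) (by positivity)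
    rw [show 4 * (2 * η) * (2 * η - 4 * η) * (8 * η ^ 2) / (η * η) ^ 2 = -128 by
      field_simp; norm_num] at this
    exact this
  -- The derivative of (B - C)² tends to -128, so it is eventually below -64 and the end time is
  -- finite.
  obtain ⟨T, rfl⟩ : ∃ T : ℝ, S = T := by
    obtain ⟨s₁, h1, h1S, H⟩ := (eventually_atEnd h.lt).1
      (hlim.eventually (gt_mem_nhds (by norm_num : (-128 : ℝ) < -64)))
    refine exists_end_of_deriv_le h1S (by norm_num : (0 : ℝ) < 64)
      (fun s hs => dD2 s (halfOpen_mono h1 hs)) (fun s hs => (H s hs).le)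
      (fun s hs => pow_pos (sub_pos.2 (hR s (halfOpen_mono h1 hs)).1) 2)
  have hmem := eventually_mem_halfOpen h.lt
  rw [atEnd_coe] at hA hB hC hm hK1 hZD hq hlim hmem
  have hTs : ∀ᶠ s in 𝓝[<] T, 0 < T - s := by
    filter_upwards [self_mem_nhdsWithin] with s hs using sub_pos.2 hs
  have hT0 : Tendsto (fun s => T - s) (𝓝[<] T) (𝓝 0) := by
    have : Tendsto (fun s => T - s) (𝓝 T) (𝓝 (T - T)) := tendsto_const_nhds.sub tendsto_id
    rw [sub_self] at this
    exact this.mono_left nhdsWithin_le_nhds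
  have hD0 : Tendsto (fun s => B s - C s) (𝓝[<] T) (𝓝 0) := by simpa using hB.sub hC
  have hD2 : Tendsto (fun s => (B s - C s) ^ 2 / (T - s)) (𝓝[<] T) (𝓝 128) := by
    refine HasDerivAt.lhopital_zero_nhdsLT (g' := fun _ => -1)
      (by filter_upwards [hmem] with s hs using dD2 s hs)
      (Eventually.of_forall fun s => by simpa using (hasDerivAt_id s).const_sub T) (by simp)
      (by simpa using hD0.pow 2) hT0 ?_
    have := hlim.div_const (-1)
    norm_num at this ⊢
    exact this
  have hAlim : Tendsto (fun s => A s / (T - s)) (𝓝[<] T) (𝓝 (64 * η⁻¹)) := by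
    have := hD2.div hq (by positivity)
    rw [show 128 / (2 * η) = 64 * η⁻¹ by field_simp; norm_num] at this
    refine this.congr' ?_
    filter_upwards [hmem, hTs] with s hs hs'
    obtain ⟨p1, p2, p3, hcb, -⟩ := h.stays_facts hR hs
    have := (sub_pos.2 hcb).ne'
    simp only [Pi.div_apply]
    field_simp
  -- B and C share the gap equally: by L'Hôpital the ratio tends to the limit of B'/(B - C)', which
  -- is η·4η/(8η²) = 1/2.
  have hBlim : Tendsto (fun s => (B s - η) / (B s - C s)) (𝓝[<] T) (𝓝 (1 / 2)) := by
    refine HasDerivAt.lhopital_zero_nhdsLT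
      (by filter_upwards [hmem] with s hs using (h.hasDerivB hs).sub_const η)
      (by filter_upwards [hmem] with s hs using h.hasDerivSub hs) ?_ (by simpa using hB.sub_const η)
      hD0 ?_
    · filter_upwards [hmem] with s hs
      obtain ⟨p1, p2, p3, hcb, hX, hY, hZ, hAD, hk⟩ := h.stays_facts hR hs
      exact mul_ne_zero (sub_pos.2 hcb).ne' (mul_ne_zero hk.ne'
        (mul_ne_zero hX.ne (by positivity)))
    · have := (hB.mul hZD).div hK1 (by positivity)
      rw [show η * (4 * η) / (8 * η ^ 2) = 1 / 2 by field_simp; norm_num] at this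
      refine this.congr' ?_
      filter_upwards [hmem] with s hs
      obtain ⟨p1, p2, p3, hcb, hX, hY, hZ, hAD, hk⟩ := h.stays_facts hR hs
      have h1 := (sub_pos.2 hcb).ne'
      have h2 : curvZ (A s) (B s) (C s) + 4 * C s * (A s + B s + C s) ≠ 0 := by positivity
      have h3 := hX.ne
      simp only [Pi.div_apply]
      field_simp
  have hDlim : Tendsto (fun s => (B s - C s) / √(2 * (T - s))) (𝓝[<] T) (𝓝 8) := by
    have h1 := (Real.continuous_sqrt.tendsto _).comp (hD2.div_const 2)
    rw [show (128 : ℝ) / 2 = 8 ^ 2 by norm_num, Real.sqrt_sq (by norm_num)] at h1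
    refine h1.congr' ?_
    filter_upwards [hmem, hTs] with s hs hs'
    simp only [Function.comp_apply]
    rw [div_div, Real.sqrt_div (sq_nonneg _), Real.sqrt_sq (sub_pos.2 (hR s hs).1).le,
      mul_comm (T - s)]
  have hsq : ∀ᶠ s in 𝓝[<] T, √(2 * (T - s)) ≠ 0 := by
    filter_upwards [hTs] with s hs
    exact (Real.sqrt_pos.2 (by linarith)).ne'
  refine ⟨T, rfl, η, hη, isEquivalent_const_mul_of_tendsto_div (by positivity) ?_ hAlim,
    isEquivalent_const_mul_of_tendsto_div (by norm_num) hsq ?_, ?_⟩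
  · filter_upwards [hTs] with s hs using hs.ne'
  · have := hBlim.mul hDlim
    rw [show (1 / 2 : ℝ) * 8 = 4 by norm_num] at this
    refine this.congr' ?_
    filter_upwards [hmem] with s hs
    have := (sub_pos.2 (hR s hs).1).ne'
    field_simp
  · simp only [← neg_mul]
    refine isEquivalent_const_mul_of_tendsto_div (by norm_num) hsq ?_
    have := (hBlim.sub_const 1).mul hDlim
    rw [show (1 / 2 - 1 : ℝ) * 8 = -4 by norm_num] at this
    refine this.congr' ?_
    filter_upwards [hmem] with s hs
    have := (sub_pos.2 (hR s hs).1).ne'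
    field_simp
    ring

end BackOrbit

end SL2XCF

namespace SL2XCF

open Set

/-! ### Classification of initial conditions -/

theorem isEquivalent_comp_neg {T : ℝ} {A u f v : ℝ → ℝ} (h : A ~[𝓝[<] T] u)
    (hf : ∀ᶠ t in 𝓝[>] (-T), f t = A (-t)) (hv : ∀ t, v t = u (-t)) : f ~[𝓝[>] (-T)] v := by
  have h1 := h.comp_tendsto (tendsto_neg_nhdsGT_neg (a := T))
  rw [show v = u ∘ Neg.neg from funext hv]
  exact h1.congr_left (by filter_upwards [hf] with t ht using ht.symm)

theorem tendsto_add_nhdsGT (T : ℝ) : Tendsto (fun t => t + T) (𝓝[>] (-T)) (𝓝[>] 0) := by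
  rw [tendsto_nhdsWithin_iff]
  refine ⟨?_, ?_⟩
  · have : Tendsto (fun t => t + T) (𝓝 (-T)) (𝓝 (-T + T)) := tendsto_id.add tendsto_const_nhds
    rw [neg_add_cancel] at this
    exact this.mono_left nhdsWithin_le_nhds
  · filter_upwards [self_mem_nhdsWithin] with t ht
    have : -T < t := ht
    simp only [mem_Ioi]
    linarith

theorem tendsto_atTop_of_isEquivalent {T η : ℝ} (hη : 0 < η) {f : ℝ → ℝ}
    (h : f ~[𝓝[>] (-T)] (fun t => η * (t + T) ^ (-(1 / 14) : ℝ))) :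
    Tendsto f (𝓝[>] (-T)) atTop := by
  refine h.symm.tendsto_atTop (Tendsto.const_mul_atTop hη ?_)
  exact (tendsto_rpow_neg_nhdsGT_zero (by norm_num)).comp (tendsto_add_nhdsGT T)

theorem tendsto_zero_of_isEquivalent {T η : ℝ} {f : ℝ → ℝ}
    (h : f ~[𝓝[>] (-T)] (fun t => η * (t + T) ^ (3 / 14 : ℝ))) :
    Tendsto f (𝓝[>] (-T)) (𝓝 0) := by
  refine h.symm.tendsto_nhds ?_
  have h1 : Tendsto (fun x : ℝ => x ^ (3 / 14 : ℝ)) (𝓝[>] 0) (𝓝 0) := by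
    have := (Real.continuousAt_rpow_const 0 (3 / 14 : ℝ) (Or.inr (by norm_num))).tendsto
    rw [Real.zero_rpow (by norm_num)] at this
    exact this.mono_left nhdsWithin_le_nhds
  simpa using (h1.comp (tendsto_add_nhdsGT T)).const_mul η

/-- Mutual exclusion of the behaviors turns the implications from regions to behaviors into
equivalences, since the regions exhaust all orbits. -/
theorem Case1.not_case2 {S : EReal} {A B C : ℝ → ℝ} (h1 : Case1 S A B C) : ¬ Case2 S A B C := by
  rintro ⟨T', h, _, _, _, _, _, _, hA', _⟩
  obtain ⟨T, rfl, _, _, _, h1, _, _, hA, _⟩ := h1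
  obtain rfl : T = T' := by exact_mod_cast h
  exact not_tendsto_nhds_of_tendsto_atTop (tendsto_atTop_of_isEquivalent h1 hA) _
    (tendsto_zero_of_isEquivalent hA')

theorem Case1.not_case3 {S : EReal} {A B C : ℝ → ℝ} (h1 : Case1 S A B C) : ¬ Case3 S A B C := by
  rintro ⟨T', h, η, _, hA', _⟩
  obtain ⟨T, rfl, _, _, _, h1, _, _, hA, _⟩ := h1
  obtain rfl : T = T' := by exact_mod_cast h
  refine not_tendsto_nhds_of_tendsto_atTop (tendsto_atTop_of_isEquivalent h1 hA) _
    (hA'.symm.tendsto_nhds (((tendsto_nhdsWithin_iff.1 (tendsto_add_nhdsGT T)).1).const_mul _))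

theorem Case2.not_case3 {S : EReal} {A B C : ℝ → ℝ} (h1 : Case2 S A B C) : ¬ Case3 S A B C := by
  rintro ⟨T', h, η, _, _, hB', _⟩
  obtain ⟨T, rfl, _, _, _, _, h1, _, _, hB, _⟩ := h1
  obtain rfl : T = T' := by exact_mod_cast h
  have h2 : Tendsto (fun t => 4 * √(2 * (t + T))) (𝓝[>] (-T)) (𝓝 (4 * √(2 * 0))) :=
    (((tendsto_nhdsWithin_iff.1 (tendsto_add_nhdsGT T)).1.const_mul 2).sqrt).const_mul 4
  have h3 := (hB'.symm.tendsto_nhds h2).add_const η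
  simp only [sub_add_cancel] at h3
  exact not_tendsto_nhds_of_tendsto_atTop (tendsto_atTop_of_isEquivalent h1 hB) _ h3

theorem isOpen_Q : IsOpen Q :=
  (isOpen_lt continuous_const continuous_fst).inter
    ((isOpen_lt (continuous_snd.comp continuous_snd) (continuous_fst.comp continuous_snd)).inter
      (isOpen_lt continuous_const (continuous_snd.comp continuous_snd)))

theorem Q_subset_octant : Q ⊆ octant := fun _ hp => ⟨hp.1, hp.2.2.trans hp.2.1, hp.2.2⟩

/-- The lower bound for `A` in `Case3Condition` says that the sectional curvature `X` is
nonpositive. -/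
theorem sqrt_le_iff_curvX_nonpos {a b c : ℝ} (ha : 0 < a) (hb : 0 < b) (hc : 0 < c) :
    (1 / 3) * (2 * √(b ^ 2 - b * c + c ^ 2) - b - c) ≤ a ↔ curvX a b c ≤ 0 := by
  rw [show (1 / 3) * (2 * √(b ^ 2 - b * c + c ^ 2) - b - c) ≤ a ↔
    √(b ^ 2 - b * c + c ^ 2) ≤ (3 * a + b + c) / 2 by constructor <;> intro h <;> linarith,
    Real.sqrt_le_left (by positivity)]
  unfold curvX
  constructor <;> intro h <;> nlinarith

namespace BackOrbit

variable {s₀ : ℝ} {S : EReal} {A B C : ℝ → ℝ}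

/-- An orbit meeting the boundary of a trapping region is strictly inside at all later times. The
strict inequality s₀ < s is provided because `Case3Condition` says nothing about the initial time.
-/
theorem stays_or (h : BackOrbit s₀ S A B C) (h0 : C s₀ < B s₀) :
    (∃ s ∈ halfOpen s₀ S, s₀ < s ∧ B s - C s < A s) ∨
    (∃ s ∈ halfOpen s₀ S, s₀ < s ∧ 0 < curvX (A s) (B s) (C s)) ∨ Stays s₀ S A B C := by
  by_contra! hcon
  obtain ⟨h1, h2, h3⟩ := hcon
  refine h3 fun s hs => ?_
  have hcb := h.C_lt_B h0 hs
  obtain ⟨s', hs', hS'⟩ := exists_gt_halfOpen hs.2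
  have hm : s' ∈ halfOpen s₀ S := ⟨hs.1.trans hs'.le, hS'⟩
  refine ⟨hcb, ?_, ?_⟩
  · by_contra! hX
    exact absurd ((h.restrict hs.1 hs.2).curvX_pos hcb hX hs' hS')
      (h2 s' hm (hs.1.trans_lt hs')).not_gt
  · by_contra! hA
    exact absurd ((h.restrict hs.1 hs.2).sub_lt_A hcb hA hs' hS')
      (h1 s' hm (hs.1.trans_lt hs')).not_gt

end BackOrbit

/-- Along the orbit of an initial condition in `Q`, the behavior is determined by which of the
regions `B - C < A` and `0 < X` the orbit enters. -/
theorem exists_classified_orbit {p : ℝ × ℝ × ℝ} (hp : p ∈ Q) :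
    ∃ (S : EReal) (A B C : ℝ → ℝ), BackOrbit 0 S A B C ∧ (A 0, B 0, C 0) = p ∧
      (p ∈ initialSet Case1 ↔ ∃ s ∈ halfOpen 0 S, B s - C s < A s) ∧
      (p ∈ initialSet Case2 ↔ ∃ s ∈ halfOpen 0 S, 0 < curvX (A s) (B s) (C s)) ∧
      (p ∈ initialSet Case3 ↔ BackOrbit.Stays 0 S A B C) ∧
      (p ∈ initialSet Case3Condition ↔ BackOrbit.Stays 0 S A B C) := by
  obtain ⟨S, A, B, C, h, hp0, ⟨Tf₀, g₀, hg₀⟩, hall⟩ := exists_backOrbit (Q_subset_octant hp)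
  have h0 : C 0 < B 0 := by
    have := hp.2.1
    rw [← hp0] at this
    exact this
  have hev : ∀ {Tb Tf g}, IsMaximalXCF p Tb Tf g → ∀ T : ℝ, S = T → ∀ᶠ t in 𝓝[>] (-T),
      g t 0 0 = A (-t) ∧ g t 1 1 = B (-t) ∧ g t 2 2 = C (-t) := by
    intro Tb Tf g hg T hT
    have hT0 : 0 < T := by
      have := h.lt
      rw [hT] at this
      exact_mod_cast this
    filter_upwards [Ioo_mem_nhdsGT (neg_lt_zero.2 hT0)] with t ht
    exact (hall _ _ _ hg).2.2 t (by rw [hT]; exact_mod_cast ht.1) ht.2.le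
  have e1 : (∃ s ∈ halfOpen 0 S, B s - C s < A s) → p ∈ initialSet Case1 := by
    rintro ⟨s, hs, hA⟩
    refine ⟨hp, fun Tb Tf g hg => ?_⟩
    obtain ⟨T, rfl, η₁, η₂, η₃, p1, p2, p3, hA, hB, hC⟩ :=
      (h.restrict hs.1 hs.2).power_law_of_sub_le (h.C_lt_B h0 hs) hA.le
    have hev := hev hg T rfl
    refine ⟨T, (hall _ _ _ hg).1, η₁, η₂, η₃, p1, p2, p3, ?_, ?_, ?_⟩
    · exact isEquivalent_comp_neg hA (hev.mono fun _ h => h.1) fun t => by simp [add_comm]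
    · exact isEquivalent_comp_neg hB (hev.mono fun _ h => h.2.1) fun t => by simp [add_comm]
    · exact isEquivalent_comp_neg hC (hev.mono fun _ h => h.2.2) fun t => by simp [add_comm]
  have e2 : (∃ s ∈ halfOpen 0 S, 0 < curvX (A s) (B s) (C s)) → p ∈ initialSet Case2 := by
    rintro ⟨s, hs, hX⟩
    refine ⟨hp, fun Tb Tf g hg => ?_⟩
    obtain ⟨T, rfl, η₁, η₂, η₃, p1, p2, p3, hB, hA, hC⟩ :=
      (h.restrict hs.1 hs.2).power_law_of_curvX_nonneg (h.C_lt_B h0 hs) hX.le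
    have hev := hev hg T rfl
    refine ⟨T, (hall _ _ _ hg).1, η₂, η₁, η₃, p2, p1, p3, ?_, ?_, ?_⟩
    · exact isEquivalent_comp_neg hA (hev.mono fun _ h => h.1) fun t => by simp [add_comm]
    · exact isEquivalent_comp_neg hB (hev.mono fun _ h => h.2.1) fun t => by simp [add_comm]
    · exact isEquivalent_comp_neg hC (hev.mono fun _ h => h.2.2) fun t => by simp [add_comm]
  have e3 : BackOrbit.Stays 0 S A B C → p ∈ initialSet Case3 := by
    intro hR
    refine ⟨hp, fun Tb Tf g hg => ?_⟩
    obtain ⟨T, rfl, η, hη, hA, hB, hC⟩ := h.asymptotics_of_stays hR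
    have hev := hev hg T rfl
    refine ⟨T, (hall _ _ _ hg).1, η, hη, ?_, ?_, ?_⟩
    · exact isEquivalent_comp_neg hA (hev.mono fun _ h => h.1) fun t => by simp [add_comm]
    · exact isEquivalent_comp_neg hB (hev.mono fun _ h => by simp [h.2.1])
        fun t => by simp [add_comm]
    · exact isEquivalent_comp_neg hC (hev.mono fun _ h => by simp [h.2.2])
        fun t => by simp [add_comm]
  have tri := h.stays_or h0
  refine ⟨S, A, B, C, h, hp0, ⟨fun hc => ?_, e1⟩, ⟨fun hc => ?_, e2⟩, ⟨fun hc => ?_, e3⟩,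
    ⟨fun hc => ?_, fun hR => ?_⟩⟩
  · rcases tri with ⟨s, hs, -, H⟩ | ⟨s, hs, -, H⟩ | H
    · exact ⟨s, hs, H⟩
    · exact ((hc.2 _ _ _ hg₀).not_case2 ((e2 ⟨s, hs, H⟩).2 _ _ _ hg₀)).elim
    · exact ((hc.2 _ _ _ hg₀).not_case3 ((e3 H).2 _ _ _ hg₀)).elim
  · rcases tri with ⟨s, hs, -, H⟩ | ⟨s, hs, -, H⟩ | H
    · exact (((e1 ⟨s, hs, H⟩).2 _ _ _ hg₀).not_case2 (hc.2 _ _ _ hg₀)).elim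
    · exact ⟨s, hs, H⟩
    · exact ((hc.2 _ _ _ hg₀).not_case3 ((e3 H).2 _ _ _ hg₀)).elim
  · rcases tri with ⟨s, hs, -, H⟩ | ⟨s, hs, -, H⟩ | H
    · exact (((e1 ⟨s, hs, H⟩).2 _ _ _ hg₀).not_case3 (hc.2 _ _ _ hg₀)).elim
    · exact (((e2 ⟨s, hs, H⟩).2 _ _ _ hg₀).not_case3 (hc.2 _ _ _ hg₀)).elim
    · exact H
  -- The condition gives only X ≤ 0, and only for s > 0. This suffices because entering a region is
  -- always witnessed strictly and at a positive time.
  · have key : ∀ s ∈ halfOpen 0 S, 0 < s → curvX (A s) (B s) (C s) ≤ 0 ∧ A s < B s - C s := by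
      intro s hs hs0
      obtain ⟨i1, -, i2⟩ := hall _ _ _ hg₀
      have h1 : -S < ((-s : ℝ) : EReal) := by
        rw [EReal.neg_lt_comm]
        simpa using hs.2
      obtain ⟨j1, j2, j3⟩ := i2 (-s) h1 (by linarith)
      have h2 := hc.2 _ _ _ hg₀ (-s) (by rw [i1]; exact h1) (by linarith)
      simp only [j1, j2, j3, neg_neg] at h2
      obtain ⟨p1, p2, p3⟩ := h.pos s hs.1 hs.2
      exact ⟨(sqrt_le_iff_curvX_nonpos p1 p2 p3).1 h2.1, h2.2⟩
    rcases tri with ⟨s, hs, hs0, H⟩ | ⟨s, hs, hs0, H⟩ | H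
    · exact absurd (key s hs hs0).2 H.not_gt
    · exact absurd (key s hs hs0).1 H.not_ge
    · exact H
  · refine ⟨hp, fun Tb Tf g hg t ht ht0 => ?_⟩
    obtain ⟨i1, -, i2⟩ := hall _ _ _ hg
    rw [i1] at ht
    obtain ⟨j1, j2, j3⟩ := i2 t ht ht0.le
    have hs : -t ∈ halfOpen 0 S := ⟨by linarith, by
      have := EReal.neg_lt_comm.1 ht
      simpa using this⟩
    obtain ⟨p1, p2, p3⟩ := h.pos _ hs.1 hs.2
    obtain ⟨-, hX, hA⟩ := hR _ hs
    simp only [j1, j2, j3]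
    exact ⟨(sqrt_le_iff_curvX_nonpos p1 p2 p3).2 hX.le, hA⟩

/-! ### Openness of the basins and existence of separating points -/

theorem BackOrbit.solvesOn {S : EReal} {A B C : ℝ → ℝ} (h : BackOrbit 0 S A B C) :
    SolvesOn (fun p => -diagField p) octant (fun s => (A s, B s, C s)) (halfOpen 0 S) := by
  intro s hs
  refine ⟨h.pos s hs.1 hs.2, ?_⟩
  refine ((h.derivA s hs.1 hs.2).prodMk
    ((h.derivB s hs.1 hs.2).prodMk (h.derivC s hs.1 hs.2))).congr_deriv ?_
  simp [diagField]

/-- Initial conditions whose orbits enter an open set stay so under small perturbations. -/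
theorem BackOrbit.eventually_enters {S : EReal} {A B C : ℝ → ℝ} (h : BackOrbit 0 S A B C)
    {O : Set (ℝ × ℝ × ℝ)} (hO : IsOpen O) {s : ℝ} (hs : s ∈ halfOpen 0 S)
    (hm : (A s, B s, C s) ∈ O) :
    ∀ᶠ q in 𝓝 (A 0, B 0, C 0), ∀ (S' : EReal) (A' B' C' : ℝ → ℝ), BackOrbit 0 S' A' B' C' →
      (A' 0, B' 0, C' 0) = q → ∃ s ∈ halfOpen 0 S', (A' s, B' s, C' s) ∈ O := by
  have hsub : Icc 0 s ⊆ halfOpen 0 S := fun t ht =>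
    ⟨ht.1, lt_of_le_of_lt (by exact_mod_cast ht.2) hs.2⟩
  filter_upwards [SolvesOn.eventually_mem_of_mem_open isOpen_octant
    (fun _ hx => (contDiffAt_diagField hx).neg) hs.1 (h.solvesOn.mono hsub) hO hm]
    with q hq S' A' B' C' h' h0'
  obtain ⟨h1, h2⟩ := hq S' (fun s => (A' s, B' s, C' s)) (by simpa using h'.lt) h0' h'.solvesOn
    fun T hT x hx hlim => h'.escape T hT x.1 x.2.1 x.2.2 hx.1 hx.2.1 hx.2.2
      hlim.fst_nhds hlim.snd_nhds.fst_nhds hlim.snd_nhds.snd_nhds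
  exact ⟨s, ⟨hs.1, h1⟩, h2⟩

theorem isOpen_initialSet_case1 : IsOpen (initialSet Case1) := by
  rw [isOpen_iff_mem_nhds]
  intro p hp
  obtain ⟨S, A, B, C, h, rfl, e1, -⟩ := exists_classified_orbit hp.1
  obtain ⟨s, hs, H⟩ := e1.1 hp
  filter_upwards [h.eventually_enters (O := {p | p.2.1 - p.2.2 < p.1})
    (isOpen_lt (by fun_prop) (by fun_prop)) hs H, isOpen_Q.mem_nhds hp.1] with q hq hqQ
  obtain ⟨S', A', B', C', h', h0', e1', -⟩ := exists_classified_orbit hqQ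
  exact e1'.2 (hq S' A' B' C' h' h0')

theorem isOpen_initialSet_case2 : IsOpen (initialSet Case2) := by
  rw [isOpen_iff_mem_nhds]
  intro p hp
  obtain ⟨S, A, B, C, h, rfl, -, e1, -⟩ := exists_classified_orbit hp.1
  obtain ⟨s, hs, H⟩ := e1.1 hp
  filter_upwards [h.eventually_enters (O := {p | 0 < curvX p.1 p.2.1 p.2.2})
    (isOpen_lt (by fun_prop) (by unfold curvX; fun_prop)) hs H, isOpen_Q.mem_nhds hp.1] with q hq hqQ
  obtain ⟨S', A', B', C', h', h0', -, e1', -⟩ := exists_classified_orbit hqQ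
  exact e1'.2 (hq S' A' B' C' h' h0')

theorem mem_initialSet_case1_or {p : ℝ × ℝ × ℝ} (hp : p ∈ Q) :
    p ∈ initialSet Case1 ∨ p ∈ initialSet Case2 ∨ p ∈ initialSet Case3 := by
  obtain ⟨S, A, B, C, h, rfl, e1, e2, e3, -⟩ := exists_classified_orbit hp
  rw [e1, e2, e3]
  rcases h.stays_or hp.2.1 with ⟨s, hs, -, H⟩ | ⟨s, hs, -, H⟩ | H
  · exact Or.inl ⟨s, hs, H⟩
  · exact Or.inr (Or.inl ⟨s, hs, H⟩)
  · exact Or.inr (Or.inr H)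

theorem exists_isMaximalXCF {p : ℝ × ℝ × ℝ} (hp : p ∈ Q) :
    ∃ Tb Tf g, IsMaximalXCF p Tb Tf g := by
  obtain ⟨Tb, A, B, C, -, -, ⟨Tf, g, hg⟩, -⟩ := exists_backOrbit (Q_subset_octant hp)
  exact ⟨Tb, Tf, g, hg⟩

/-- `initialSet` quantifies over all maximal solutions, so disjointness rests on the existence of at
least one. -/
theorem disjoint_initialSet {P P' : EReal → (ℝ → ℝ) → (ℝ → ℝ) → (ℝ → ℝ) → Prop}
    (h : ∀ S A B C, P S A B C → ¬ P' S A B C) : Disjoint (initialSet P) (initialSet P') := by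
  rw [Set.disjoint_left]
  intro p h1 h2
  obtain ⟨Tb, Tf, g, hg⟩ := exists_isMaximalXCF h1.1
  exact h _ _ _ _ (h1.2 _ _ _ hg) (h2.2 _ _ _ hg)

theorem initialSet_case3Condition : initialSet Case3Condition = initialSet Case3 := by
  ext p
  by_cases hp : p ∈ Q
  · obtain ⟨S, A, B, C, -, -, -, -, e3, e4⟩ := exists_classified_orbit hp
    rw [e3, e4]
  · exact ⟨fun h => (hp h.1).elim, fun h => (hp h.1).elim⟩

/-- Every slice `b, c = const` contains an initial condition with the third behavior. -/
theorem exists_mem_initialSet_case3 {b c : ℝ} (hc : 0 < c) (hcb : c < b) :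
    ∃ a, (a, b, c) ∈ initialSet Case3 := by
  by_contra! hcon
  have hQ : ∀ {a : ℝ}, 0 < a → (a, b, c) ∈ Q := fun ha => ⟨ha, hcb, hc⟩
  have hcont : Continuous fun a : ℝ => (a, b, c) := by fun_prop
  -- Otherwise the ray a > 0 would be covered by two disjoint open sets, both nonempty: a = b
  -- exceeds b - c, and a small enough makes X positive.
  obtain ⟨a, -, h1, h2⟩ := isPreconnected_Ioi (a := (0 : ℝ)) _ _
    (isOpen_initialSet_case1.preimage hcont) (isOpen_initialSet_case2.preimage hcont)
    (fun a ha => by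
      rcases mem_initialSet_case1_or (hQ ha) with h | h | h
      exacts [Or.inl h, Or.inr h, (hcon a h).elim])
    ⟨b, hc.trans hcb, by
      obtain ⟨S, A, B, C, h, h0, e1, -⟩ := exists_classified_orbit (hQ (hc.trans hcb))
      simp only [Prod.mk.injEq] at h0
      exact e1.2 ⟨0, left_mem_halfOpen h.lt, by rw [h0.1, h0.2.1, h0.2.2]; linarith⟩⟩
    (by
      have hb := hc.trans hcb
      have hD := sub_pos.2 hcb
      -- For 0 < a ≤ 1, 2a(b + c) + 3a² < a(2(b + c) + 4) ≤ (b - c)².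
      set a := min 1 ((b - c) ^ 2 / (2 * (b + c) + 4)) with ha
      have h0 : 0 < a := lt_min one_pos (by positivity)
      have h1 : a ≤ 1 := min_le_left _ _
      have h2 : a * (2 * (b + c) + 4) ≤ (b - c) ^ 2 :=
        (le_div_iff₀ (by positivity)).1 (min_le_right _ _)
      refine ⟨a, h0, ?_⟩
      obtain ⟨S, A, B, C, h, h0', -, e2, -⟩ := exists_classified_orbit (hQ h0)
      simp only [Prod.mk.injEq] at h0'
      refine e2.2 ⟨0, left_mem_halfOpen h.lt, ?_⟩
      rw [h0'.1, h0'.2.1, h0'.2.2]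
      unfold curvX
      nlinarith)
  exact (disjoint_initialSet fun _ _ _ _ h => h.not_case2).le_bot ⟨h1, h2⟩

end SL2XCF

namespace SL2XCF

open Set

/-! ### Orbits between the basins as graphs -/

/-- Allows an orbit to be reparametrized by a strictly increasing quantity, here C/B, carrying
limits at the end time to limits at l. -/
theorem exists_inverse_halfOpen {s₀ : ℝ} {S : EReal} {f : ℝ → ℝ} {l : ℝ} (h : (s₀ : EReal) < S)
    (hf : StrictMonoOn f (halfOpen s₀ S)) (hc : ContinuousOn f (halfOpen s₀ S))
    (hl : Tendsto f (atEnd S) (𝓝 l)) :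
    f s₀ < l ∧ ∃ σ : ℝ → ℝ, (∀ x ∈ Ico (f s₀) l, σ x ∈ halfOpen s₀ S ∧ f (σ x) = x) ∧
      ContinuousOn σ (Ico (f s₀) l) ∧ Tendsto σ (𝓝[<] l) (atEnd S) := by
  have hlt : ∀ s ∈ halfOpen s₀ S, f s < l := by
    intro s hs
    obtain ⟨s', h1, h2⟩ := exists_gt_halfOpen hs.2
    have hs' : s' ∈ halfOpen s₀ S := ⟨hs.1.trans h1.le, h2⟩
    have := atEnd_neBot h
    refine (hf hs hs' h1).trans_le (ge_of_tendsto hl ((eventually_atEnd h).2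
      ⟨s', hs'.1, h2, fun t ht => hf.monotoneOn hs' (halfOpen_mono hs'.1 ht) ht.1⟩))
  have hsurj : ∀ x ∈ Ico (f s₀) l, ∃ s ∈ halfOpen s₀ S, f s = x := by
    intro x hx
    obtain ⟨a, ha, haS, H⟩ := (eventually_atEnd h).1 (hl.eventually (lt_mem_nhds hx.2))
    have hsub : Icc s₀ a ⊆ halfOpen s₀ S := fun t ht =>
      ⟨ht.1, lt_of_le_of_lt (by exact_mod_cast ht.2) haS⟩
    obtain ⟨s, hs, hsx⟩ := intermediate_value_Icc ha (hc.mono hsub)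
      ⟨hx.1, (H a (left_mem_halfOpen haS)).le⟩
    exact ⟨s, hsub hs, hsx⟩
  choose! σ hσ hfσ using hsurj
  refine ⟨hlt _ (left_mem_halfOpen h), σ, fun x hx => ⟨hσ x hx, hfσ x hx⟩, fun x hx => ?_,
    fun P hP => ?_⟩
  · refine tendsto_order.2 ⟨fun a ha => ?_, fun a ha => ?_⟩
    · by_cases has : s₀ ≤ a
      · have hm : a ∈ halfOpen s₀ S := ⟨has, lt_trans (by exact_mod_cast ha) (hσ x hx).2⟩
        have h1 := hf hm (hσ x hx) ha
        rw [hfσ x hx] at h1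
        filter_upwards [self_mem_nhdsWithin, mem_nhdsWithin_of_mem_nhds (lt_mem_nhds h1)] with y hy hy'
        exact (hf.lt_iff_lt hm (hσ y hy)).1 (by rwa [hfσ y hy])
      · filter_upwards [self_mem_nhdsWithin] with y hy
        exact (not_le.1 has).trans_le (hσ y hy).1
    · by_cases haS : (a : EReal) < S
      · have hm : a ∈ halfOpen s₀ S := ⟨(hσ x hx).1.trans ha.le, haS⟩
        have h1 := hf (hσ x hx) hm ha
        rw [hfσ x hx] at h1
        filter_upwards [self_mem_nhdsWithin, mem_nhdsWithin_of_mem_nhds (gt_mem_nhds h1)] with y hy hy'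
        exact (hf.lt_iff_lt (hσ y hy) hm).1 (by rwa [hfσ y hy])
      · filter_upwards [self_mem_nhdsWithin] with y hy
        exact_mod_cast (hσ y hy).2.trans_le (not_lt.1 haS)
  · obtain ⟨a, ha, haS, H⟩ := (eventually_atEnd h).1 hP
    have hm : a ∈ halfOpen s₀ S := ⟨ha, haS⟩
    have h0 : f s₀ ≤ f a := hf.monotoneOn (left_mem_halfOpen h) hm ha
    change σ ⁻¹' P ∈ 𝓝[<] l
    filter_upwards [Ioo_mem_nhdsLT (hlt a hm)] with y hy
    have hy' : y ∈ Ico (f s₀) l := ⟨h0.trans hy.1.le, hy.2⟩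
    refine H _ ⟨?_, (hσ y hy').2⟩
    by_contra! hcon
    have := hf (hσ y hy') hm hcon
    rw [hfσ y hy'] at this
    exact hy.1.not_gt this

/-- The logarithmic derivative of `y = A / B`, up to the factor `1 / x`, as a function of
`x = C / B`. -/
noncomputable def slope (x y : ℝ) : ℝ :=
  curvZ y 1 x * ((y + 1) * (1 - x - y)) / (curvX y 1 x * ((1 - x) * (y + 1 + x)))

/-- After dividing Z and X by y, minus the slope is a quotient of positive factors. As y grows, Z/y
and (y + 1)(1 - x - y) decrease, the second strictly, while -X/y and y + 1 + x increase. -/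
theorem slope_lt_slope {x y₁ y₂ : ℝ} (hx : 0 < x) (hx1 : x < 1) (hy₁ : 0 < y₁) (hy : y₁ < y₂)
    (hyD : y₂ < 1 - x) (hX₁ : curvX y₁ 1 x < 0) :
    slope x y₁ < slope x y₂ := by
  have key : ∀ y : ℝ, 0 < y → slope x y = -(curvZ y 1 x / y * ((y + 1) * (1 - x - y)) /
      (-curvX y 1 x / y * ((1 - x) * (y + 1 + x)))) := by
    intro y hy
    unfold slope
    rw [← neg_inj, neg_neg, ← neg_div, neg_div, ← div_neg]
    rw [show -(curvX y 1 x * ((1 - x) * (y + 1 + x))) =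
      y * (-curvX y 1 x / y * ((1 - x) * (y + 1 + x))) by field_simp,
      show curvZ y 1 x * ((y + 1) * (1 - x - y)) =
      y * (curvZ y 1 x / y * ((y + 1) * (1 - x - y))) by field_simp]
    rw [mul_div_mul_left _ _ hy.ne']
  have hy₂ := hy₁.trans hy
  have hD := sub_pos.2 hx1
  rw [key y₁ hy₁, key y₂ hy₂, neg_lt_neg_iff]
  have hZ₁ := curvZ_pos hy₁ hx hx1
  have hZ₂ := curvZ_pos hy₂ hx hx1
  have hw₁ : 0 < (y₁ + 1) * (1 - x - y₁) := mul_pos (by linarith) (by linarith)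
  have hw₂ : 0 < (y₂ + 1) * (1 - x - y₂) := mul_pos (by linarith) (by linarith)
  have hr₁ : 0 < -curvX y₁ 1 x / y₁ := div_pos (by linarith) hy₁
  have he₁ : 0 < (1 - x) * (y₁ + 1 + x) := mul_pos hD (by linarith)
  have c1 : curvZ y₂ 1 x / y₂ ≤ curvZ y₁ 1 x / y₁ := by
    rw [div_le_div_iff₀ hy₂ hy₁, ← sub_nonneg]
    rw [show curvZ y₁ 1 x * y₂ - curvZ y₂ 1 x * y₁ =
      (y₂ - y₁) * ((1 - x) * (1 + 3 * x) - y₁ * y₂) by unfold curvZ; ring]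
    exact mul_nonneg (by linarith) (by nlinarith)
  have c2 : (y₂ + 1) * (1 - x - y₂) < (y₁ + 1) * (1 - x - y₁) := by nlinarith
  have c3 : -curvX y₁ 1 x / y₁ ≤ -curvX y₂ 1 x / y₂ := by
    rw [div_le_div_iff₀ hy₁ hy₂, ← sub_nonneg]
    rw [show -curvX y₂ 1 x * y₁ - -curvX y₁ 1 x * y₂ =
      (y₂ - y₁) * (3 * y₁ * y₂ + (1 - x) ^ 2) by unfold curvX; ring]
    exact mul_nonneg (by linarith) (by positivity)
  have c4 : (1 - x) * (y₁ + 1 + x) ≤ (1 - x) * (y₂ + 1 + x) := by gcongr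
  refine div_lt_div₀ ?_ (mul_le_mul c3 c4 he₁.le (hr₁.le.trans c3)) ?_ (mul_pos hr₁ he₁)
  · exact mul_lt_mul_of_le_of_lt_of_pos_of_nonneg c1 c2 (div_pos hZ₂ hy₂) hw₁.le
  · exact (mul_pos (div_pos hZ₁ hy₁) hw₁).le

namespace BackOrbit

variable {s₀ : ℝ} {S : EReal} {A B C : ℝ → ℝ}

/-- Both sides are, up to the common factor k, logarithmic derivatives: of A/B on the left and of
C/B times the slope on the right. Homogeneity of the curvatures reduces the quotient to a function
of x and y. -/
theorem slope_div (h : BackOrbit s₀ S A B C) (hR : Stays s₀ S A B C) {s : ℝ}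
    (hs : s ∈ halfOpen s₀ S) :
    curvZ (A s) (B s) (C s) * (curvY (A s) (B s) (C s) - curvX (A s) (B s) (C s)) =
      slope (C s / B s) (A s / B s) * (curvX (A s) (B s) (C s) *
        (curvY (A s) (B s) (C s) - curvZ (A s) (B s) (C s))) := by
  obtain ⟨p1, p2, p3, hcb, hX, hY, hZ, hAD, hk⟩ := h.stays_facts hR hs
  have hD := (sub_pos.2 hcb).ne'
  have hz : curvZ (A s / B s) 1 (C s / B s) = curvZ (A s) (B s) (C s) / B s ^ 2 := by
    unfold curvZ; field_simp
  have hx : curvX (A s / B s) 1 (C s / B s) = curvX (A s) (B s) (C s) / B s ^ 2 := by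
    unfold curvX; field_simp
  have h2 := curvY_sub_curvX (a := A s) (b := B s) (c := C s)
  have h3 : curvY (A s) (B s) (C s) - curvZ (A s) (B s) (C s) =
      -(4 * (B s - C s) * (A s + B s + C s)) := by
    rw [← curvZ_sub_curvY]; ring
  unfold slope
  rw [hz, hx, h2, h3]
  have hs : A s + B s + C s ≠ 0 := by positivity
  have hD' : 1 - C s / B s ≠ 0 := by
    rw [one_sub_div p2.ne']; exact div_ne_zero hD p2.ne'
  have hs' : A s / B s + 1 + C s / B s ≠ 0 := by positivity
  rw [one_sub_div p2.ne', show A s / B s + 1 + C s / B s = (A s + B s + C s) / B s by field_simp]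
  have := hX.ne
  field_simp
  ring

/-- An orbit between the basins as a graph over `x = C / B`. -/
theorem exists_graph (h : BackOrbit s₀ S A B C) (hR : Stays s₀ S A B C) :
    C s₀ / B s₀ < 1 ∧ ∃ y : ℝ → ℝ,
      (∀ x ∈ Ico (C s₀ / B s₀) 1, ∃ s ∈ halfOpen s₀ S, C s / B s = x ∧ A s / B s = y x) ∧
      ContinuousOn y (Ico (C s₀ / B s₀) 1) ∧
      (∀ x ∈ Ioo (C s₀ / B s₀) 1, HasDerivAt y (y x * (slope x (y x) / x)) x) ∧
      y (C s₀ / B s₀) = A s₀ / B s₀ ∧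
      Tendsto (fun x => y x / (1 - x) ^ 2) (𝓝[<] 1) (𝓝 (1 / 2)) := by
  have facts := fun s (hs : s ∈ halfOpen s₀ S) => h.stays_facts hR hs
  obtain ⟨η, hη, hA, hB, hC⟩ := h.exists_tendsto_of_stays hR
  have dx : ∀ s ∈ halfOpen s₀ S, HasDerivAt (fun s => C s / B s) (C s / B s *
      (speed (A s) (B s) (C s) * (curvX (A s) (B s) (C s) *
        (curvY (A s) (B s) (C s) - curvZ (A s) (B s) (C s))))) s := fun s hs =>
    (hasDerivAt_div_of_log (h.hasDerivC hs) (h.hasDerivB hs) (facts s hs).2.1.ne').congr_deriv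
      (by ring)
  have dy : ∀ s ∈ halfOpen s₀ S, HasDerivAt (fun s => A s / B s) (A s / B s *
      (speed (A s) (B s) (C s) * (curvZ (A s) (B s) (C s) *
        (curvY (A s) (B s) (C s) - curvX (A s) (B s) (C s))))) s := fun s hs =>
    (hasDerivAt_div_of_log (h.hasDerivA hs) (h.hasDerivB hs) (facts s hs).2.1.ne').congr_deriv
      (by ring)
  have hpos : ∀ s ∈ halfOpen s₀ S, 0 < speed (A s) (B s) (C s) * (curvX (A s) (B s) (C s) *
        (curvY (A s) (B s) (C s) - curvZ (A s) (B s) (C s))) := by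
    intro s hs
    obtain ⟨p1, p2, p3, hcb, hX, hY, hZ, hAD, hk⟩ := facts s hs
    exact mul_pos hk (mul_pos_of_neg_of_neg hX (by linarith))
  have hmono : StrictMonoOn (fun s => C s / B s) (halfOpen s₀ S) :=
    strictMonoOn_halfOpen dx fun s hs =>
      mul_pos (div_pos (facts s hs).2.2.1 (facts s hs).2.1) (hpos s hs)
  have hlim : Tendsto (fun s => C s / B s) (atEnd S) (𝓝 1) := by
    have := hC.div hB hη.ne'
    rwa [div_self hη.ne'] at this
  obtain ⟨hlt, σ, hσ, hσc, hσl⟩ := exists_inverse_halfOpen h.lt hmono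
    (fun s hs => (dx s hs).continuousAt.continuousWithinAt) hlim
  refine ⟨hlt, fun x => A (σ x) / B (σ x), fun x hx => ⟨σ x, (hσ x hx).1, (hσ x hx).2, rfl⟩,
    ?_, fun x hx => ?_, ?_, ?_⟩
  · exact ContinuousOn.comp (g := fun s => A s / B s)
      (fun s hs => (dy s hs).continuousAt.continuousWithinAt) hσc fun x hx => (hσ x hx).1
  · obtain ⟨hm, hfx⟩ := hσ x ⟨hx.1.le, hx.2⟩
    have hnhds : Ico (C s₀ / B s₀) 1 ∈ 𝓝 x := Ico_mem_nhds hx.1 hx.2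
    have hx0 : 0 < x := by
      rw [← hfx]; exact div_pos (facts _ hm).2.2.1 (facts _ hm).2.1
    have hd := HasDerivAt.of_local_left_inverse (hσc.continuousAt hnhds) (dx _ hm)
      (mul_pos (div_pos (facts _ hm).2.2.1 (facts _ hm).2.1) (hpos _ hm)).ne'
      (by filter_upwards [hnhds] with z hz using (hσ z hz).2)
    refine ((dy _ hm).comp x hd).congr_deriv ?_
    have e := h.slope_div hR hm
    have hp := (hpos _ hm).ne'
    change _ = A (σ x) / B (σ x) * (slope x (A (σ x) / B (σ x)) / x)
    rw [e, hfx]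
    have h1 := left_ne_zero_of_mul hp
    have h2 := right_ne_zero_of_mul hp
    generalize curvX (A (σ x)) (B (σ x)) (C (σ x)) * (curvY (A (σ x)) (B (σ x)) (C (σ x)) -
      curvZ (A (σ x)) (B (σ x)) (C (σ x))) = u at h2 ⊢
    generalize speed (A (σ x)) (B (σ x)) (C (σ x)) = k at h1 ⊢
    generalize A (σ x) / B (σ x) = w
    field_simp
  · obtain ⟨hm, hfx⟩ := hσ _ ⟨le_rfl, hlt⟩
    have := hmono.injOn hm (left_mem_halfOpen h.lt) hfx
    simp only [this]
  -- y/(1 - x)² = AB/(B - C)² = B/q, which tends to η/(2η).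
  · have hq := hB.div (h.tendsto_quot hR hη hA hB hC) (by positivity)
    rw [show η / (2 * η) = 1 / 2 by field_simp] at hq
    refine (hq.comp hσl).congr' ?_
    filter_upwards [Ioo_mem_nhdsLT hlt] with x hx
    obtain ⟨hm, hfx⟩ := hσ x ⟨hx.1.le, hx.2⟩
    obtain ⟨p1, p2, p3, hcb, -⟩ := facts _ hm
    have hD := (sub_pos.2 hcb).ne'
    simp only [Function.comp, Pi.div_apply]
    generalize σ x = s at p1 p2 p3 hD hfx ⊢
    rw [← hfx, one_sub_div p2.ne']
    field_simp

/-- Orbits between the basins are determined, up to scaling, by the initial value of `C / B`. -/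
theorem div_le_of_stays {s₀' : ℝ} {S' : EReal} {A' B' C' : ℝ → ℝ}
    (h : BackOrbit s₀ S A B C) (hR : Stays s₀ S A B C) (h' : BackOrbit s₀' S' A' B' C')
    (hR' : Stays s₀' S' A' B' C') (hx : C s₀ / B s₀ = C' s₀' / B' s₀') :
    A' s₀' / B' s₀' ≤ A s₀ / B s₀ := by
  obtain ⟨hx1, y₁, r₁, c₁, d₁, i₁, l₁⟩ := h.exists_graph hR
  obtain ⟨-, y₂, r₂, c₂, d₂, i₂, l₂⟩ := h'.exists_graph hR'
  rw [← hx] at r₂ c₂ d₂ i₂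
  have hx0 : 0 < C s₀ / B s₀ := by
    obtain ⟨-, p2, p3, -⟩ := h.stays_facts hR (left_mem_halfOpen h.lt)
    exact div_pos p3 p2
  set x₀ := C s₀ / B s₀ with hx₀
  rw [← i₁, ← i₂]
  have facts : ∀ {s₀ : ℝ} {S : EReal} {A B C : ℝ → ℝ} (_ : BackOrbit s₀ S A B C)
      (_ : Stays s₀ S A B C) {x y : ℝ}, (∃ s ∈ halfOpen s₀ S, C s / B s = x ∧ A s / B s = y) →
      0 < y ∧ y < 1 - x ∧ curvX y 1 x < 0 := by
    rintro s₀ S A B C h hR x y ⟨s, hs, rfl, rfl⟩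
    obtain ⟨p1, p2, p3, hcb, hX, hY, hZ, hAD, hk⟩ := h.stays_facts hR hs
    refine ⟨div_pos p1 p2, ?_, ?_⟩
    · rw [one_sub_div p2.ne']; gcongr
    · rw [show curvX (A s / B s) 1 (C s / B s) = curvX (A s) (B s) (C s) / B s ^ 2 by
        unfold curvX; field_simp]
      exact div_neg_of_neg_of_pos hX (by positivity)
  have f₁ := fun x hx => facts h hR (r₁ x hx)
  have f₂ := fun x hx => facts h' hR' (r₂ x hx)
  by_contra! hlt
  -- The comparison starts at an interior point, because the graphs are only known to be
  -- differentiable there.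
  obtain ⟨z, hz, hz'⟩ : ∃ z ∈ Ioo x₀ 1, y₁ z < y₂ z := by
    have hm : x₀ ∈ Ico x₀ 1 := ⟨le_rfl, hx1⟩
    have e1 := ((c₁ x₀ hm).eventually_lt (c₂ x₀ hm) hlt).filter_mono
      (nhdsWithin_mono x₀ Ioo_subset_Ico_self)
    rw [nhdsWithin_Ioo_eq_nhdsGT hx1] at e1
    obtain ⟨z, e2, e3⟩ := (e1.and (Ioo_mem_nhdsGT hx1)).exists
    exact ⟨z, e3, e2⟩
  set u₀ := Real.log (y₂ z) - Real.log (y₁ z) with hu₀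
  have hI : ∀ x ∈ halfOpen z ((1 : ℝ) : EReal), x ∈ Ioo x₀ 1 := fun x hx =>
    ⟨hz.1.trans_le hx.1, by exact_mod_cast hx.2⟩
  have hu0 : 0 < u₀ := sub_pos.2 (Real.log_lt_log (f₁ z ⟨hz.1.le, hz.2⟩).1 hz')
  -- Whenever log(y₂/y₁) equals u₀ > 0, the larger graph has the larger logarithmic slope, so the
  -- ratio never falls back below its value at z. The common asymptotics (1 - x)²/2 force its
  -- logarithm to zero.
  have hgt : ∀ x : ℝ, z < x → (x : EReal) < (1 : ℝ) →
      0 < Real.log (y₂ x) - Real.log (y₁ x) - u₀ := by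
    intro x hzx hx1
    refine pos_of_deriv_pos_at_zero (s₀ := z) (S := ((1 : ℝ) : EReal))
      (f := fun x => Real.log (y₂ x) - Real.log (y₁ x) - u₀)
      (f' := fun x => slope x (y₂ x) / x - slope x (y₁ x) / x) (fun x hx => ?_) (by simp [hu₀])
      (fun x hx h0 => ?_) hzx hx1
    · have hm := Ioo_subset_Ico_self (hI x hx)
      have q1 := (f₁ x hm).1.ne'
      have q2 := (f₂ x hm).1.ne'
      refine ((((d₂ x (hI x hx)).log q2).sub ((d₁ x (hI x hx)).log q1)).sub_const u₀).congr_deriv ?_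
      rw [mul_div_cancel_left₀ _ q2, mul_div_cancel_left₀ _ q1]
    · have hm := Ioo_subset_Ico_self (hI x hx)
      obtain ⟨a1, a2, a3⟩ := f₁ x hm
      obtain ⟨b1, b2, -⟩ := f₂ x hm
      have hx0' : 0 < x := hx0.trans_le hm.1
      have : y₁ x < y₂ x := (Real.log_lt_log_iff a1 b1).1 (by linarith)
      have := slope_lt_slope hx0' hm.2 a1 this b2 a3
      rw [← sub_div]
      exact div_pos (by linarith) hx0'
  have hlim : Tendsto (fun x => Real.log (y₂ x) - Real.log (y₁ x)) (𝓝[<] 1) (𝓝 0) := by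
    have h1 := (l₂.log (by norm_num)).sub (l₁.log (by norm_num))
    rw [sub_self] at h1
    refine h1.congr' ?_
    filter_upwards [Ioo_mem_nhdsLT hx1] with x hx
    have hm := Ioo_subset_Ico_self hx
    have hD : (1 - x) ^ 2 ≠ 0 := pow_ne_zero 2 (sub_pos.2 hx.2).ne'
    rw [Real.log_div (f₂ x hm).1.ne' hD, Real.log_div (f₁ x hm).1.ne' hD]
    ring
  have := ge_of_tendsto (b := u₀) hlim (by
    filter_upwards [Ioo_mem_nhdsLT hz.2] with x hx
    linarith [hgt x hx.1 (by exact_mod_cast hx.2)])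
  linarith

end BackOrbit

end SL2XCF

namespace SL2XCF

open Set

/-! ### The separating hypersurface -/

theorem mem_initialSet_case1_of_sub_lt {p : ℝ × ℝ × ℝ} (hp : p ∈ Q) (h : p.2.1 - p.2.2 < p.1) :
    p ∈ initialSet Case1 := by
  obtain ⟨S, A, B, C, h', rfl, e, -⟩ := exists_classified_orbit hp
  exact e.2 ⟨0, left_mem_halfOpen h'.lt, h⟩

theorem mem_initialSet_case2_of_curvX_pos {p : ℝ × ℝ × ℝ} (hp : p ∈ Q)
    (h : 0 < curvX p.1 p.2.1 p.2.2) : p ∈ initialSet Case2 := by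
  obtain ⟨S, A, B, C, h', rfl, -, e, -⟩ := exists_classified_orbit hp
  exact e.2 ⟨0, left_mem_halfOpen h'.lt, h⟩

/-- The initial conditions of the third behavior form a smooth cone, a graph over the `b, c`
plane. -/
theorem exists_graph_initialSet_case3 : ∃ φ : ℝ → ℝ, ContDiffOn ℝ ∞ φ (Ioo 0 1) ∧
    (∀ x ∈ Ioo (0 : ℝ) 1, 0 < φ x) ∧
    ∀ p ∈ Q, p ∈ initialSet Case3 ↔ p.1 = p.2.1 * φ (p.2.2 / p.2.1) := by
  have hex : ∀ x ∈ Ioo (0 : ℝ) 1, ∃ a, (a, 1, x) ∈ initialSet Case3 := fun x hx =>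
    exists_mem_initialSet_case3 hx.1 hx.2
  choose! φ hφ using hex
  have stays : ∀ x ∈ Ioo (0 : ℝ) 1, ∃ S A B C, BackOrbit 0 S A B C ∧ BackOrbit.Stays 0 S A B C ∧
      A 0 = φ x ∧ B 0 = 1 ∧ C 0 = x := by
    intro x hx
    obtain ⟨S, A, B, C, h, h0, -, -, e, -⟩ := exists_classified_orbit (hφ x hx).1
    simp only [Prod.mk.injEq] at h0
    exact ⟨S, A, B, C, h, e.1 (hφ x hx), h0⟩
  have uniq : ∀ {s₀ : ℝ} {S : EReal} {A B C : ℝ → ℝ}, BackOrbit s₀ S A B C →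
      BackOrbit.Stays s₀ S A B C → C s₀ / B s₀ ∈ Ioo (0 : ℝ) 1 →
      A s₀ / B s₀ = φ (C s₀ / B s₀) := by
    intro s₀ S A B C h hR hx
    obtain ⟨S', A', B', C', h', hR', e1, e2, e3⟩ := stays _ hx
    have e : C s₀ / B s₀ = C' 0 / B' 0 := by rw [e2, e3, div_one]
    have h1 := h.div_le_of_stays hR h' hR' e
    have h2 := h'.div_le_of_stays hR' h hR e.symm
    rw [e1, e2, div_one] at h1 h2
    exact le_antisymm h2 h1
  have hQ : ∀ {p : ℝ × ℝ × ℝ}, p ∈ Q → p.2.2 / p.2.1 ∈ Ioo (0 : ℝ) 1 := fun hp =>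
    ⟨div_pos hp.2.2 (hp.2.2.trans hp.2.1), (div_lt_one (hp.2.2.trans hp.2.1)).2 hp.2.1⟩
  have slice : ∀ p ∈ initialSet Case3, p.1 = p.2.1 * φ (p.2.2 / p.2.1) := by
    intro p hp
    have hb := (hp.1.2.2.trans hp.1.2.1).ne'
    have hx := hQ hp.1
    obtain ⟨S, A, B, C, h, rfl, -, -, e, -⟩ := exists_classified_orbit hp.1
    rw [← uniq h (e.1 hp) hx]
    exact (mul_div_cancel₀ _ hb).symm
  have hfacts : ∀ x ∈ Ioo (0 : ℝ) 1, 0 < φ x ∧ curvX (φ x) 1 x < 0 := by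
    intro x hx
    obtain ⟨S, A, B, C, h, hR, e1, e2, e3⟩ := stays x hx
    obtain ⟨p1, -, -, -, hX, -⟩ := h.stays_facts hR (left_mem_halfOpen h.lt)
    rw [e1, e2, e3] at hX
    exact ⟨e1 ▸ p1, hX⟩
  have hderiv : ∀ x ∈ Ioo (0 : ℝ) 1, HasDerivAt φ (φ x * (slope x (φ x) / x)) x := by
    intro x hx
    -- Starting at x/2 puts x in the interior of the orbit's graph. Every later point of the orbit
    -- is again the start of a staying orbit, so by uniqueness the graph is φ itself.
    obtain ⟨S, A, B, C, h, hR, e1, e2, e3⟩ := stays (x / 2) ⟨half_pos hx.1, by linarith [hx.2, hx.1]⟩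
    obtain ⟨-, y, r, -, d, -⟩ := h.exists_graph hR
    rw [e2, e3, div_one] at r d
    have hm : Ioo (x / 2) 1 ∈ 𝓝 x := Ioo_mem_nhds (by linarith [hx.1]) hx.2
    have heq : ∀ z ∈ Ioo (x / 2) 1, φ z = y z := by
      intro z hz
      obtain ⟨s, hs, f1, f2⟩ := r z (Ioo_subset_Ico_self hz)
      have := uniq (h.restrict hs.1 hs.2) (hR.restrict hs.1)
        (f1 ▸ ⟨(half_pos hx.1).trans hz.1, hz.2⟩)
      rw [f1, f2] at this
      exact this.symm
    have hxm := mem_of_mem_nhds hm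
    rw [heq x hxm]
    exact (d x hxm).congr_of_eventuallyEq (by filter_upwards [hm] with z hz using heq z hz)
  -- Bootstrapping: φ' is a rational expression in x and φ with nonvanishing denominator, so φ gains
  -- one derivative at each step.
  have hsmooth : ContDiffOn ℝ ∞ φ (Ioo 0 1) := by
    rw [contDiffOn_infty]
    intro n
    induction n with
    | zero =>
      exact contDiffOn_zero.2 fun x hx => (hderiv x hx).continuousAt.continuousWithinAt
    | succ n ih =>
      rw [Nat.cast_succ, contDiffOn_succ_iff_deriv_of_isOpen isOpen_Ioo]
      refine ⟨fun x hx => (hderiv x hx).differentiableAt.differentiableWithinAt, by simp, ?_⟩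
      have hden : ∀ x ∈ Ioo (0 : ℝ) 1, curvX (φ x) 1 x * ((1 - x) * (φ x + 1 + x)) ≠ 0 := by
        intro x hx
        have := hfacts x hx
        exact mul_ne_zero this.2.ne (mul_ne_zero (sub_pos.2 hx.2).ne'
          (by have := hx.1; linarith : 0 < φ x + 1 + x).ne')
      have hx0 : ∀ x ∈ Ioo (0 : ℝ) 1, x ≠ 0 := fun x hx => hx.1.ne'
      refine ContDiffOn.congr (f := fun x => φ x * (slope x (φ x) / x)) ?_
        fun x hx => (hderiv x hx).deriv
      unfold slope curvX curvZ at *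
      refine ih.mul (ContDiffOn.div (ContDiffOn.div ?_ ?_ hden) contDiffOn_id hx0) <;> fun_prop
  refine ⟨φ, hsmooth, fun x hx => (hfacts x hx).1, fun p hp => ⟨slice p, fun h => ?_⟩⟩
  -- The slice through p contains some point of the third set; its first coordinate is forced to be
  -- bφ(c/b), so it is p.
  obtain ⟨a, ha⟩ := exists_mem_initialSet_case3 hp.2.2 hp.2.1
  have := slice _ ha
  simp only at this
  rw [← h] at this
  rwa [this] at ha

/-! ### The graph as a hypersurface and its two connected sides -/

theorem isSmoothEmbeddedHypersurface_graph {φ : ℝ → ℝ} (hφ : ContDiffOn ℝ ∞ φ (Ioo 0 1))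
    {S : Set (ℝ × ℝ × ℝ)} (hSQ : S ⊆ Q)
    (hS : ∀ p ∈ Q, p ∈ S ↔ p.1 = p.2.1 * φ (p.2.2 / p.2.1)) :
    IsSmoothEmbeddedHypersurface S := by
  have hb : ∀ p ∈ Q, p.2.1 ≠ 0 := fun p hp => (hp.2.2.trans hp.2.1).ne'
  have hsm : ContDiffOn ℝ ∞ (fun p : ℝ × ℝ × ℝ => p.1 - p.2.1 * φ (p.2.2 / p.2.1)) Q := by
    refine contDiffOn_fst.sub (ContDiffOn.mul (by fun_prop) (hφ.comp
      (ContDiffOn.div (by fun_prop) (by fun_prop) hb) fun p hp => ?_))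
    exact ⟨div_pos hp.2.2 (hp.2.2.trans hp.2.1), (div_lt_one (hp.2.2.trans hp.2.1)).2 hp.2.1⟩
  refine fun p hp => ⟨Q, isOpen_Q, hSQ hp, _, hsm, fun x hx h0 => ?_, ?_⟩
  -- The defining function a - bφ(c/b) has derivative 1 in the direction of a.
  · have hd := ((hsm.contDiffAt (isOpen_Q.mem_nhds hx)).differentiableAt (by simp)).hasFDerivAt
    rw [h0] at hd
    have h1 := hd.comp_hasDerivAt_of_eq x.1 ((hasDerivAt_id x.1).prodMk (hasDerivAt_const x.1 x.2))
      (by rfl)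
    have h2 := (hasDerivAt_id x.1).sub_const (x.2.1 * φ (x.2.2 / x.2.1))
    have := h1.unique h2
    simp at this
  · ext q
    simp only [mem_inter_iff, mem_ofPred_eq, sub_eq_zero]
    exact ⟨fun h => ⟨h.2, (hS q h.2).1 h.1⟩, fun h => ⟨(hS q h.1).2 h.2, h.1⟩⟩

/-- The region is the continuous image of a product of intervals under (s, b, x) ↦ (bφ(x) + s, b,
bx). -/
theorem isPreconnected_above_graph {φ : ℝ → ℝ} (hφ : ContinuousOn φ (Ioo 0 1))
    (hpos : ∀ x ∈ Ioo (0 : ℝ) 1, 0 < φ x) :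
    IsPreconnected {p | p ∈ Q ∧ p.2.1 * φ (p.2.2 / p.2.1) < p.1} := by
  have hc : IsPreconnected (Ioi (0 : ℝ) ×ˢ Ioi (0 : ℝ) ×ˢ Ioo (0 : ℝ) 1) :=
    isPreconnected_Ioi.prod (isPreconnected_Ioi.prod isPreconnected_Ioo)
  have hc' : ContinuousOn (fun q : ℝ × ℝ × ℝ => (q.2.1 * φ q.2.2 + q.1, q.2.1, q.2.1 * q.2.2))
      (Ioi (0 : ℝ) ×ˢ Ioi (0 : ℝ) ×ˢ Ioo (0 : ℝ) 1) := by
    have : ContinuousOn (fun q : ℝ × ℝ × ℝ => φ q.2.2)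
        (Ioi (0 : ℝ) ×ˢ Ioi (0 : ℝ) ×ˢ Ioo (0 : ℝ) 1) :=
      hφ.comp (by fun_prop) fun q hq => hq.2.2
    exact ((ContinuousOn.mul (by fun_prop) this).add (by fun_prop)).prodMk (by fun_prop)
  convert hc.image _ hc' using 1
  ext ⟨a, b, c⟩
  simp only [Q, mem_ofPred_eq, mem_image, mem_prod, mem_Ioi, mem_Ioo, Prod.exists, Prod.mk.injEq]
  constructor
  · rintro ⟨⟨ha, hcb, hc⟩, h⟩
    have hb := hc.trans hcb
    exact ⟨a - b * φ (c / b), b, c / b, ⟨sub_pos.2 h, hb, div_pos hc hb, (div_lt_one hb).2 hcb⟩,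
      by ring, rfl, mul_div_cancel₀ _ hb.ne'⟩
  · rintro ⟨s, b', x, ⟨hs, hb, hx, hx1⟩, rfl, rfl, rfl⟩
    rw [mul_div_cancel_left₀ _ hb.ne']
    have := mul_pos hb (hpos x ⟨hx, hx1⟩)
    exact ⟨⟨by linarith, mul_lt_of_lt_one_right hb hx1, mul_pos hb hx⟩, by linarith⟩

/-- Here the height is scaled rather than shifted, a = s·bφ(x) with 0 < s < 1, so that a > 0 is
kept. -/
theorem isPreconnected_below_graph {φ : ℝ → ℝ} (hφ : ContinuousOn φ (Ioo 0 1))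
    (hpos : ∀ x ∈ Ioo (0 : ℝ) 1, 0 < φ x) :
    IsPreconnected {p | p ∈ Q ∧ p.1 < p.2.1 * φ (p.2.2 / p.2.1)} := by
  have hc : IsPreconnected (Ioo (0 : ℝ) 1 ×ˢ Ioi (0 : ℝ) ×ˢ Ioo (0 : ℝ) 1) :=
    isPreconnected_Ioo.prod (isPreconnected_Ioi.prod isPreconnected_Ioo)
  have hc' : ContinuousOn (fun q : ℝ × ℝ × ℝ => (q.1 * (q.2.1 * φ q.2.2), q.2.1, q.2.1 * q.2.2))
      (Ioo (0 : ℝ) 1 ×ˢ Ioi (0 : ℝ) ×ˢ Ioo (0 : ℝ) 1) := by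
    have : ContinuousOn (fun q : ℝ × ℝ × ℝ => φ q.2.2)
        (Ioo (0 : ℝ) 1 ×ˢ Ioi (0 : ℝ) ×ˢ Ioo (0 : ℝ) 1) :=
      hφ.comp (by fun_prop) fun q hq => hq.2.2
    exact (ContinuousOn.mul (by fun_prop) (ContinuousOn.mul (by fun_prop) this)).prodMk (by fun_prop)
  convert hc.image _ hc' using 1
  ext ⟨a, b, c⟩
  simp only [Q, mem_ofPred_eq, mem_image, mem_prod, mem_Ioi, mem_Ioo, Prod.exists, Prod.mk.injEq]
  constructor
  · rintro ⟨⟨ha, hcb, hc⟩, h⟩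
    have hb := hc.trans hcb
    have h0 := ha.trans h
    exact ⟨a / (b * φ (c / b)), b, c / b, ⟨⟨div_pos ha h0, (div_lt_one h0).2 h⟩, hb, div_pos hc hb,
      (div_lt_one hb).2 hcb⟩, div_mul_cancel₀ _ h0.ne', rfl, mul_div_cancel₀ _ hb.ne'⟩
  · rintro ⟨s, b', x, ⟨⟨hs, hs1⟩, hb, hx, hx1⟩, rfl, rfl, rfl⟩
    rw [mul_div_cancel_left₀ _ hb.ne']
    have := mul_pos hb (hpos x ⟨hx, hx1⟩)
    exact ⟨⟨mul_pos hs this, mul_lt_of_lt_one_right hb hx1, mul_pos hb hx⟩,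
      mul_lt_of_lt_one_left this hs1⟩

theorem componentsOf_union {E : Type*} [TopologicalSpace E] {U V : Set E} (hU : IsOpen U)
    (hV : IsOpen V) (hUV : Disjoint U V) (hU' : IsConnected U) (hV' : IsConnected V) :
    componentsOf (U ∪ V) = {U, V} := by
  have key : ∀ {U V : Set E}, IsOpen U → IsOpen V → Disjoint U V → IsPreconnected U →
      ∀ x ∈ U, connectedComponentIn (U ∪ V) x = U := by
    intro U V hU hV hUV hU' x hx
    have hxm : x ∈ U ∪ V := Or.inl hx
    refine Subset.antisymm ?_ (hU'.subset_connectedComponentIn hx subset_union_left)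
    exact isPreconnected_connectedComponentIn.subset_left_of_subset_union hU hV hUV
      (connectedComponentIn_subset _ _) ⟨x, mem_connectedComponentIn hxm, hx⟩
  have hr : ∀ x ∈ V, connectedComponentIn (U ∪ V) x = V := fun x hx => by
    rw [union_comm]
    exact key hV hU hUV.symm hV'.isPreconnected x hx
  have hl := key hU hV hUV hU'.isPreconnected
  ext Y
  simp only [componentsOf, mem_ofPred_eq, mem_insert_iff, mem_singleton_iff]
  constructor
  · rintro ⟨x, hx | hx, rfl⟩
    exacts [Or.inl (hl x hx), Or.inr (hr x hx)]
  · rintro (rfl | rfl)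
    · obtain ⟨x, hx⟩ := hU'.nonempty
      exact ⟨x, Or.inl hx, (hl x hx).symm⟩
    · obtain ⟨x, hx⟩ := hV'.nonempty
      exact ⟨x, Or.inr hx, (hr x hx).symm⟩

theorem disjoint_initialSet_case1_case2 : Disjoint (initialSet Case1) (initialSet Case2) :=
  disjoint_initialSet fun _ _ _ _ h => h.not_case2

theorem Q_diff_initialSet_case3 :
    Q \ initialSet Case3 = initialSet Case1 ∪ initialSet Case2 := by
  ext p
  constructor
  · rintro ⟨hp, h3⟩
    rcases mem_initialSet_case1_or hp with h | h | h
    exacts [Or.inl h, Or.inr h, (h3 h).elim]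
  · rintro (h | h)
    · exact ⟨h.1, (disjoint_initialSet fun _ _ _ _ h => h.not_case3).notMem_of_mem_left h⟩
    · exact ⟨h.1, (disjoint_initialSet fun _ _ _ _ h => h.not_case3).notMem_of_mem_left h⟩

/-- The basins of the first two behaviors lie on the two sides of a graph. -/
theorem initialSet_eq_of_graph {φ : ℝ → ℝ} (hφ : ContinuousOn φ (Ioo 0 1))
    (hpos : ∀ x ∈ Ioo (0 : ℝ) 1, 0 < φ x)
    (hS : ∀ p ∈ Q, p ∈ initialSet Case3 ↔ p.1 = p.2.1 * φ (p.2.2 / p.2.1)) :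
    initialSet Case1 = {p | p ∈ Q ∧ p.2.1 * φ (p.2.2 / p.2.1) < p.1} ∧
    initialSet Case2 = {p | p ∈ Q ∧ p.1 < p.2.1 * φ (p.2.2 / p.2.1)} := by
  have hhalf : (1 / 2 : ℝ) ∈ Ioo (0 : ℝ) 1 := by norm_num
  have h0 := hpos _ hhalf
  have hcover : ∀ p ∈ Q, p.1 ≠ p.2.1 * φ (p.2.2 / p.2.1) →
      p ∈ initialSet Case1 ∪ initialSet Case2 := fun p hp hne => by
    rw [← Q_diff_initialSet_case3]
    exact ⟨hp, fun h => hne ((hS p hp).1 h)⟩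
  -- A connected side covered by two disjoint open basins lies in one of them; a test point with b =
  -- 1, c = 1/2 decides which.
  have hup : {p | p ∈ Q ∧ p.2.1 * φ (p.2.2 / p.2.1) < p.1} ⊆ initialSet Case1 := by
    have hq : (1 + φ (1 / 2), (1 : ℝ), (1 / 2 : ℝ)) ∈ Q :=
      ⟨by simp only; linarith, by norm_num, by norm_num⟩
    refine (isPreconnected_above_graph hφ hpos).subset_left_of_subset_union isOpen_initialSet_case1
      isOpen_initialSet_case2 disjoint_initialSet_case1_case2 (fun p hp => hcover p hp.1 hp.2.ne')
      ⟨_, ⟨hq, ?_⟩, mem_initialSet_case1_of_sub_lt hq ?_⟩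
    · simp only [one_mul, div_one]
      linarith
    · simp only
      linarith
  have hdown : {p | p ∈ Q ∧ p.1 < p.2.1 * φ (p.2.2 / p.2.1)} ⊆ initialSet Case2 := by
    have h1 : 0 < min (φ (1 / 2) / 2) (1 / 100) := lt_min (by linarith) (by norm_num)
    have hq : (min (φ (1 / 2) / 2) (1 / 100), (1 : ℝ), (1 / 2 : ℝ)) ∈ Q :=
      ⟨h1, by norm_num, by norm_num⟩
    refine (isPreconnected_below_graph hφ hpos).subset_right_of_subset_union isOpen_initialSet_case1
      isOpen_initialSet_case2 disjoint_initialSet_case1_case2 (fun p hp => hcover p hp.1 hp.2.ne)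
      ⟨_, ⟨hq, ?_⟩, mem_initialSet_case2_of_curvX_pos hq ?_⟩
    · simp only [one_mul, div_one]
      exact (min_le_left _ _).trans_lt (by linarith)
    · have h2 := min_le_right (φ (1 / 2) / 2) (1 / 100 : ℝ)
      simp only
      unfold curvX
      nlinarith
  refine ⟨Subset.antisymm (fun p hp => ⟨hp.1, ?_⟩) hup, Subset.antisymm (fun p hp => ⟨hp.1, ?_⟩) hdown⟩
  · have hm : p ∈ Q \ initialSet Case3 := by rw [Q_diff_initialSet_case3]; exact Or.inl hp
    rcases lt_trichotomy p.1 (p.2.1 * φ (p.2.2 / p.2.1)) with h | h | h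
    · exact (disjoint_initialSet_case1_case2.notMem_of_mem_left hp (hdown ⟨hp.1, h⟩)).elim
    · exact (hm.2 ((hS p hp.1).2 h)).elim
    · exact h
  · have hm : p ∈ Q \ initialSet Case3 := by rw [Q_diff_initialSet_case3]; exact Or.inr hp
    rcases lt_trichotomy p.1 (p.2.1 * φ (p.2.2 / p.2.1)) with h | h | h
    · exact h
    · exact (hm.2 ((hS p hp.1).2 h)).elim
    · exact (disjoint_initialSet_case1_case2.notMem_of_mem_left (hup ⟨hp.1, h⟩) hp).elim

end SL2XCF

/-! ### Assembly of the theorem -/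

theorem theorem3p3 :
    -- every initial metric has a maximal solution, and maximal solutions stay diagonal
    (∀ p ∈ SL2XCF.Q,
      (∃ (Tb Tf : EReal) (g : ℝ → Matrix (Fin 3) (Fin 3) ℝ), SL2XCF.IsMaximalXCF p Tb Tf g) ∧
      ∀ (Tb Tf : EReal) (g : ℝ → Matrix (Fin 3) (Fin 3) ℝ), SL2XCF.IsMaximalXCF p Tb Tf g →
        ∀ t ∈ SL2XCF.timeInterval Tb Tf, (g t).IsDiag) ∧
    -- generic behavior
    (∃ Q₀ : Set (ℝ × ℝ × ℝ), Q₀ ⊆ SL2XCF.Q ∧ IsOpen Q₀ ∧ SL2XCF.Q ⊆ closure Q₀ ∧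
      ∀ p ∈ Q₀, ∀ (Tb Tf : EReal) (g : ℝ → Matrix (Fin 3) (Fin 3) ℝ),
        SL2XCF.IsMaximalXCF p Tb Tf g →
          SL2XCF.Case1 Tb (fun t => g t 0 0) (fun t => g t 1 1) (fun t => g t 2 2) ∨
          SL2XCF.Case2 Tb (fun t => g t 0 0) (fun t => g t 1 1) (fun t => g t 2 2)) ∧
    -- the separating hypersurface
    ∃ S₀ : Set (ℝ × ℝ × ℝ), S₀ ⊆ SL2XCF.Q ∧ SL2XCF.IsSmoothEmbeddedHypersurface S₀ ∧
      SL2XCF.initialSet SL2XCF.Case1 ≠ SL2XCF.initialSet SL2XCF.Case2 ∧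
      SL2XCF.componentsOf (SL2XCF.Q \ S₀) =
        {SL2XCF.initialSet SL2XCF.Case1, SL2XCF.initialSet SL2XCF.Case2} ∧
      S₀ = SL2XCF.initialSet SL2XCF.Case3 ∧
      S₀ = SL2XCF.initialSet SL2XCF.Case3Condition := by
  obtain ⟨φ, hφ, hpos, hS⟩ := SL2XCF.exists_graph_initialSet_case3
  obtain ⟨h1, h2⟩ := SL2XCF.initialSet_eq_of_graph hφ.continuousOn hpos hS
  have hhalf := hpos (1 / 2) (by norm_num)
  have c1 : IsConnected (SL2XCF.initialSet SL2XCF.Case1) := by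
    refine ⟨⟨((1 : ℝ), (1 : ℝ), (1 / 2 : ℝ)),
      SL2XCF.mem_initialSet_case1_of_sub_lt ⟨?_, ?_, ?_⟩ ?_⟩, ?_⟩
    iterate 4 norm_num
    rw [h1]
    exact SL2XCF.isPreconnected_above_graph hφ.continuousOn hpos
  have c2 : IsConnected (SL2XCF.initialSet SL2XCF.Case2) := by
    refine ⟨⟨((1 / 100 : ℝ), (1 : ℝ), (1 / 2 : ℝ)),
      SL2XCF.mem_initialSet_case2_of_curvX_pos ⟨?_, ?_, ?_⟩ ?_⟩, ?_⟩
    iterate 4 norm_num [SL2XCF.curvX]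
    rw [h2]
    exact SL2XCF.isPreconnected_below_graph hφ.continuousOn hpos
  refine ⟨fun p hp => ?_, ⟨SL2XCF.initialSet SL2XCF.Case1 ∪ SL2XCF.initialSet SL2XCF.Case2,
    Set.union_subset (fun _ h => h.1) (fun _ h => h.1),
    SL2XCF.isOpen_initialSet_case1.union SL2XCF.isOpen_initialSet_case2, fun p hp => ?_, ?_⟩,
    SL2XCF.initialSet SL2XCF.Case3, fun _ h => h.1,
    SL2XCF.isSmoothEmbeddedHypersurface_graph hφ (fun _ h => h.1) hS, fun he => ?_, ?_, rfl,
    SL2XCF.initialSet_case3Condition.symm⟩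
  · obtain ⟨Tb, A, B, C, -, -, ⟨Tf, g, hg⟩, hall⟩ :=
      SL2XCF.exists_backOrbit (SL2XCF.Q_subset_octant hp)
    exact ⟨⟨Tb, Tf, g, hg⟩, fun Tb' Tf' g' hg' => (hall Tb' Tf' g' hg').2.1⟩
  · by_cases h3 : p ∈ SL2XCF.initialSet SL2XCF.Case3
    -- Density: raising a slightly moves a point of the graph to its upper side, the first basin.
    · have hlim : Tendsto (fun t : ℝ => (p.1 + t, p.2)) (𝓝[>] 0) (𝓝 p) := by
        have : Tendsto (fun t : ℝ => (p.1 + t, p.2)) (𝓝 0) (𝓝 (p.1 + 0, p.2)) :=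
          (Continuous.prodMk (by fun_prop) continuous_const).tendsto 0
        rw [add_zero] at this
        exact this.mono_left nhdsWithin_le_nhds
      refine mem_closure_of_tendsto hlim ?_
      filter_upwards [self_mem_nhdsWithin] with t ht
      have ht0 : 0 < t := ht
      refine Or.inl ?_
      rw [h1]
      have he := (hS p hp).1 h3
      refine ⟨⟨?_, hp.2⟩, ?_⟩
      · have := hp.1
        simp only
        linarith
      · simp only
        linarith
    · exact subset_closure (SL2XCF.Q_diff_initialSet_case3 ▸ ⟨hp, h3⟩)
  · rintro p (h | h) Tb Tf g hg
    · exact Or.inl (h.2 Tb Tf g hg)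
    · exact Or.inr (h.2 Tb Tf g hg)
  · obtain ⟨q, hq⟩ := c1.nonempty
    exact SL2XCF.disjoint_initialSet_case1_case2.notMem_of_mem_left hq (he ▸ hq)
  · rw [SL2XCF.Q_diff_initialSet_case3]
    exact SL2XCF.componentsOf_union SL2XCF.isOpen_initialSet_case1 SL2XCF.isOpen_initialSet_case2
      SL2XCF.disjoint_initialSet_case1_case2 c1 c2
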